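/- Fix integers $N\ge 1$ and $p_1,p_2,p_3\ge 0$. Let $\gamma_N=(1\,2\,\dots\,N)$, let permutations compose from right to left, and let $\Sigma_n$ be the symmetric group on $[n]=\{1,\dots,n\}$. **Partitioned 3-cacti.** $CC(p_1,p_2,p_3,N)$ is the set of 5-tuples $(\pi_1,\pi_2,\pi_3,\alpha_1,\alpha_2)$ where $\pi_1,\pi_2,\pi_3$ are partitions of $[N]$ into $p_1,p_2,p_3$ blocks and $\alpha_1,\alpha_2\in\Sigma_N$ are such that every block of $\pi_1$, $\pi_2$, $\pi_3$ is a union of cycles of $\alpha_1$, $\alpha_2$, $\alpha_3:=\alpha_2^{-1}\alpha_1^{-1}\gamma_N$ respectively. The blocks of $\pi_1,\pi_2,\pi_3$ are called white, black and grey. **Cactus trees.** $CT(p_1,p_2,p_3,a,b,c)$ is the set of rooted ordered (plane) cactus trees whose polygons are edges and triangles, with a white root, such that the polygons descending from a vertex form a sequence ordered from left to right; a descending edge of a white (black, grey) vertex leads to a black (grey, white) vertex, and a descending triangle rooted in a vertex $u$ consists of $u$, a child $v$ of $u$ and the rightmost child $w$ of $v$, with colors following the cyclic order white, black, grey along $u,v,w$,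 and no parent-child edge belongs to two triangles; with $p_1$ white, $p_2$ black, $p_3$ grey vertices, and $a$, $b$, $c$ triangles rooted in a grey, white, black vertex respectively. **The set $I$.** $I(p_1,p_2,p_3,N)$ is the set of 7-tuples $(\tau,S_0,S_1,S_2,\chi,\sigma_1,\sigma_2)$ such that, for some $a,b,c\ge 0$: $\tau\in CT(p_1,p_2,p_3,a,b,c)$; $S_0\subseteq[N]$ with $|S_0|=p_1-1+p_2-a$; $S_1\subseteq[N-1]$ with $|S_1|=p_1-1+p_3-1-c$; $S_2\subseteq[N-1]$ with $|S_2|=p_2+p_3-1-b$; $\chi$ is a sequence of $p_3-b-c$ distinct elements of $[N]\setminus S_0$; $\sigma_1\in\Sigma_{N-p_1+1-p_3+c}$ and $\sigma_2\in\Sigma_{N-p_2-p_3+b}$ (there is no such tuple for triples $(a,b,c)$ making one of these sizes negative). **The map $\Theta$.** Let $(\pi_1,\pi_2,\pi_3,\alpha_1,\alpha_2)\in CC(p_1,p_2,p_3,N)$. Put $\theta_1=\mathrm{id}$, $\theta_2=\alpha_3^{-1}\alpha_2^{-1}$, $\theta_3=\alpha_3^{-1}$. For a block $B$ of $\pi_i$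 let $\ell(B)=\theta_i^{-1}(\max\theta_i(B))$. The root is the white block containing $1$. Let $L_1,L_2,L_3$ be the sets of all $\ell(B)$ for $B$ a white block other than the root, a black block, a grey block respectively. * The tree $T$ has the blocks of $\pi_1,\pi_2,\pi_3$ as vertices. The children of a block $B$ of $\pi_i$ are the non-root blocks $D$ of $\pi_{i+1}$ (indices modulo $3$) with $\ell(D)\in B$, ordered from left to right by increasing $\theta_i(\ell(D))$. The cactus tree $\tau$ is $T$ without labels, with a triangle formed by a non-root vertex $B$, its parent and its rightmost child $D$ whenever $\ell(B)=\ell(D)$. * List the vertices of each color level by level, from the level farthest from the root to the level nearest to the root, each level from left to right. For $i=1,2,3$, write the sets $\theta_i(B)$ for the blocks $B$ of $\pi_i$ one after the other in this order, each in increasing order, and let $\lambda_i\in\Sigma_N$ send the $r$-th letter of the resulting word to $r$. * $S_0=\lambda_1(L_1\cup L_2)$, $\bar S_1=\lambda_3\theta_3(L_3\cup L_1)$, $\bar S_2=\lambda_2\theta_2(L_2\cup L_3)$, $S_1=\bar S_1\setminus\{N\}$, $S_2=\bar S_2\setminus\{N\}$. * $\chi$ is the sequence of the $\lambda_1(\ell(B))$,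 for the grey blocks $B$ in the above order with $\ell(B)\notin L_1\cup L_2$. * $\sigma_1$ (resp. $\sigma_2$) is the permutation obtained from the bijection $\lambda_3\theta_3\lambda_1^{-1}:[N]\setminus\lambda_1(L_1\cup L_3)\to[N]\setminus\bar S_1$ (resp. $\lambda_2\theta_2\lambda_1^{-1}:[N]\setminus\lambda_1(L_2\cup L_3)\to[N]\setminus\bar S_2$) by replacing each element of the source and of the target with its rank in that set. **Theorem.** The map $\Theta:(\pi_1,\pi_2,\pi_3,\alpha_1,\alpha_2)\mapsto(\tau,S_0,S_1,S_2,\chi,\sigma_1,\sigma_2)$ is a bijection from $CC(p_1,p_2,p_3,N)$ onto $I(p_1,p_2,p_3,N)$. -/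

import Mathlib

namespace Cacti

/-- The three colors of the vertices of a 3-cactus. -/
inductive Color
  | white
  | black
  | grey
  deriving DecidableEq

/-- The cyclic order white - black - grey - white of the colors. -/
def Color.next : Color → Color
  | .white => .black
  | .black => .grey
  | .grey => .white

/-! ### Partitioned 3-cacti

The set `[N] = {1, ..., N}` is modelled by `Fin N`: the integer `i` is the element with value
`i - 1`.  The long cycle `γ_N = (1 2 ... N)` is then `finRotate N`. -/

/-- A 5-tuple `(π₁, π₂, π₃, α₁, α₂)` of three partitions of `[N]` and two permutations of `[N]`. -/
structure FiveTuple (N : ℕ) where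
  π₁ : Finpartition (Finset.univ : Finset (Fin N))
  π₂ : Finpartition (Finset.univ : Finset (Fin N))
  π₃ : Finpartition (Finset.univ : Finset (Fin N))
  α₁ : Equiv.Perm (Fin N)
  α₂ : Equiv.Perm (Fin N)

/-- `α₃ = α₂⁻¹ ∘ α₁⁻¹ ∘ γ_N`. -/
def FiveTuple.α₃ {N : ℕ} (C : FiveTuple N) : Equiv.Perm (Fin N) :=
  C.α₂⁻¹ * C.α₁⁻¹ * finRotate N

/-- Each block of the partition `P` is a union of cycles of `α`. -/
def BlocksAreUnionsOfCycles {N : ℕ} (P : Finpartition (Finset.univ : Finset (Fin N)))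
    (α : Equiv.Perm (Fin N)) : Prop :=
  ∀ B ∈ P.parts, ∀ x ∈ B, ∀ y, α.SameCycle x y → y ∈ B

/-- The set `CC(p₁, p₂, p₃, N)` of partitioned 3-cacti with `N` triangles, `p₁` white, `p₂` black
and `p₃` grey blocks. -/
def CC (p₁ p₂ p₃ N : ℕ) : Set (FiveTuple N) :=
  {C | C.π₁.parts.card = p₁ ∧ C.π₂.parts.card = p₂ ∧ C.π₃.parts.card = p₃ ∧
    BlocksAreUnionsOfCycles C.π₁ C.α₁ ∧
    BlocksAreUnionsOfCycles C.π₂ C.α₂ ∧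
    BlocksAreUnionsOfCycles C.π₃ C.α₃}

/-! ### Cactus trees -/

/-- Rooted ordered cactus trees whose polygons are edges and triangles.  The descending polygons of
the root are listed from left to right:
* `leaf` is a root without descending polygon;
* `edge t rest` is the cactus tree `rest` to whose root a new leftmost descending edge is added,
  leading to the root of `t`;
* `triangle t u rest` is the cactus tree `rest` to whose root a new leftmost descending triangle is
  added; the two other vertices of this triangle are the root `v` of `t` and the root `w` of `u`.
  As a tree, `v` is a descendant of the root and `w` is the rightmost descendant of `v` (to the
  right of all descendants of `v` inside `t`).

Colors are not recorded: a child of a vertex of color `c` has color `c.next`, so the color of the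
root determines all the colors. -/
inductive CactusTree
  | leaf : CactusTree
  | edge (t rest : CactusTree) : CactusTree
  | triangle (t u rest : CactusTree) : CactusTree
  deriving DecidableEq

/-- Number of vertices of color `d` in a cactus tree whose root has color `c`. -/
def CactusTree.numVertices (d : Color) : Color → CactusTree → ℕ
  | c, .leaf => if c = d then 1 else 0
  | c, .edge t rest => t.numVertices d c.next + rest.numVertices d c
  | c, .triangle t u rest =>
      t.numVertices d c.next + u.numVertices d c.next.next + rest.numVertices d c

/-- Number of triangles rooted in a vertex of color `d`, in a cactus tree whose root has
color `c`. -/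
def CactusTree.numTriangles (d : Color) : Color → CactusTree → ℕ
  | _, .leaf => 0
  | c, .edge t rest => t.numTriangles d c.next + rest.numTriangles d c
  | c, .triangle t u rest =>
      (if c = d then 1 else 0) +
        (t.numTriangles d c.next + u.numTriangles d c.next.next + rest.numTriangles d c)

/-- The set `CT(p₁, p₂, p₃, a, b, c)` of cactus trees with a white root, `p₁` white, `p₂` black and
`p₃` grey vertices, and `a` triangles rooted in a grey vertex, `b` triangles rooted in a white
vertex, `c` triangles rooted in a black vertex. -/
def CT (p₁ p₂ p₃ a b c : ℕ) : Set CactusTree :=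
  {τ | τ.numVertices .white .white = p₁ ∧ τ.numVertices .black .white = p₂ ∧
    τ.numVertices .grey .white = p₃ ∧ τ.numTriangles .grey .white = a ∧
    τ.numTriangles .white .white = b ∧ τ.numTriangles .black .white = c}

/-! ### The target set -/

/-- A 7-tuple `(τ, S₀, S₁, S₂, χ, σ₁, σ₂)`.  A permutation in `Σ_n` is recorded together
with `n`. -/
structure SevenTuple (N : ℕ) where
  τ : CactusTree
  S₀ : Finset (Fin N)
  S₁ : Finset (Fin N)
  S₂ : Finset (Fin N)
  χ : List (Fin N)
  σ₁ : (n : ℕ) × Equiv.Perm (Fin n)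
  σ₂ : (n : ℕ) × Equiv.Perm (Fin n)

/-- The set `I(p₁, p₂, p₃, N)`.  All sizes are written without subtraction, so that no tuple is
allowed when a prescribed size is negative:
`|S₀| = p₁ - 1 + p₂ - a`, `S₁ ⊆ [N-1]` and `|S₁| = p₁ - 1 + p₃ - 1 - c`,
`S₂ ⊆ [N-1]` and `|S₂| = p₃ + p₂ - 1 - b`, `χ` is an ordered subset of `[N]` of size
`p₃ - b - c` disjoint from `S₀`, and `σ₁`, `σ₂` are permutations of
`[N - p₁ + 1 - p₃ + c]`, `[N - p₂ - p₃ + b]`. -/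
def I (p₁ p₂ p₃ N : ℕ) : Set (SevenTuple N) :=
  {X | ∃ a b c : ℕ, X.τ ∈ CT p₁ p₂ p₃ a b c ∧
    X.S₀.card + 1 + a = p₁ + p₂ ∧
    (X.S₁.card + 2 + c = p₁ + p₃ ∧ ∀ x ∈ X.S₁, x.val + 1 < N) ∧
    (X.S₂.card + 1 + b = p₂ + p₃ ∧ ∀ x ∈ X.S₂, x.val + 1 < N) ∧
    (X.χ.Nodup ∧ X.χ.length + b + c = p₃) ∧
    (∀ x ∈ X.χ, x ∉ X.S₀) ∧
    X.σ₁.1 + p₁ + p₃ = N + 1 + c ∧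
    X.σ₂.1 + p₂ + p₃ = N + b}

/-! ### The last passage tree -/

namespace FiveTuple

variable {N : ℕ}

/-- The partition whose blocks are the vertices of color `c`. -/
def part (C : FiveTuple N) : Color → Finpartition (Finset.univ : Finset (Fin N))
  | .white => C.π₁
  | .black => C.π₂
  | .grey => C.π₃

/-- The traversal labelling of color `c`: the triangle `i` has white label `i`, black label
`α₃⁻¹ α₂⁻¹ (i)` and grey label `α₃⁻¹ (i)`. -/
def trav (C : FiveTuple N) : Color → Equiv.Perm (Fin N)
  | .white => 1
  | .black => C.α₃⁻¹ * C.α₂⁻¹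
  | .grey => C.α₃⁻¹

/-- The maximal traversal label of color `c` on the block `B` of color `c`, that is `m₁`, `m₂'`,
`m₃` for a white, black, grey block.  (Blocks are nonempty, so the default value `0` is not used.) -/
def maxLabel [NeZero N] (C : FiveTuple N) (c : Color) (B : Finset (Fin N)) : Fin N :=
  (B.image (C.trav c)).max.unbotD 0

/-- The (initial) index of the triangle containing the last passage vertex of the block `B` of
color `c`: `m₁`, `α₂ α₃ m₂'`, `α₃ m₃` for a white, black, grey block. -/
def lastPassage [NeZero N] (C : FiveTuple N) (c : Color) (B : Finset (Fin N)) : Fin N :=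
  (C.trav c)⁻¹ (C.maxLabel c B)

/-- The root: the white block containing the first element of `[N]`. -/
def root [NeZero N] (C : FiveTuple N) : Finset (Fin N) := C.π₁.part 0

/-- The blocks of color `c` other than the root. -/
def nonRoot [NeZero N] (C : FiveTuple N) (c : Color) : Finset (Finset (Fin N)) :=
  (C.part c).parts.filter fun B => ¬ (c = .white ∧ B = C.root)

/-- The triangles that contain the last passage vertex of a non-root block of color `c`. -/
def lastPassages [NeZero N] (C : FiveTuple N) (c : Color) : Finset (Fin N) :=
  (C.nonRoot c).image (C.lastPassage c)

/-- The ordered list, from left to right, of the descendants in `T` of the block `B` of color `c`: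
the non-root blocks of color `c.next` whose last passage triangle lies in `B`, sorted by the
`c`-traversal label of this triangle. -/
def children [NeZero N] (C : FiveTuple N) (c : Color) (B : Finset (Fin N)) :
    List (Finset (Fin N)) :=
  ((((C.lastPassages c.next).filter (· ∈ B)).image (C.trav c)).sort (· ≤ ·)).map
    fun l => (C.part c.next).part ((C.trav c)⁻¹ l)

/-! ### The cactus tree -/

/-- The cactus tree spanned by a vertex of color `c` and those of its descendants in `T` that are
in `kids` (or below).  A descendant `B` and its rightmost descendant `D` form a triangle with the
ascendant of `B` exactly when their last passage vertices belong to the same triangle of the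
partitioned cactus.  The first argument bounds the recursion depth. -/
def treeAux [NeZero N] (C : FiveTuple N) : ℕ → Color → List (Finset (Fin N)) → CactusTree
  | 0, _, _ => .leaf
  | d + 1, c, kids => kids.foldr (fun B rest =>
      match (C.children c.next B).getLast? with
      | none => .edge .leaf rest
      | some D =>
        if C.lastPassage c.next B = C.lastPassage c.next.next D then
          .triangle (C.treeAux d c.next (C.children c.next B).dropLast)
            (C.treeAux d c.next.next (C.children c.next.next D)) rest
        else
          .edge (C.treeAux d c.next (C.children c.next B)) rest) .leaf

/-- The cactus tree `τ`.  The tree `T` has at most `3 N` vertices, so that its depth is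
less than `3 N`. -/
def tree [NeZero N] (C : FiveTuple N) : CactusTree :=
  C.treeAux (3 * N) .white (C.children .white C.root)

/-! ### Reverse labelling and relabelling permutations -/

/-- The color of the vertices at distance `n` from the root. -/
def levelColor (n : ℕ) : Color := Color.next^[n] .white

/-- The vertices of `T` at distance `n` from the root, from left to right. -/
def level [NeZero N] (C : FiveTuple N) : ℕ → List (Finset (Fin N))
  | 0 => [C.root]
  | n + 1 => (C.level n).flatMap (C.children (levelColor n))

/-- The blocks of color `c`, listed by increasing reverse label: the top level first, each level
from left to right (so that, read backwards, one labels from the root level on, each level from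
right to left, with decreasing labels). -/
def reverseLabelled [NeZero N] (C : FiveTuple N) (c : Color) : List (Finset (Fin N)) :=
  ((List.range (3 * N)).reverse.filter fun n => levelColor n = c).flatMap C.level

/-- The reverse label (starting from `0`) of the block of color `c` that contains the triangle
with `c`-traversal label `l`. -/
def reverseLabel [NeZero N] (C : FiveTuple N) (c : Color) (l : Fin N) : ℕ :=
  (C.reverseLabelled c).idxOf ((C.part c).part ((C.trav c)⁻¹ l))

/-- The relabelling permutation of color `c` (`λ₁`, `λ₂`, `λ₃` for white, black, grey).  The sets
`π₁`, `α₃⁻¹(π₂) = α₃⁻¹ α₂⁻¹ (π₂)`, `π₃ = α₃⁻¹(π₃)` of `c`-traversal labels of the blocks of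
color `c` are written one after the other by increasing reverse label, each one in increasing
order; this word is the one-line notation of `Tuple.sort (C.reverseLabel c)`, and `relabel` sends
its `r`-th letter to `r`. -/
def relabel [NeZero N] (C : FiveTuple N) (c : Color) : Equiv.Perm (Fin N) :=
  (Tuple.sort (C.reverseLabel c))⁻¹

/-! ### Support sets, support complement and permutations -/

/-- The support set `S₀ = λ₁ {m₁ⁱ, α₂ α₃ m₂'ʲ}` (`i` not the root). -/
def S₀ [NeZero N] (C : FiveTuple N) : Finset (Fin N) :=
  (C.lastPassages .white ∪ C.lastPassages .black).image (C.relabel .white)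

/-- The full support set `S₁ = λ₃ {m₃ᵏ, α₃⁻¹ m₁ⁱ}` (`i` not the root), which contains `N`. -/
def fullS₁ [NeZero N] (C : FiveTuple N) : Finset (Fin N) :=
  (C.lastPassages .grey ∪ C.lastPassages .white).image (C.relabel .grey * C.trav .grey)

/-- The full support set `S₂ = λ₂ {m₂'ʲ, α₃⁻¹ α₂⁻¹ α₃ m₃ᵏ}`, which contains `N`. -/
def fullS₂ [NeZero N] (C : FiveTuple N) : Finset (Fin N) :=
  (C.lastPassages .black ∪ C.lastPassages .grey).image (C.relabel .black * C.trav .black)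

/-- The ordered set `χ` of the `λ₁ α₃ m₃ᵏ`, by increasing reverse label `k`, for those `k` with
`α₃ m₃ᵏ ∉ {m₁ⁱ, α₂ α₃ m₂'ʲ}` (`i` not the root). -/
def χ [NeZero N] (C : FiveTuple N) : List (Fin N) :=
  (((C.reverseLabelled .grey).map (C.lastPassage .grey)).filter
    fun t => t ∉ C.lastPassages .white ∪ C.lastPassages .black).map (C.relabel .white)

/-- `E₁ = [N] ∖ λ₁ {m₁ⁱ, α₃ m₃ᵏ}` (`i` not the root). -/
def E₁ [NeZero N] (C : FiveTuple N) : Finset (Fin N) :=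
  ((C.lastPassages .white ∪ C.lastPassages .grey).image (C.relabel .white))ᶜ

/-- `E₂ = [N] ∖ λ₁ {α₂ α₃ m₂'ʲ, α₃ m₃ᵏ}`. -/
def E₂ [NeZero N] (C : FiveTuple N) : Finset (Fin N) :=
  ((C.lastPassages .black ∪ C.lastPassages .grey).image (C.relabel .white))ᶜ

/-- The permutation `λ₃ ∘ α₃⁻¹ ∘ λ₁⁻¹` of `[N]`. -/
def ext₁ [NeZero N] (C : FiveTuple N) : Equiv.Perm (Fin N) :=
  C.relabel .grey * C.trav .grey * (C.relabel .white)⁻¹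

/-- The permutation `λ₂ ∘ α₃⁻¹ ∘ α₂⁻¹ ∘ λ₁⁻¹` of `[N]`. -/
def ext₂ [NeZero N] (C : FiveTuple N) : Equiv.Perm (Fin N) :=
  C.relabel .black * C.trav .black * (C.relabel .white)⁻¹

theorem mem_E₁_iff [NeZero N] (C : FiveTuple N) (u : Fin N) :
    u ∈ C.E₁ ↔ C.ext₁ u ∈ C.fullS₁ᶜ := by
  obtain ⟨t, rfl⟩ := (C.relabel .white).surjective u
  simp [E₁, fullS₁, ext₁, and_comm]

theorem mem_E₂_iff [NeZero N] (C : FiveTuple N) (u : Fin N) :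
    u ∈ C.E₂ ↔ C.ext₂ u ∈ C.fullS₂ᶜ := by
  obtain ⟨t, rfl⟩ := (C.relabel .white).surjective u
  simp [E₂, fullS₂, ext₂]

end FiveTuple

/-- If the permutation `f` of `[N]` restricts to a bijection from `E` onto `F`, the permutation of
`[n]`, `n = |E|`, obtained from this restriction by replacing each element of `E` and of `F` with
its position in `E`, resp. `F`, sorted in increasing order. -/
def standardize {N : ℕ} (f : Equiv.Perm (Fin N)) (E F : Finset (Fin N))
    (h : ∀ u, u ∈ E ↔ f u ∈ F) : (n : ℕ) × Equiv.Perm (Fin n) :=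
  ⟨E.card, ((E.orderIsoOfFin rfl).toEquiv.trans (f.subtypeEquiv h)).trans
    (F.orderIsoOfFin (by
      simpa using (Fintype.card_congr (f.subtypeEquiv h)).symm)).symm.toEquiv⟩

/-- The mapping `Θ`.  The element `N` of the full support sets `S₁`, `S₂` is left out. -/
def Theta {N : ℕ} [NeZero N] (C : FiveTuple N) : SevenTuple N where
  τ := C.tree
  S₀ := C.S₀
  S₁ := C.fullS₁.filter fun x => x.val + 1 < N
  S₂ := C.fullS₂.filter fun x => x.val + 1 < N
  χ := C.χ
  σ₁ := standardize C.ext₁ C.E₁ C.fullS₁ᶜ C.mem_E₁_iff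
  σ₂ := standardize C.ext₂ C.E₂ C.fullS₂ᶜ C.mem_E₂_iff

end Cacti

namespace Cacti

open FiveTuple

/-! Read the labels in the order white 1, grey 1, black 1, white 2, and so on. By `trav_perm`, a
visit of color `c.next` at a triangle t is followed by a visit of the block of color c that contains
t. A partitioned cactus is therefore a closed walk from the root through the blocks, with 3N arcs,
one for each pair of a color and a triangle, and T is the tree of last exits of this walk. As in the
BEST theorem, such a walk is the same thing as a tree directed towards the root together with an
order on the arcs leaving each vertex, the tree arc being the last one.

The relabellings turn the blocks of each color into consecutive intervals, in which the order of the
labels is the order of the exits. What remains is a model (`IsModel`): the tree, the ends of the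
intervals, the positions of the children, and the permutations from white labels to labels of each
color. Both the passage from cacti to models and the encoding of models as seven-tuples are
bijective, and their composite is the map to study (`theta_eq_encode`).

Models and seven-tuples. In each color the relative order of the ends and the child positions is
dictated by the tree (`IsSpine`), so both families are recovered from the set of their values
(`IsSpine.unique`, `exists_isSpine`). Triangles of the cactus tree are exactly the coincidences
between an end and a child position. The label N always ends the last block, so it can be left out
of the black and grey supports. Over its support a transfer permutation is prescribed by the
identity between child positions and ends, once the white labels of the grey last passages are
known; such a label either coincides with one in the white support, in a way dictated by the tree,
or is listed in χ. Outside the support it is an arbitrary permutation (`IsModel.encode_inj`,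
`exists_isModel`).

Cacti and models. A cactus is recovered by replaying its walk: the block visited next is known from
the previous label, and its labels are used in increasing order (`SameModel.relabel_eq`).
Conversely, `exists_tour` produces a walk through all arcs of a given model, from which a cactus is
built (`IsModel.exists_realizes`). Blocks and tree vertices are matched throughout by the uniqueness
of the solution of the listing equation (`IsListing.eq_revLevels`). -/

theorem Color.next_injective : Function.Injective Color.next := by
  intro c d; cases c <;> cases d <;> simp [Color.next]

theorem Color.next_next_next (c : Color) : c.next.next.next = c := by
  cases c <;> rfl

theorem levelColor_succ (n : ℕ) : levelColor (n + 1) = (levelColor n).next :=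
  Function.iterate_succ_apply' ..

/-! ### Level by level listings -/

section Levels

variable {α β : Type*}

/-- The `n`-th level of the plane tree with root `r` and color-dependent lists of children `ch`. -/
def levels (ch : Color → α → List α) (r : α) : ℕ → List α
  | 0 => [r]
  | n + 1 => (levels ch r n).flatMap (ch (levelColor n))

/-- The vertices of color `c` in the levels below `M`, the top level first. -/
def revLevels (ch : Color → α → List α) (r : α) (M : ℕ) (c : Color) : List α :=
  ((List.range M).reverse.filter fun n => levelColor n = c).flatMap (levels ch r)

/-- The one-element list `[r]` for white and the empty list for the other colors. -/
def rootList (r : α) (c : Color) : List α := if c = .white then [r] else []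

variable {ch : Color → α → List α} {r : α}

theorem revLevels_zero (c : Color) : revLevels ch r 0 c = [] := by
  simp [revLevels]

theorem revLevels_succ (M : ℕ) (c : Color) :
    revLevels ch r (M + 1) c =
      (if levelColor M = c then levels ch r M else []) ++ revLevels ch r M c := by
  unfold revLevels
  rw [List.range_succ, List.reverse_append]
  simp only [List.reverse_cons, List.reverse_nil, List.nil_append, List.cons_append,
    List.filter_cons]
  split_ifs <;> simp_all

/-- Going up one level replaces every vertex by its children. Only the root is nobody's child; being
alone on the lowest level, it closes the white list. -/
theorem revLevels_succ_next (M : ℕ) (c : Color) :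
    revLevels ch r (M + 1) c.next =
      (revLevels ch r M c).flatMap (ch c) ++ rootList r c.next := by
  induction M with
  | zero =>
    rw [revLevels_succ, revLevels_zero, revLevels_zero]
    cases c <;> simp [levels, rootList, levelColor, Color.next]
  | succ M ih =>
    rw [revLevels_succ, ih, revLevels_succ M c, levelColor_succ]
    by_cases h : levelColor M = c
    · subst h
      simp [levels]
    · rw [if_neg h, if_neg (fun h' => h (Color.next_injective h'))]
      simp

/-- The families of lists, one for each color, that are stable under replacing each vertex by
its children and adding the root at the end of the white list. -/
def IsListing (ch : Color → α → List α) (r : α) (A : Color → List α) : Prop :=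
  ∀ c, A c.next = (A c).flatMap (ch c) ++ rootList r c.next

theorem isListing_revLevels {M : ℕ} (h : levels ch r M = []) :
    IsListing ch r (revLevels ch r M) := by
  intro c
  rw [← revLevels_succ_next, revLevels_succ, h]
  simp

/-- Unfolding the equation m times makes the levels below m appear at the end of each list, preceded
by a remainder Z whose ranks have dropped by m. The bound K on the ranks forces Z to be empty for m
= K + 1. -/
theorem IsListing.eq_revLevels {A : Color → List α} (hA : IsListing ch r A)
    (ρ : Color → α → ℕ) (K : ℕ) (hρ : ∀ c, ∀ a ∈ A c, ∀ b ∈ ch c a, ρ c.next b < ρ c a)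
    (hK : ∀ c, ∀ a ∈ A c, ρ c a ≤ K) (c : Color) : A c = revLevels ch r (K + 1) c := by
  have key : ∀ m, ∀ c, ∃ Z, A c = Z ++ revLevels ch r m c ∧ ∀ b ∈ Z, ρ c b + m ≤ K := by
    intro m
    induction m with
    | zero => exact fun c => ⟨A c, by simp [revLevels_zero], by simpa using hK c⟩
    | succ m ih =>
      intro c
      obtain ⟨d, rfl⟩ : ∃ d : Color, d.next = c := ⟨c.next.next, c.next_next_next⟩
      obtain ⟨Z, hZ, hb⟩ := ih d
      refine ⟨Z.flatMap (ch d), ?_, ?_⟩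
      · rw [hA d, hZ, revLevels_succ_next]
        simp
      · intro b hb'
        obtain ⟨a, ha, hab⟩ := List.mem_flatMap.1 hb'
        have h1 := hρ d a (by rw [hZ]; simp [ha]) b hab
        have h2 := hb a ha
        omega
  obtain ⟨Z, hZ, hb⟩ := key (K + 1) c
  rcases Z with _ | ⟨b, Z⟩
  · simpa using hZ
  · have := hb b (by simp)
    omega

/-- Ranks decrease along the levels. -/
theorem rank_levels (G : Color → α → Prop) (ρ : Color → α → ℕ) (K : ℕ)
    (hr : G .white r) (hK : ρ .white r ≤ K)
    (hρ : ∀ c a, G c a → ∀ b ∈ ch c a, G c.next b ∧ ρ c.next b < ρ c a) (n : ℕ) :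
    ∀ b ∈ levels ch r n, G (levelColor n) b ∧ ρ (levelColor n) b + n ≤ K := by
  induction n with
  | zero =>
    intro b hb
    obtain rfl : b = r := by simpa [levels] using hb
    exact ⟨hr, hK⟩
  | succ n ih =>
    intro b hb
    obtain ⟨a, ha, hab⟩ := List.mem_flatMap.1 hb
    rw [levelColor_succ]
    obtain ⟨h1, h2⟩ := ih a ha
    obtain ⟨h3, h4⟩ := hρ _ a h1 b hab
    exact ⟨h3, by omega⟩

theorem levels_eq_nil (G : Color → α → Prop) (ρ : Color → α → ℕ) (K : ℕ)
    (hr : G .white r) (hK : ρ .white r ≤ K)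
    (hρ : ∀ c a, G c a → ∀ b ∈ ch c a, G c.next b ∧ ρ c.next b < ρ c a) :
    levels ch r (K + 1) = [] := by
  rw [List.eq_nil_iff_forall_not_mem]
  intro b hb
  have := (rank_levels G ρ K hr hK hρ _ b hb).2
  omega

theorem mem_revLevels {M : ℕ} {c : Color} {b : α} :
    b ∈ revLevels ch r M c ↔ ∃ n < M, levelColor n = c ∧ b ∈ levels ch r n := by
  simp [revLevels, and_assoc]

theorem map_revLevels {ch' : Color → β → List β} (f : Color → α → β) (M : ℕ)
    (h : ∀ c, ∀ a ∈ revLevels ch r M c, (ch c a).map (f c.next) = ch' c (f c a)) (c : Color) :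
    (revLevels ch r M c).map (f c) = revLevels ch' (f .white r) M c := by
  have key : ∀ n < M, (levels ch r n).map (f (levelColor n)) = levels ch' (f .white r) n := by
    intro n
    induction n with
    | zero => exact fun _ => rfl
    | succ n ih =>
      intro hn
      rw [levels, levels, ← ih (by omega), List.map_flatMap, List.flatMap_map, levelColor_succ]
      refine List.flatMap_congr fun a ha => ?_
      exact h _ a (mem_revLevels.2 ⟨n, by omega, rfl, ha⟩)
  unfold revLevels
  rw [List.map_flatMap]
  refine List.flatMap_congr fun n hn => ?_
  simp only [List.mem_filter, List.mem_reverse, List.mem_range, decide_eq_true_eq] at hn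
  rw [← key n hn.1, hn.2]

/-- Unrolling the recursion of F over m levels collects the terms g below level m and leaves the sum
of F over level m, which is empty for m = M. This converts counts defined by recursion on cactus
trees into counts over `verts`. -/
theorem sum_revLevels (F g : Color → α → ℕ)
    (hF : ∀ c a, F c a = g c a + ((ch c a).map (F c.next)).sum) (M : ℕ)
    (hM : levels ch r M = []) (d : Color) (hg : ∀ c, c ≠ d → ∀ a, g c a = 0) :
    F .white r = ((revLevels ch r M d).map (g d)).sum := by
  have step : ∀ l : List α, ∀ c,
      (l.map (F c)).sum = (l.map (g c)).sum + ((l.flatMap (ch c)).map (F c.next)).sum := by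
    intro l c
    induction l with
    | nil => simp
    | cons a l ih => simp [hF c a, ih]; omega
  have key : ∀ m, F .white r = ((revLevels ch r m d).map (g d)).sum +
      ((levels ch r m).map (F (levelColor m))).sum := by
    intro m
    induction m with
    | zero => simp [revLevels_zero, levels, levelColor]
    | succ m ih =>
      rw [ih, step, revLevels_succ, levelColor_succ]
      by_cases h : levelColor m = d
      · subst h
        simp [levels]
        omega
      · have : ((levels ch r m).map (g (levelColor m))).sum = 0 := by
          rw [show g (levelColor m) = fun _ => 0 from funext (hg _ h)]
          simp
        simp [h, this, levels]
  rw [key M, hM]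
  simp

end Levels

end Cacti

namespace Cacti

open FiveTuple

/-! ### Concatenations of lists of children -/

section KidCount

variable {α β : Type*}

/-- The number of children of the first `k` elements of `l`. -/
def kidCount (l : List α) (f : α → List β) (k : ℕ) : ℕ := ((l.take k).flatMap f).length

variable {l : List α} {f : α → List β}

theorem kidCount_succ {i : ℕ} (h : i < l.length) :
    kidCount l f (i + 1) = kidCount l f i + (f l[i]).length := by
  unfold kidCount
  rw [← List.take_concat_get' l i h, List.flatMap_append, List.length_append]
  simp

theorem kidCount_mono : Monotone (kidCount l f) := by
  refine monotone_nat_of_le_succ fun i => ?_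
  by_cases h : i < l.length
  · rw [kidCount_succ h]
    omega
  · unfold kidCount
    rw [List.take_of_length_le (by omega), List.take_of_length_le (by omega)]

theorem kidCount_length : kidCount l f l.length = (l.flatMap f).length := by
  simp [kidCount]

theorem getElem?_flatMap_kidCount {i : ℕ} (h : i < l.length) {o : ℕ}
    (ho : o < (f l[i]).length) : (l.flatMap f)[kidCount l f i + o]? = some (f l[i])[o] := by
  have : l = l.take i ++ l[i] :: l.drop (i + 1) := by simp
  have h2 : l.flatMap f = (l.take i).flatMap f ++ (f l[i] ++ (l.drop (i + 1)).flatMap f) := by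
    conv_lhs => rw [this, List.flatMap_append, List.flatMap_cons]
  rw [h2, kidCount, List.getElem?_append_right (by omega), Nat.add_sub_cancel_left,
    List.getElem?_append_left ho, List.getElem?_eq_getElem ho]

theorem exists_kidCount_le {j : ℕ} (h : j < (l.flatMap f).length) :
    ∃ i, ∃ hi : i < l.length, kidCount l f i ≤ j ∧ j < kidCount l f (i + 1) ∧
      ∃ ho : j - kidCount l f i < (f l[i]).length, (l.flatMap f)[j] =
        (f l[i])[j - kidCount l f i] := by
  classical
  have hex : ∃ n, j < kidCount l f n := ⟨l.length, by rwa [kidCount_length]⟩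
  have h1 := Nat.find_spec hex
  have h0 : Nat.find hex ≠ 0 := by
    intro h0
    rw [h0] at h1
    simp [kidCount] at h1
  obtain ⟨i, hi⟩ := Nat.exists_eq_succ_of_ne_zero h0
  have h2 : ¬ j < kidCount l f i := Nat.find_min hex (by omega)
  rw [hi] at h1
  have hil : i < l.length := by
    have : Nat.find hex ≤ l.length := Nat.find_min' hex (by rwa [kidCount_length])
    omega
  have h3 := kidCount_succ (f := f) hil
  have ho : j - kidCount l f i < (f l[i]).length := by
    have : j < kidCount l f (i + 1) := h1
    omega
  refine ⟨i, hil, by omega, h1, ho, ?_⟩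
  have := getElem?_flatMap_kidCount hil ho
  rw [Nat.add_sub_cancel' (by omega), List.getElem?_eq_getElem h] at this
  exact Option.some.inj this

end KidCount

/-! ### The plane tree underlying a cactus tree -/

namespace CactusTree

/-- The cactus tree obtained by adding a new rightmost descending edge to the root. -/
def snoc : CactusTree → CactusTree → CactusTree
  | leaf, u => edge u leaf
  | edge t r, u => edge t (r.snoc u)
  | triangle t v r, u => triangle t v (r.snoc u)

/-- The children of the root, each with the subtree of its descendants, and with the value `true`
if it forms a triangle with the root and its own rightmost child. -/
def kids : CactusTree → List (CactusTree × Bool)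
  | leaf => []
  | edge t r => (t, false) :: r.kids
  | triangle t u r => (t.snoc u, true) :: r.kids

/-- The number of non-root vertices. -/
def size : CactusTree → ℕ
  | leaf => 0
  | edge t r => t.size + r.size + 1
  | triangle t u r => t.size + u.size + r.size + 2

theorem kids_snoc (t u : CactusTree) : (t.snoc u).kids = t.kids ++ [(u, false)] := by
  induction t with
  | leaf => rfl
  | edge t r _ ih => simp [snoc, kids, ih]
  | triangle t v r _ _ ih => simp [snoc, kids, ih]

theorem size_snoc (t u : CactusTree) : (t.snoc u).size = t.size + u.size + 1 := by
  induction t with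
  | leaf => simp [snoc, size]
  | edge t r _ ih => simp [snoc, size, ih]; omega
  | triangle t v r _ _ ih => simp [snoc, size, ih]; omega

theorem snoc_inj {t t' u u' : CactusTree} : t.snoc u = t'.snoc u' ↔ t = t' ∧ u = u' := by
  refine ⟨fun h => ?_, fun ⟨h, h'⟩ => h ▸ h' ▸ rfl⟩
  have key : ∀ t t' : CactusTree, t.snoc u = t'.snoc u' → t = t' ∧ u = u' := by
    intro t
    induction t with
    | leaf =>
      intro t' h
      cases t' with
      | leaf => simpa [snoc] using h
      | edge t r => cases r <;> simp [snoc] at h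
      | triangle t v r => simp [snoc] at h
    | edge t r _ ih =>
      intro t' h
      cases t' with
      | leaf => cases r <;> simp [snoc] at h
      | edge t r' =>
        simp only [snoc, edge.injEq] at h ⊢
        exact ⟨⟨h.1, (ih _ h.2).1⟩, (ih _ h.2).2⟩
      | triangle t v r => simp [snoc] at h
    | triangle t v r _ _ ih =>
      intro t' h
      cases t' with
      | leaf => simp [snoc] at h
      | edge t r => simp [snoc] at h
      | triangle t v r' =>
        simp only [snoc, triangle.injEq] at h ⊢
        exact ⟨⟨h.1, h.2.1, (ih _ h.2.2).1⟩, (ih _ h.2.2).2⟩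
  exact key t t' h

/-- The plane tree with flags loses no information: the third vertex of a triangle has been moved to
the end of the children of the flagged vertex, and `snoc_inj` splits it off again. -/
theorem kids_injective : Function.Injective kids := by
  intro t
  induction t with
  | leaf => intro t' h; cases t' <;> simp_all [kids]
  | edge t r _ ih =>
    intro t' h
    cases t' with
    | leaf => simp [kids] at h
    | edge t' r' =>
      simp only [kids, List.cons.injEq, Prod.mk.injEq, and_true] at h
      rw [h.1, ih h.2]
    | triangle t' u' r' => simp [kids] at h
  | triangle t u r _ _ ih =>
    intro t' h
    cases t' with
    | leaf => simp [kids] at h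
    | edge t' r' => simp [kids] at h
    | triangle t' u' r' =>
      simp only [kids, List.cons.injEq, Prod.mk.injEq, and_true, snoc_inj] at h
      rw [h.1.1, h.1.2, ih h.2]

theorem size_lt_of_mem_kids {t : CactusTree} {v : CactusTree × Bool} (h : v ∈ t.kids) :
    v.1.size < t.size := by
  induction t with
  | leaf => simp [kids] at h
  | edge t r _ ih =>
    rcases List.mem_cons.1 h with rfl | h
    · simp only [size]; omega
    · have := ih h
      simp only [size]; omega
  | triangle t u r _ _ ih =>
    rcases List.mem_cons.1 h with rfl | h
    · simp only [size, size_snoc]; omega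
    · have := ih h
      simp only [size]; omega

/-- A child that forms a triangle with its parent and its rightmost child has a child, and its
rightmost child does not form a triangle with it and a grandchild. -/
theorem exists_of_mem_kids {t s : CactusTree} (h : (s, true) ∈ t.kids) :
    ∃ l u, s.kids = l ++ [(u, false)] := by
  induction t with
  | leaf => simp [kids] at h
  | edge t r _ ih =>
    rcases List.mem_cons.1 h with h | h
    · simp at h
    · exact ih h
  | triangle t u r _ _ ih =>
    rcases List.mem_cons.1 h with h | h
    · simp only [Prod.mk.injEq, and_true] at h
      exact ⟨t.kids, u, by rw [h, kids_snoc]⟩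
    · exact ih h

theorem numVertices_snoc (d c : Color) (t u : CactusTree) :
    (t.snoc u).numVertices d c = t.numVertices d c + u.numVertices d c.next := by
  induction t generalizing c with
  | leaf => simp [snoc, numVertices, add_comm]
  | edge t r _ ih => simp [snoc, numVertices, ih]; omega
  | triangle t v r _ _ ih => simp [snoc, numVertices, ih]; omega

theorem numTriangles_snoc (d c : Color) (t u : CactusTree) :
    (t.snoc u).numTriangles d c = t.numTriangles d c + u.numTriangles d c.next := by
  induction t generalizing c with
  | leaf => simp [snoc, numTriangles]
  | edge t r _ ih => simp [snoc, numTriangles, ih]; omega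
  | triangle t v r _ _ ih => simp [snoc, numTriangles, ih]; omega

theorem numVertices_eq (d c : Color) (t : CactusTree) :
    t.numVertices d c =
      (if c = d then 1 else 0) + (t.kids.map fun v => v.1.numVertices d c.next).sum := by
  induction t with
  | leaf => simp [kids, numVertices]
  | edge t r _ ih => simp [kids, numVertices, ih]; omega
  | triangle t v r _ _ ih => simp [kids, numVertices, numVertices_snoc, ih]; omega

theorem numTriangles_eq (d c : Color) (t : CactusTree) :
    t.numTriangles d c =
      (if c = d then t.kids.countP (·.2) else 0) +
        (t.kids.map fun v => v.1.numTriangles d c.next).sum := by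
  induction t with
  | leaf => simp [kids, numTriangles]
  | edge t r _ ih => simp [kids, numTriangles, ih]; omega
  | triangle t v r _ _ ih =>
    simp [kids, numTriangles, numTriangles_snoc, ih]
    split_ifs <;> omega

/-- The lists of children, with the signature used for `levels`. -/
def kidsOf (_ : Color) (v : CactusTree × Bool) : List (CactusTree × Bool) := v.1.kids

/-- The vertices of color `c` of a cactus tree with a white root, by increasing reverse label. -/
def verts (τ : CactusTree) (c : Color) : List (CactusTree × Bool) :=
  revLevels kidsOf (τ, false) (τ.size + 1) c

/-- The number of vertices of color `c`. -/
def vcount (τ : CactusTree) (c : Color) : ℕ := (τ.verts c).length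

/-- The number of non-root vertices of color `c`. -/
def dcount (τ : CactusTree) (c : Color) : ℕ := τ.vcount c - if c = .white then 1 else 0

/-- The number of children of the first `k` vertices of color `c`; the children of the `k`-th
vertex have the numbers from `kidStart c k` on. -/
def kidStart (τ : CactusTree) (c : Color) (k : ℕ) : ℕ := kidCount (τ.verts c) (kidsOf c) k

/-- The `k`-th vertex of color `c` forms a triangle with its parent and its rightmost child. -/
def Flagged (τ : CactusTree) (c : Color) (k : ℕ) : Prop := ∃ s, (τ.verts c)[k]? = some (s, true)

/-! ### Numbering of the vertices of a cactus tree, color by color -/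

variable (τ : CactusTree)

theorem levels_kidsOf_eq_nil :
    levels kidsOf (τ, false) (τ.size + 1) = [] :=
  levels_eq_nil (fun _ _ => True) (fun _ v => v.1.size) _ trivial le_rfl
    fun _ _ _ _ h => ⟨trivial, size_lt_of_mem_kids h⟩

theorem isListing_verts : IsListing kidsOf (τ, false) τ.verts :=
  isListing_revLevels τ.levels_kidsOf_eq_nil

/-- The criterion by which lists coming from blocks will be recognized as the vertices of the tree.
-/
theorem eq_verts {A : Color → List (CactusTree × Bool)} (hA : IsListing kidsOf (τ, false) A)
    (h : ∀ c, ∀ v ∈ A c, v.1.size ≤ τ.size) : A = τ.verts := by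
  funext c
  exact hA.eq_revLevels (fun _ v => v.1.size) τ.size
    (fun _ _ _ _ h => size_lt_of_mem_kids h) h c

theorem vcount_next (c : Color) :
    τ.vcount c.next = ((τ.verts c).flatMap (kidsOf c)).length +
      (if c.next = .white then 1 else 0) := by
  rw [vcount, τ.isListing_verts c, List.length_append, rootList]
  split_ifs <;> rfl

theorem dcount_next (c : Color) :
    τ.dcount c.next = ((τ.verts c).flatMap (kidsOf c)).length := by
  rw [dcount, vcount_next]
  omega

theorem vcount_white : τ.vcount .white = τ.dcount .white + 1 := by
  have h1 := τ.vcount_next .grey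
  have h2 := τ.dcount_next .grey
  simp only [Color.next, if_true] at h1 h2
  omega

theorem vcount_black : τ.vcount .black = τ.dcount .black := by simp [dcount]

theorem vcount_grey : τ.vcount .grey = τ.dcount .grey := by simp [dcount]

theorem dcount_le (c : Color) : τ.dcount c ≤ τ.vcount c := Nat.sub_le ..

theorem kidStart_mono (c : Color) : Monotone (τ.kidStart c) := kidCount_mono

theorem kidStart_zero (c : Color) : τ.kidStart c 0 = 0 := by simp [kidStart, kidCount]

theorem kidStart_vcount (c : Color) : τ.kidStart c (τ.vcount c) = τ.dcount c.next := by
  rw [dcount_next, kidStart, vcount, kidCount_length]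

theorem kidStart_le {c : Color} {k : ℕ} (h : k ≤ τ.vcount c) :
    τ.kidStart c k ≤ τ.dcount c.next := by
  rw [← kidStart_vcount]
  exact τ.kidStart_mono c h

theorem dcount_next_eq_zero {c : Color} (h : τ.vcount c = 0) : τ.dcount c.next = 0 := by
  rw [← kidStart_vcount, h, kidStart_zero]

theorem exists_parent {c : Color} {j : ℕ} (h : j < τ.dcount c.next) :
    ∃ k < τ.vcount c, τ.kidStart c k ≤ j ∧ j < τ.kidStart c (k + 1) := by
  rw [dcount_next] at h
  obtain ⟨i, hi, h1, h2, -⟩ := exists_kidCount_le h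
  exact ⟨i, hi, h1, h2⟩

theorem getElem?_verts_next {c : Color} {j : ℕ} (h : j < τ.dcount c.next) :
    (τ.verts c.next)[j]? = ((τ.verts c).flatMap (kidsOf c))[j]? := by
  rw [dcount_next] at h
  rw [isListing_verts, List.getElem?_append_left h]

theorem getElem?_verts_kid {c : Color} {k o : ℕ} {v : CactusTree × Bool}
    (hv : (τ.verts c)[k]? = some v) (ho : o < v.1.kids.length) :
    (τ.verts c.next)[τ.kidStart c k + o]? = some v.1.kids[o] := by
  obtain ⟨hk, rfl⟩ := List.getElem?_eq_some_iff.1 hv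
  have h1 := kidCount_succ (f := kidsOf c) hk
  have h2 : τ.kidStart c (k + 1) ≤ τ.dcount c.next := τ.kidStart_le hk
  rw [getElem?_verts_next, kidStart, getElem?_flatMap_kidCount hk ho]
  · rfl
  · unfold kidStart at *
    unfold kidsOf at *
    omega

theorem kidStart_succ {c : Color} {k : ℕ} {v : CactusTree × Bool}
    (hv : (τ.verts c)[k]? = some v) :
    τ.kidStart c (k + 1) = τ.kidStart c k + v.1.kids.length := by
  obtain ⟨hk, rfl⟩ := List.getElem?_eq_some_iff.1 hv
  exact kidCount_succ hk

/-- The root is the last white vertex. -/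
theorem getElem?_verts_root : (τ.verts .white)[τ.dcount .white]? = some (τ, false) := by
  have h := τ.isListing_verts .grey
  have h2 := τ.dcount_next .grey
  simp only [Color.next, rootList, if_true] at h h2
  rw [h, h2, List.getElem?_concat_length]

theorem Flagged.lt_vcount {τ : CactusTree} {c : Color} {k : ℕ} (h : τ.Flagged c k) :
    k < τ.vcount c := by
  obtain ⟨s, hs⟩ := h
  exact (List.getElem?_eq_some_iff.1 hs).1

theorem Flagged.lt_dcount {τ : CactusTree} {c : Color} {k : ℕ} (h : τ.Flagged c k) :
    k < τ.dcount c := by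
  have h1 := h.lt_vcount
  by_cases hc : c = .white
  · subst hc
    rw [vcount_white] at h1
    rcases (Nat.lt_succ_iff_lt_or_eq.1 h1) with h1 | rfl
    · exact h1
    · obtain ⟨s, hs⟩ := h
      simp [getElem?_verts_root] at hs
  · simpa [dcount, hc] using h1

theorem Flagged.exists_kids {τ : CactusTree} {c : Color} {k : ℕ} (h : τ.Flagged c k) :
    ∃ s l u, (τ.verts c)[k]? = some (s, true) ∧ s.kids = l ++ [(u, false)] := by
  have hk := h.lt_dcount
  obtain ⟨s, hs⟩ := h
  obtain ⟨d, rfl⟩ : ∃ d : Color, d.next = c := ⟨c.next.next, c.next_next_next⟩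
  have hs' := hs
  rw [getElem?_verts_next _ hk] at hs'
  obtain ⟨v, _, h2⟩ := List.mem_flatMap.1 (List.mem_of_getElem? hs')
  obtain ⟨l, u, h3⟩ := exists_of_mem_kids h2
  exact ⟨s, l, u, hs, h3⟩

theorem Flagged.kidStart_lt {τ : CactusTree} {c : Color} {k : ℕ} (h : τ.Flagged c k) :
    τ.kidStart c k < τ.kidStart c (k + 1) := by
  obtain ⟨s, l, u, h1, h2⟩ := h.exists_kids
  rw [kidStart_succ _ h1, h2]
  simp

/-- The rightmost child of a flagged vertex was attached by `snoc`, hence with the value `false`: no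
parent-child edge belongs to two triangles. All later exclusions between coincidences of last
passages rest on this. -/
theorem Flagged.not_flagged {τ : CactusTree} {c : Color} {k : ℕ} (h : τ.Flagged c k) :
    ¬ τ.Flagged c.next (τ.kidStart c (k + 1) - 1) := by
  obtain ⟨s, l, u, h1, h2⟩ := h.exists_kids
  have h3 := τ.getElem?_verts_kid (o := l.length) h1 (by simp [h2])
  have h4 : τ.kidStart c (k + 1) - 1 = τ.kidStart c k + l.length := by
    rw [kidStart_succ _ h1, h2]
    simp
  rintro ⟨s', hs'⟩
  rw [h4, h3] at hs'
  simp [h2] at hs'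

theorem size_le_of_mem_verts {c : Color} {v : CactusTree × Bool} (h : v ∈ τ.verts c) :
    v.1.size ≤ τ.size := by
  obtain ⟨n, -, rfl, hv⟩ := mem_revLevels.1 h
  have := (rank_levels (fun _ _ => True) (fun _ (v : CactusTree × Bool) => v.1.size) τ.size trivial
    le_rfl (fun _ _ _ _ h => ⟨trivial, size_lt_of_mem_kids h⟩) n v hv).2
  exact le_trans (Nat.le_add_right _ n) this

/-- There is a function on the vertices that increases from parents to children. -/
theorem exists_depth : ∃ ρ : Color → ℕ → ℕ, ∀ c, ∀ k < τ.vcount c, ∀ j,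
    τ.kidStart c k ≤ j → j < τ.kidStart c (k + 1) → ρ c k < ρ c.next j := by
  -- Subtrees shrink from parent to child, so their defect from the full size grows. The subtraction
  -- is not truncated, by `size_le_of_mem_verts`; the default 0 only concerns indices beyond the
  -- list.
  refine ⟨fun c k => τ.size - (((τ.verts c)[k]?).map fun v => v.1.size).getD 0, ?_⟩
  intro c k hk j h1 h2
  have hv : (τ.verts c)[k]? = some (τ.verts c)[k] := List.getElem?_eq_getElem hk
  rw [kidStart_succ _ hv] at h2
  have h3 := τ.getElem?_verts_kid (o := j - τ.kidStart c k) hv (by omega)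
  rw [Nat.add_sub_cancel' h1] at h3
  beta_reduce
  rw [hv, h3]
  have h4 := size_lt_of_mem_kids (List.getElem_mem (l := (τ.verts c)[k].1.kids)
    (n := j - τ.kidStart c k) (by omega))
  have h5 := τ.size_le_of_mem_verts (List.getElem_mem hk)
  simp only [Option.map_some, Option.getD_some]
  omega

theorem vcount_eq (d : Color) : τ.vcount d = τ.numVertices d .white := by
  have := sum_revLevels (ch := kidsOf) (r := (τ, false)) (fun c v => v.1.numVertices d c)
    (fun c _ => if c = d then 1 else 0) (fun c v => numVertices_eq d c v.1) (τ.size + 1)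
    τ.levels_kidsOf_eq_nil d (fun c h _ => if_neg h)
  simp only [if_true, List.map_const', List.sum_replicate, smul_eq_mul, mul_one] at this
  exact this.symm

-- A triangle is charged to its middle vertex, the flagged one, whose color follows the color of the
-- vertex in which the triangle is rooted.
open Classical in
theorem card_flagged (d : Color) :
    ((Finset.range (τ.dcount d.next)).filter (τ.Flagged d.next)).card =
      τ.numTriangles d .white := by
  have h1 := sum_revLevels (ch := kidsOf) (r := (τ, false)) (fun c v => v.1.numTriangles d c)
    (fun c v => if c = d then v.1.kids.countP (·.2) else 0) (fun c v => numTriangles_eq d c v.1)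
    (τ.size + 1) τ.levels_kidsOf_eq_nil d (fun c h _ => if_neg h)
  simp only [if_true] at h1
  rw [h1]
  have h2 : ((revLevels kidsOf (τ, false) (τ.size + 1) d).map
      fun v => v.1.kids.countP (·.2)).sum = ((τ.verts d).flatMap (kidsOf d)).countP (·.2) := by
    rw [List.countP_flatMap]
    rfl
  rw [h2, dcount_next]
  have h3 : ∀ j ∈ Finset.range ((τ.verts d).flatMap (kidsOf d)).length,
      (τ.Flagged d.next j ↔ ∃ s, ((τ.verts d).flatMap (kidsOf d))[j]? = some (s, true)) := by
    intro j hj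
    rw [Flagged, getElem?_verts_next]
    rw [dcount_next]
    simpa using hj
  rw [Finset.filter_congr h3]
  generalize (τ.verts d).flatMap (kidsOf d) = l
  induction l using List.reverseRecOn with
  | nil => simp
  | append_singleton l v ih =>
    rw [List.countP_append, ← ih, List.length_append, List.length_singleton,
      Finset.range_add_one, Finset.filter_insert]
    have h4 : ∀ j ∈ Finset.range l.length, ((∃ s, (l ++ [v])[j]? = some (s, true)) ↔
        ∃ s, l[j]? = some (s, true)) := by
      intro j hj
      rw [List.getElem?_append_left (by simpa using hj)]
    rw [Finset.filter_congr h4]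
    obtain ⟨s, b⟩ := v
    cases b <;> simp

end CactusTree

end Cacti

namespace Cacti

open FiveTuple

/-! ### Families of elements of a finite linear order -/

section Families

variable {ι α : Type*} [LinearOrder α]

/-- At a least value of f where the families differ, the smaller of the two values is also taken by
the other family, at an earlier index; there the families agree, which is contradictory. -/
theorem eq_of_lt_iff_lt [WellFoundedLT α] {f f' : ι → α} (h : ∀ i i', f i < f i' ↔ f' i < f' i')
    (hr : Set.range f = Set.range f') : f = f' := by
  have heq : ∀ i i', f' i = f' i' → f i = f i' := by
    intro i i' hi
    apply le_antisymm
    · exact not_lt.1 fun hlt => (((h _ _).1 hlt).ne' hi).elim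
    · exact not_lt.1 fun hlt => (((h _ _).1 hlt).ne hi).elim
  have key : ∀ x, ∀ i, f i = x → f i = f' i := by
    intro x
    induction x using WellFoundedLT.induction with
    | ind x ih =>
      rintro i rfl
      by_contra hne
      rcases lt_or_gt_of_ne hne with hlt | hlt
      · obtain ⟨i', hi'⟩ : f i ∈ Set.range f' := hr ▸ ⟨i, rfl⟩
        have h1 : f i' < f i := (h _ _).2 (hi' ▸ hlt)
        have h2 := ih _ h1 i' rfl
        exact h1.ne (h2.trans hi')
      · obtain ⟨i', hi'⟩ : f' i ∈ Set.range f := hr ▸ ⟨i, rfl⟩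
        have h1 : f i' < f i := hi' ▸ hlt
        have h2 := ih _ h1 i' rfl
        exact h1.ne (heq _ _ (h2.symm.trans hi'))
  exact funext fun i => key _ i rfl

/-- The family t is a pattern, carried to S by the order isomorphism between two finite chains of
the same size. -/
theorem exists_family [Fintype ι] {β : Type*} [LinearOrder β] (t : ι → β) (S : Finset α)
    (hS : S.card = (Finset.univ.image t).card) :
    ∃ f : ι → α, (∀ i i', f i < f i' ↔ t i < t i') ∧ Finset.univ.image f = S := by
  let W := Finset.univ.image t
  let e : W ≃o S := (W.orderIsoOfFin hS.symm).symm.trans (S.orderIsoOfFin rfl)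
  refine ⟨fun i => e ⟨t i, Finset.mem_image_of_mem _ (Finset.mem_univ _)⟩, fun i i' => ?_, ?_⟩
  · rw [Subtype.coe_lt_coe, e.lt_iff_lt, Subtype.mk_lt_mk]
  · ext s
    simp only [Finset.mem_image, Finset.mem_univ, true_and]
    constructor
    · rintro ⟨i, rfl⟩
      exact Subtype.prop _
    · intro hs
      obtain ⟨⟨w, hw⟩, hws⟩ := e.surjective ⟨s, hs⟩
      obtain ⟨i, -, rfl⟩ := Finset.mem_image.1 hw
      exact ⟨i, by rw [hws]⟩

/-- `en k`, for `k < m`, are the ends of consecutive intervals, and `kp j`, for `j < q`, are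
increasing elements, those with `j < K (k + 1)` lying in the first `k + 1` intervals; the `k`-th
end is one of the `kp j` if and only if `fl k`. -/
structure IsSpine (m q : ℕ) (K : ℕ → ℕ) (fl : ℕ → Prop) (en kp : ℕ → α) : Prop where
  en_lt : ∀ k k', k < k' → k' < m → en k < en k'
  kp_lt : ∀ j j', j < j' → j' < q → kp j < kp j'
  en_lt_kp : ∀ k < m, ∀ j < q, en k < kp j ↔ K (k + 1) ≤ j
  flag : ∀ k < m, fl k ↔ ∃ j < q, kp j = en k

/-- The set of all ends and kid positions. -/
def spineSet (m q : ℕ) (en kp : ℕ → α) : Finset α :=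
  (Finset.range m).image en ∪ (Finset.range q).image kp

theorem mem_spineSet {m q : ℕ} {en kp : ℕ → α} {x : α} :
    x ∈ spineSet m q en kp ↔ (∃ k < m, en k = x) ∨ ∃ j < q, kp j = x := by
  simp [spineSet]

/-! ### Rigidity, cardinality and existence of spines -/

variable {m q : ℕ} {K : ℕ → ℕ} {fl : ℕ → Prop} {en kp : ℕ → α}

namespace IsSpine

theorem en_lt_iff (h : IsSpine m q K fl en kp) {k k' : ℕ} (hk : k < m) (hk' : k' < m) :
    en k < en k' ↔ k < k' := by
  refine ⟨fun hlt => ?_, fun hlt => h.en_lt _ _ hlt hk'⟩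
  by_contra hle
  rcases (not_lt.1 hle).lt_or_eq with h1 | h1
  · exact (h.en_lt _ _ h1 hk).asymm hlt
  · exact hlt.ne (by rw [h1])

theorem kp_lt_iff (h : IsSpine m q K fl en kp) {k k' : ℕ} (hk : k < q) (hk' : k' < q) :
    kp k < kp k' ↔ k < k' := by
  refine ⟨fun hlt => ?_, fun hlt => h.kp_lt _ _ hlt hk'⟩
  by_contra hle
  rcases (not_lt.1 hle).lt_or_eq with h1 | h1
  · exact (h.kp_lt _ _ h1 hk).asymm hlt
  · exact hlt.ne (by rw [h1])

theorem en_inj (h : IsSpine m q K fl en kp) {k k' : ℕ} (hk : k < m) (hk' : k' < m) :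
    en k = en k' ↔ k = k' := by
  refine ⟨fun he => ?_, fun he => by rw [he]⟩
  by_contra hne
  rcases Nat.lt_or_gt_of_ne hne with h1 | h1
  · exact (h.en_lt _ _ h1 hk').ne he
  · exact (h.en_lt _ _ h1 hk).ne' he

theorem kp_inj (h : IsSpine m q K fl en kp) {k k' : ℕ} (hk : k < q) (hk' : k' < q) :
    kp k = kp k' ↔ k = k' := by
  refine ⟨fun he => ?_, fun he => by rw [he]⟩
  by_contra hne
  rcases Nat.lt_or_gt_of_ne hne with h1 | h1
  · exact (h.kp_lt _ _ h1 hk').ne he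
  · exact (h.kp_lt _ _ h1 hk).ne' he

/-- A child position equal to the k-th end must be the last one of the first k + 1 intervals, since
the following one would lie beyond that end although its index is still less than `K (k + 1)`. -/
theorem kp_eq_en (h : IsSpine m q K fl en kp) (hK : ∀ k < m, K (k + 1) ≤ q)
    {k j : ℕ} (hk : k < m) (hj : j < q) : kp j = en k ↔ fl k ∧ j + 1 = K (k + 1) := by
  have key : ∀ i < q, kp i = en k → i + 1 = K (k + 1) := by
    intro i hi he
    have h1 : ¬ K (k + 1) ≤ i := by
      rw [← h.en_lt_kp k hk i hi, he]
      exact lt_irrefl _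
    by_contra hne
    have h2 : kp i < kp (i + 1) := h.kp_lt _ _ (by omega) (by have := hK k hk; omega)
    rw [he, h.en_lt_kp k hk (i + 1) (by have := hK k hk; omega)] at h2
    omega
  constructor
  · intro he
    exact ⟨(h.flag k hk).2 ⟨j, hj, he⟩, key j hj he⟩
  · rintro ⟨hf, hj1⟩
    obtain ⟨i, hi, he⟩ := (h.flag k hk).1 hf
    have := key i hi he
    obtain rfl : i = j := by omega
    exact he

theorem kp_lt_en (h : IsSpine m q K fl en kp) (hK : ∀ k < m, K (k + 1) ≤ q)
    {k j : ℕ} (hk : k < m) (hj : j < q) :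
    kp j < en k ↔ ¬ K (k + 1) ≤ j ∧ ¬ (fl k ∧ j + 1 = K (k + 1)) := by
  rw [← h.kp_eq_en hK hk hj, ← h.en_lt_kp k hk j hj, not_lt, lt_iff_le_and_ne]

/-- Every comparison between ends and child positions is expressed by `K` and `fl` alone, so the two
spines have the same pattern and `eq_of_lt_iff_lt` applies. -/
theorem unique [WellFoundedLT α] {en' kp' : ℕ → α} (h : IsSpine m q K fl en kp)
    (h' : IsSpine m q K fl en' kp') (hK : ∀ k < m, K (k + 1) ≤ q)
    (hS : spineSet m q en kp = spineSet m q en' kp') :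
    (∀ k < m, en k = en' k) ∧ ∀ j < q, kp j = kp' j := by
  have key := eq_of_lt_iff_lt
    (f := Sum.elim (fun k : Fin m => en k) (fun j : Fin q => kp j))
    (f' := Sum.elim (fun k : Fin m => en' k) (fun j : Fin q => kp' j)) ?_ ?_
  · exact ⟨fun k hk => congrFun key (.inl ⟨k, hk⟩), fun j hj => congrFun key (.inr ⟨j, hj⟩)⟩
  · rintro (⟨k, hk⟩ | ⟨j, hj⟩) (⟨k', hk'⟩ | ⟨j', hj'⟩)
    · simp only [Sum.elim_inl, h.en_lt_iff hk hk', h'.en_lt_iff hk hk']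
    · simp only [Sum.elim_inl, Sum.elim_inr, h.en_lt_kp k hk j' hj', h'.en_lt_kp k hk j' hj']
    · simp only [Sum.elim_inl, Sum.elim_inr, h.kp_lt_en hK hk' hj, h'.kp_lt_en hK hk' hj]
    · simp only [Sum.elim_inr, h.kp_lt_iff hj hj', h'.kp_lt_iff hj hj']
  · ext x
    have : x ∈ spineSet m q en kp ↔ x ∈ spineSet m q en' kp' := by rw [hS]
    simp only [mem_spineSet] at this
    simpa [Fin.exists_iff] using this

open Classical in
theorem card_spineSet (h : IsSpine m q K fl en kp) :
    (spineSet m q en kp).card + ((Finset.range m).filter fl).card = m + q := by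
  have h1 : ((Finset.range m).image en).card = m := by
    rw [Finset.card_image_of_injOn, Finset.card_range]
    intro k hk k' hk' he
    exact (h.en_inj (by simpa using hk) (by simpa using hk')).1 he
  have h2 : ((Finset.range q).image kp).card = q := by
    rw [Finset.card_image_of_injOn, Finset.card_range]
    intro k hk k' hk' he
    exact (h.kp_inj (by simpa using hk) (by simpa using hk')).1 he
  have h3 : (Finset.range m).image en ∩ (Finset.range q).image kp =
      ((Finset.range m).filter fl).image en := by
    ext x
    simp only [Finset.mem_inter, Finset.mem_image, Finset.mem_range, Finset.mem_filter]
    constructor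
    · rintro ⟨⟨k, hk, rfl⟩, hj⟩
      exact ⟨k, ⟨hk, (h.flag k hk).2 hj⟩, rfl⟩
    · rintro ⟨k, ⟨hk, hf⟩, rfl⟩
      exact ⟨⟨k, hk, rfl⟩, (h.flag k hk).1 hf⟩
  have h4 : (((Finset.range m).filter fl).image en).card = ((Finset.range m).filter fl).card := by
    rw [Finset.card_image_of_injOn]
    intro k hk k' hk' he
    simp only [Finset.coe_filter, Finset.mem_range, Set.mem_ofPred_eq] at hk hk'
    exact (h.en_inj hk.1 hk'.1).1 he
  have h5 := Finset.card_union_add_card_inter ((Finset.range m).image en)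
    ((Finset.range q).image kp)
  rw [h3, h4, h1, h2] at h5
  exact h5

end IsSpine

-- One spine is built in an auxiliary lexicographic order, then carried to S by `exists_family`. The
-- free value d beyond m will serve as the end of the white root block, which is not part of the
-- white spine.
open Classical in
theorem exists_isSpine (hKm : Monotone K) (hK : ∀ k < m, K (k + 1) ≤ q)
    (hfl : ∀ k < m, fl k → K k < K (k + 1)) (S : Finset α)
    (hS : S.card + ((Finset.range m).filter fl).card = m + q) (d : α) :
    ∃ en kp : ℕ → α, IsSpine m q K fl en kp ∧ spineSet m q en kp = S ∧ ∀ k, m ≤ k → en k = d := by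
  -- The j-th child sits at (j, m). An unflagged end (K (k+1), k) comes after the child K (k+1) - 1
  -- and, because k < m, before the child K (k+1); ends without a child between them are separated
  -- by k. A flagged end sits exactly on the child K (k+1) - 1.
  let te : ℕ → ℕ ×ₗ ℕ := fun k => if fl k then toLex (K (k + 1) - 1, m) else toLex (K (k + 1), k)
  let tk : ℕ → ℕ ×ₗ ℕ := fun j => toLex (j, m)
  have hte : ∀ k, fl k → te k = toLex (K (k + 1) - 1, m) := fun k h => if_pos h
  have hte' : ∀ k, ¬ fl k → te k = toLex (K (k + 1), k) := fun k h => if_neg h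
  have htok : IsSpine m q K fl te tk := by
    refine ⟨fun k k' hk hk' => ?_, fun j j' hj _ => ?_, fun k hk j hj => ?_, fun k hk => ?_⟩
    · have h1 : K (k + 1) ≤ K k' := hKm hk
      have h2 : K k' ≤ K (k' + 1) := hKm (Nat.le_succ _)
      have h3 := hfl k (hk.trans hk')
      have h4 := hfl k' hk'
      by_cases hf : fl k <;> by_cases hf' : fl k' <;>
        simp only [hte, hte', hf, hf', not_false_eq_true, Prod.Lex.toLex_lt_toLex] <;>
        simp only [hf, hf', true_implies] at h3 h4 <;> omega
    · simp only [tk, Prod.Lex.toLex_lt_toLex]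
      omega
    · have h3 := hfl k hk
      by_cases hf : fl k <;>
        simp only [hte, hte', hf, not_false_eq_true, tk, Prod.Lex.toLex_lt_toLex] <;>
        simp only [hf, true_implies] at h3 <;> omega
    · have h1 := hK k hk
      by_cases hf : fl k
      · have h3 := hfl k hk hf
        refine iff_of_true hf ⟨K (k + 1) - 1, by omega, ?_⟩
        rw [hte k hf]
      · refine iff_of_false hf ?_
        rintro ⟨j, hj, he⟩
        rw [hte' k hf] at he
        have := congrArg (fun x => (ofLex x).2) he
        simp only [tk, ofLex_toLex] at this
        omega
  have himg : Finset.univ.image (Sum.elim (fun k : Fin m => te k) (fun j : Fin q => tk j)) =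
      spineSet m q te tk := by
    ext x
    rw [mem_spineSet]
    simp [Fin.exists_iff]
  obtain ⟨f, hf, hfS⟩ := exists_family
    (Sum.elim (fun k : Fin m => te k) (fun j : Fin q => tk j)) S (by
      have := htok.card_spineSet
      rw [himg]
      omega)
  have hfe : ∀ i i', f i = f i' ↔ Sum.elim (fun k : Fin m => te k) (fun j : Fin q => tk j) i =
      Sum.elim (fun k : Fin m => te k) (fun j : Fin q => tk j) i' := by
    intro i i'
    rw [le_antisymm_iff, le_antisymm_iff, ← not_lt, ← not_lt, ← not_lt, ← not_lt, hf, hf]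
  have hen : ∀ k, ∀ hk : k < m,
      (if h : k < m then f (.inl ⟨k, h⟩) else d) = f (.inl ⟨k, hk⟩) := fun k hk => dif_pos hk
  have hkp : ∀ k, ∀ hk : k < q,
      (if h : k < q then f (.inr ⟨k, h⟩) else d) = f (.inr ⟨k, hk⟩) := fun k hk => dif_pos hk
  refine ⟨fun k => if h : k < m then f (.inl ⟨k, h⟩) else d,
    fun k => if h : k < q then f (.inr ⟨k, h⟩) else d, ⟨?_, ?_, ?_, ?_⟩, ?_, ?_⟩
  · intro k k' hk hk'
    rw [hen k (hk.trans hk'), hen k' hk', hf]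
    exact htok.en_lt k k' hk hk'
  · intro k k' hk hk'
    rw [hkp k (hk.trans hk'), hkp k' hk', hf]
    exact htok.kp_lt k k' hk hk'
  · intro k hk j hj
    rw [hen k hk, hkp j hj, hf]
    exact htok.en_lt_kp k hk j hj
  · intro k hk
    rw [htok.flag k hk]
    refine exists_congr fun j => and_congr_right fun hj => ?_
    rw [hen k hk, hkp j hj, hfe]
    rfl
  · rw [← hfS]
    ext x
    rw [mem_spineSet]
    simp only [Finset.mem_image, Finset.mem_univ, true_and, Sum.exists, Fin.exists_iff]
    refine or_congr (exists_congr fun k => ?_) (exists_congr fun k => ?_)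
    · constructor
      · rintro ⟨hk, h⟩
        exact ⟨hk, by rwa [hen k hk] at h⟩
      · rintro ⟨hk, h⟩
        exact ⟨hk, by rwa [hen k hk]⟩
    · constructor
      · rintro ⟨hk, h⟩
        exact ⟨hk, by rwa [hkp k hk] at h⟩
      · rintro ⟨hk, h⟩
        exact ⟨hk, by rwa [hkp k hk]⟩
  · intro k hk
    exact dif_neg (not_lt.2 hk)

end Families

/-! ### Permutations with prescribed restriction and standardization -/

section Standardize

variable {N : ℕ}

theorem orderEmbOfFin_standardize {f : Equiv.Perm (Fin N)} {E F : Finset (Fin N)}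
    (h : ∀ u, u ∈ E ↔ f u ∈ F) (hF : F.card = E.card) (i : Fin E.card) :
    F.orderEmbOfFin hF ((standardize f E F h).2 i) = f (E.orderEmbOfFin rfl i) := by
  have h1 : (standardize f E F h).2 i =
      (F.orderIsoOfFin hF).symm (f.subtypeEquiv h (E.orderIsoOfFin rfl i)) := rfl
  rw [h1]
  exact congrArg Subtype.val ((F.orderIsoOfFin hF).apply_symm_apply _)

theorem card_eq_of_mem_iff {f : Equiv.Perm (Fin N)} {E F : Finset (Fin N)}
    (h : ∀ u, u ∈ E ↔ f u ∈ F) : F.card = E.card := by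
  simpa using (Fintype.card_congr (f.subtypeEquiv h)).symm

theorem eq_of_standardize_eq {f f' : Equiv.Perm (Fin N)} {E F : Finset (Fin N)}
    {h : ∀ u, u ∈ E ↔ f u ∈ F} {h' : ∀ u, u ∈ E ↔ f' u ∈ F}
    (hs : standardize f E F h = standardize f' E F h') {u : Fin N} (hu : u ∈ E) : f u = f' u := by
  obtain ⟨i, rfl⟩ : ∃ i, E.orderEmbOfFin rfl i = u := by
    have : u ∈ Set.range (E.orderEmbOfFin rfl) := by rwa [Finset.range_orderEmbOfFin]
    exact this
  rw [← orderEmbOfFin_standardize h (card_eq_of_mem_iff h),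
    ← orderEmbOfFin_standardize h' (card_eq_of_mem_iff h)]
  have : (standardize f E F h).2 = (standardize f' E F h').2 := eq_of_heq (Sigma.mk.inj hs).2
  exact congrArg _ (DFunLike.congr_fun this i)

theorem mem_compl_image_inv_iff (f : Equiv.Perm (Fin N)) (S : Finset (Fin N)) (u : Fin N) :
    u ∈ (S.image (f⁻¹ : Equiv.Perm (Fin N)))ᶜ ↔ f u ∈ Sᶜ := by
  simp only [Finset.mem_compl, Finset.mem_image, not_iff_not]
  constructor
  · rintro ⟨s, hs, rfl⟩
    simpa using hs
  · intro h
    exact ⟨f u, h, by simp⟩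

/-- The permutation of `[n]`, `n = N - |S|`, describing `f` outside the preimage of `S`. -/
def standardizeCompl (f : Equiv.Perm (Fin N)) (S : Finset (Fin N)) :
    (n : ℕ) × Equiv.Perm (Fin n) :=
  standardize f (S.image (f⁻¹ : Equiv.Perm (Fin N)))ᶜ Sᶜ (mem_compl_image_inv_iff f S)

theorem standardize_eq_standardizeCompl {f : Equiv.Perm (Fin N)} {E F S : Finset (Fin N)}
    (h : ∀ u, u ∈ E ↔ f u ∈ F) (hF : F = Sᶜ) : standardize f E F h = standardizeCompl f S := by
  subst hF
  obtain rfl : E = (S.image (f⁻¹ : Equiv.Perm (Fin N)))ᶜ := by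
    ext u
    rw [h, mem_compl_image_inv_iff]
  rfl

theorem card_standardizeCompl (f : Equiv.Perm (Fin N)) (S : Finset (Fin N)) :
    (standardizeCompl f S).1 + S.card = N := by
  have h1 : (standardizeCompl f S).1 = (S.image (f⁻¹ : Equiv.Perm (Fin N)))ᶜ.card := rfl
  rw [h1, Finset.card_compl, Finset.card_image_of_injective _ (Equiv.injective _),
    Fintype.card_fin]
  have := card_finset_fin_le S
  omega

/-- A permutation consists of its part with values in S, fixed by the inverse images of S, and of
its part with values outside S, fixed by the standardization. -/
theorem eq_of_standardizeCompl_eq {f f' : Equiv.Perm (Fin N)} {S : Finset (Fin N)}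
    (h : ∀ s ∈ S, f⁻¹ s = f'⁻¹ s) (hs : standardizeCompl f S = standardizeCompl f' S) :
    f = f' := by
  have himg : S.image (f⁻¹ : Equiv.Perm (Fin N)) = S.image (f'⁻¹ : Equiv.Perm (Fin N)) :=
    Finset.image_congr fun s hs => h s hs
  ext1 u
  by_cases hu : u ∈ (S.image (f⁻¹ : Equiv.Perm (Fin N)))ᶜ
  · have h1 : standardizeCompl f' S = standardize f' (S.image (f⁻¹ : Equiv.Perm (Fin N)))ᶜ Sᶜ
        (by rw [himg]; exact mem_compl_image_inv_iff f' S) := by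
      symm
      exact standardize_eq_standardizeCompl _ rfl
    rw [h1] at hs
    exact eq_of_standardize_eq hs hu
  · have h1 : f u ∈ S := by
      rw [mem_compl_image_inv_iff] at hu
      simpa using hu
    have h2 := h _ h1
    exact Equiv.Perm.inv_eq_iff_eq.1 ((f.symm_apply_apply u).symm.trans h2).symm

/-- By `hab` the prescription sends the image of a bijectively onto the image of b; σ, read through
the increasing enumerations, fills in the complements. -/
theorem exists_standardizeCompl_eq {ι : Type*} [Fintype ι] (a b : ι → Fin N)
    (hab : ∀ i i', a i = a i' ↔ b i = b i') (S : Finset (Fin N)) (hS : Finset.univ.image b = S)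
    (σ : (n : ℕ) × Equiv.Perm (Fin n)) (hσ : σ.1 + S.card = N) :
    ∃ f : Equiv.Perm (Fin N), (∀ i, f (a i) = b i) ∧ standardizeCompl f S = σ := by
  classical
  subst hS
  set A := Finset.univ.image a
  set B := Finset.univ.image b
  have hAB : A.card = B.card := by
    refine Finset.card_bij' (fun x hx => b (Finset.mem_image.1 hx).choose)
      (fun x hx => a (Finset.mem_image.1 hx).choose) ?_ ?_ ?_ ?_
    · intro x hx
      simp [B]
    · intro x hx
      simp [A]
    · intro x hx
      have h1 := (Finset.mem_image.1 hx).choose_spec.2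
      conv_rhs => rw [← h1]
      rw [hab]
      exact (Finset.mem_image.1 (Finset.mem_image_of_mem b (Finset.mem_univ
        (Finset.mem_image.1 hx).choose))).choose_spec.2
    · intro x hx
      have h1 := (Finset.mem_image.1 hx).choose_spec.2
      conv_rhs => rw [← h1]
      rw [← hab]
      exact (Finset.mem_image.1 (Finset.mem_image_of_mem a (Finset.mem_univ
        (Finset.mem_image.1 hx).choose))).choose_spec.2
  obtain ⟨n, σ⟩ := σ
  have hAc : Aᶜ.card = n := by
    rw [Finset.card_compl, Fintype.card_fin]
    simp only at hσ
    omega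
  have hBc : Bᶜ.card = n := by
    rw [Finset.card_compl, Fintype.card_fin]
    simp only at hσ
    omega
  subst hAc
  let g : Fin N → Fin N := fun x =>
    if hx : x ∈ A then b (Finset.mem_image.1 hx).choose
    else Bᶜ.orderEmbOfFin hBc (σ ((Aᶜ.orderIsoOfFin rfl).symm ⟨x, Finset.mem_compl.2 hx⟩))
  have hga : ∀ i, g (a i) = b i := by
    intro i
    have hx : a i ∈ A := Finset.mem_image_of_mem a (Finset.mem_univ i)
    have h1 : g (a i) = b (Finset.mem_image.1 hx).choose := dif_pos hx
    rw [h1, ← hab]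
    exact (Finset.mem_image.1 hx).choose_spec.2
  have hgc : ∀ x, ∀ hx : x ∉ A, g x =
      Bᶜ.orderEmbOfFin hBc (σ ((Aᶜ.orderIsoOfFin rfl).symm ⟨x, Finset.mem_compl.2 hx⟩)) :=
    fun x hx => dif_neg hx
  have hgcB : ∀ x, x ∉ A → g x ∉ B := by
    intro x hx
    rw [hgc x hx, ← Finset.mem_compl]
    exact Finset.orderEmbOfFin_mem _ _ _
  have hgB : ∀ x, x ∈ A → g x ∈ B := by
    intro x hx
    obtain ⟨i, -, rfl⟩ := Finset.mem_image.1 hx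
    rw [hga]
    exact Finset.mem_image_of_mem b (Finset.mem_univ i)
  have hg : Function.Injective g := by
    intro x y hxy
    by_cases hx : x ∈ A <;> by_cases hy : y ∈ A
    · obtain ⟨i, -, rfl⟩ := Finset.mem_image.1 hx
      obtain ⟨i', -, rfl⟩ := Finset.mem_image.1 hy
      rw [hga, hga] at hxy
      exact (hab _ _).2 hxy
    · exact absurd (hxy ▸ hgB x hx) (hgcB y hy)
    · exact absurd (hxy ▸ hgB y hy) (hgcB x hx)
    · rw [hgc x hx, hgc y hy] at hxy
      have h1 := (Bᶜ.orderEmbOfFin hBc).injective hxy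
      have h2 := (Aᶜ.orderIsoOfFin rfl).symm.injective (σ.injective h1)
      exact congrArg Subtype.val h2
  let f : Equiv.Perm (Fin N) := Equiv.ofBijective g (Finite.injective_iff_bijective.1 hg)
  have hf : ∀ u, u ∈ Aᶜ ↔ f u ∈ Bᶜ := by
    intro u
    simp only [Finset.mem_compl, not_iff_not]
    exact ⟨hgB u, fun h => by_contra fun h' => hgcB u h' h⟩
  refine ⟨f, hga, ?_⟩
  rw [← standardize_eq_standardizeCompl hf rfl]
  refine Sigma.ext rfl (heq_of_eq ?_)
  refine Equiv.ext fun (i : Fin Aᶜ.card) => ?_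
  apply (Bᶜ.orderEmbOfFin hBc).injective
  have h1 := orderEmbOfFin_standardize hf hBc i
  refine h1.trans ?_
  have hi : Aᶜ.orderEmbOfFin rfl i ∉ A := by
    rw [← Finset.mem_compl]
    exact Finset.orderEmbOfFin_mem _ _ _
  refine (hgc _ hi).trans ?_
  congr 2
  exact (OrderIso.symm_apply_eq _).2 (Subtype.ext (by simp))

end Standardize

end Cacti

namespace Cacti

open FiveTuple

/-! ### Relabelled cacti -/

section Model

variable {N : ℕ}

/-- A partitioned cactus with cactus tree `τ` in which the labels of each color have been
rearranged so that the blocks are consecutive intervals: `en c k` is the last label of the `k`-th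
block of color `c`, `kp c j` is the label of color `c` of the last passage of the `j`-th non-root
block of color `c.next`, and `E c` sends the white label of a triangle to its label of
color `c`. -/
structure IsModel (τ : CactusTree) (en kp : Color → ℕ → Fin N)
    (E : Color → Equiv.Perm (Fin N)) : Prop where
  vcount_pos : ∀ c, 0 < τ.vcount c
  spine : ∀ c, IsSpine (τ.dcount c) (τ.dcount c.next) (τ.kidStart c) (τ.Flagged c) (en c) (kp c)
  last : ∀ c, (en c (τ.vcount c - 1)).val + 1 = N
  root : ∀ k < τ.dcount .white, en .white k < en .white (τ.dcount .white)
  white : E .white = 1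
  kid : ∀ c, ∀ j < τ.dcount c.next, (E c)⁻¹ (kp c j) = (E c.next)⁻¹ (en c.next j)

/-- The ends of non-root blocks of color `c` and the last passage labels of color `c` of the
non-root blocks of color `c.next`. -/
def support (τ : CactusTree) (en kp : Color → ℕ → Fin N) (c : Color) : Finset (Fin N) :=
  spineSet (τ.dcount c) (τ.dcount c.next) (en c) (kp c)

/-- The 7-tuple of a relabelled cactus. -/
def encode (τ : CactusTree) (en kp : Color → ℕ → Fin N) (E : Color → Equiv.Perm (Fin N)) :
    SevenTuple N where
  τ := τ
  S₀ := support τ en kp .white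
  S₁ := (support τ en kp .grey).filter fun x => x.val + 1 < N
  S₂ := (support τ en kp .black).filter fun x => x.val + 1 < N
  χ := ((List.range (τ.vcount .grey)).map fun k => (E .grey)⁻¹ (en .grey k)).filter
    fun t => t ∉ support τ en kp .white
  σ₁ := standardizeCompl (E .grey) (support τ en kp .grey)
  σ₂ := standardizeCompl (E .black) (support τ en kp .black)

theorem encode_congr {τ : CactusTree} {en kp en' kp' : Color → ℕ → Fin N}
    {E : Color → Equiv.Perm (Fin N)}
    (hen : ∀ c, ∀ k < τ.vcount c, en c k = en' c k)
    (hkp : ∀ c, ∀ j < τ.dcount c.next, kp c j = kp' c j) :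
    encode τ en kp E = encode τ en' kp' E := by
  have hs : ∀ c, support τ en kp c = support τ en' kp' c := by
    intro c
    unfold support spineSet
    congr 1
    · exact Finset.image_congr fun k hk =>
        hen c k ((Finset.mem_range.1 hk).trans_le (τ.dcount_le c))
    · exact Finset.image_congr fun j hj => hkp c j (Finset.mem_range.1 hj)
  have hl : ((List.range (τ.vcount .grey)).map fun k => (E .grey)⁻¹ (en .grey k)) =
      (List.range (τ.vcount .grey)).map fun k => (E .grey)⁻¹ (en' .grey k) :=
    List.map_congr_left fun k hk => by rw [hen _ k (List.mem_range.1 hk)]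
  unfold encode
  rw [hl, hs, hs, hs]

theorem CactusTree.kidStart_succ_le (τ : CactusTree) (c : Color) :
    ∀ k < τ.dcount c, τ.kidStart c (k + 1) ≤ τ.dcount c.next :=
  fun _ hk => τ.kidStart_le (hk.trans_le (τ.dcount_le c))

variable {τ : CactusTree} {en kp : Color → ℕ → Fin N} {E : Color → Equiv.Perm (Fin N)}

open Classical in
/-- The number of grey vertices whose last passage is not the one of a white or black vertex. -/
theorem card_free {en kp : Color → ℕ → Fin N}
    (h : ∀ c, IsSpine (τ.dcount c) (τ.dcount c.next) (τ.kidStart c) (τ.Flagged c) (en c) (kp c)) :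
    ((List.range (τ.dcount .grey)).filter fun k => ¬ ((∃ i < τ.dcount .white,
      kp .grey i = en .grey k) ∨ ∃ i < τ.dcount .black, en .black i = kp .black k)).length +
      τ.numTriangles .white .white + τ.numTriangles .black .white = τ.dcount .grey := by
  set P : ℕ → Prop := fun k => (∃ i < τ.dcount .white, kp .grey i = en .grey k) ∨
    ∃ i < τ.dcount .black, en .black i = kp .black k
  have h0 : ((List.range (τ.dcount .grey)).filter fun k => ¬ P k).length =
      ((Finset.range (τ.dcount .grey)).filter fun k => ¬ P k).card := by
    rw [Finset.card_def, Finset.filter_val, Finset.range_val,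
      Multiset.range, Multiset.filter_coe, Multiset.coe_card]
  set F := (Finset.range (τ.dcount .black)).filter (τ.Flagged .black)
  have hF : F.card = τ.numTriangles .white .white := τ.card_flagged .white
  have hFl : ∀ i ∈ F, τ.kidStart .black i < τ.kidStart .black (i + 1) ∧
      τ.kidStart .black (i + 1) ≤ τ.dcount .grey ∧ i < τ.dcount .black ∧ τ.Flagged .black i := by
    intro i hi
    simp only [F, Finset.mem_filter, Finset.mem_range] at hi
    exact ⟨hi.2.kidStart_lt, τ.kidStart_succ_le .black i hi.1, hi⟩
  -- The grey last passages that occur elsewhere are those of the flagged grey vertices, shared with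
  -- a white child, and those of the rightmost children of the flagged black vertices. The two kinds
  -- are disjoint by `Flagged.not_flagged`, and each is counted by triangles.
  have h1 : ((Finset.range (τ.dcount .grey)).filter P) =
      (Finset.range (τ.dcount .grey)).filter (τ.Flagged .grey) ∪
        F.image fun i => τ.kidStart .black (i + 1) - 1 := by
    ext k
    simp only [Finset.mem_filter, Finset.mem_union, Finset.mem_range, Finset.mem_image]
    constructor
    · rintro ⟨hk, hx | ⟨i, hi, hx⟩⟩
      · exact .inl ⟨hk, ((h .grey).flag k hk).2 hx⟩
      · right
        obtain ⟨h3, h4⟩ := ((h .black).kp_eq_en (τ.kidStart_succ_le .black) hi hk).1 hx.symm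
        refine ⟨i, ?_, by omega⟩
        simp [F, hi, h3]
    · rintro (⟨hk, hf⟩ | ⟨i, hi, rfl⟩)
      · exact ⟨hk, .inl (((h .grey).flag k hk).1 hf)⟩
      · obtain ⟨h2, h3, h4, h5⟩ := hFl i hi
        have hk : τ.kidStart .black (i + 1) - 1 < τ.dcount .grey := by omega
        exact ⟨hk, .inr ⟨i, h4, (((h .black).kp_eq_en (τ.kidStart_succ_le .black) h4 hk).2
          ⟨h5, by omega⟩).symm⟩⟩
  have h2 : Disjoint ((Finset.range (τ.dcount .grey)).filter (τ.Flagged .grey))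
      (F.image fun i => τ.kidStart .black (i + 1) - 1) := by
    rw [Finset.disjoint_right]
    intro k hk hk'
    obtain ⟨i, hi, rfl⟩ := Finset.mem_image.1 hk
    exact (hFl i hi).2.2.2.not_flagged (Finset.mem_filter.1 hk').2
  have h3 : (F.image fun i => τ.kidStart .black (i + 1) - 1).card = F.card := by
    refine Finset.card_image_of_injOn fun i hi i' hi' he => ?_
    obtain ⟨h2, h3, h4, h5⟩ := hFl i hi
    obtain ⟨h2', h3', h4', h5'⟩ := hFl i' hi'
    have hk : τ.kidStart .black (i + 1) - 1 < τ.dcount .grey := by omega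
    have e1 := ((h .black).kp_eq_en (τ.kidStart_succ_le .black) h4 hk).2 ⟨h5, by omega⟩
    have e2 := ((h .black).kp_eq_en (τ.kidStart_succ_le .black) h4' hk).2 ⟨h5', by omega⟩
    exact ((h .black).en_inj h4 h4').1 (e1.symm.trans e2)
  have h4 := Finset.card_filter_add_card_filter_not (s := Finset.range (τ.dcount .grey)) P
  rw [h1, Finset.card_union_of_disjoint h2, h3, hF, Finset.card_range] at h4
  have h5 : ((Finset.range (τ.dcount .grey)).filter (τ.Flagged .grey)).card =
    τ.numTriangles .black .white := τ.card_flagged .black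
  rw [h0]
  omega

/-! ### The seven-tuple of a model belongs to the target set -/

namespace IsModel

theorem kp_white (h : IsModel τ en kp E) {j : ℕ} (hj : j < τ.dcount .black) :
    (E .black)⁻¹ (en .black j) = kp .white j := by
  have := h.kid .white j hj
  rw [h.white] at this
  exact this.symm

theorem en_white (h : IsModel τ en kp E) {j : ℕ} (hj : j < τ.dcount .white) :
    (E .grey)⁻¹ (kp .grey j) = en .white j := by
  have := h.kid .grey j hj
  rw [this]
  simp only [Color.next, h.white]
  rfl

theorem kp_black (h : IsModel τ en kp E) {j : ℕ} (hj : j < τ.dcount .grey) :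
    (E .black)⁻¹ (kp .black j) = (E .grey)⁻¹ (en .grey j) :=
  h.kid .black j hj

theorem inv_en_grey_eq_en (h : IsModel τ en kp E) {i k : ℕ} (hi : i < τ.dcount .white) :
    (E .grey)⁻¹ (en .grey k) = en .white i ↔ kp .grey i = en .grey k := by
  rw [← h.en_white hi, (Equiv.injective _).eq_iff, eq_comm]

theorem inv_en_grey_eq_kp (h : IsModel τ en kp E) {i k : ℕ} (hi : i < τ.dcount .black)
    (hk : k < τ.dcount .grey) :
    (E .grey)⁻¹ (en .grey k) = kp .white i ↔ en .black i = kp .black k := by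
  rw [← h.kp_white hi, ← h.kp_black hk, (Equiv.injective _).eq_iff, eq_comm]

/-- Through the identities between child positions and ends, coincidences in the white labels become
coincidences inside the grey or the black spine. They can be read without knowing `E`. -/
theorem inv_en_grey_mem (h : IsModel τ en kp E) {k : ℕ} (hk : k < τ.dcount .grey) :
    (E .grey)⁻¹ (en .grey k) ∈ support τ en kp .white ↔
      (∃ i < τ.dcount .white, kp .grey i = en .grey k) ∨
        ∃ i < τ.dcount .black, en .black i = kp .black k := by
  rw [support, mem_spineSet]
  refine or_congr (exists_congr fun i => and_congr_right fun hi => ?_)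
    (exists_congr fun i => and_congr_right fun hi => ?_)
  · rw [eq_comm, h.inv_en_grey_eq_en hi]
  · rw [eq_comm, h.inv_en_grey_eq_kp hi hk]

theorem inv_en_grey_injOn (h : IsModel τ en kp E) {k k' : ℕ} (hk : k < τ.dcount .grey)
    (hk' : k' < τ.dcount .grey) (he : (E .grey)⁻¹ (en .grey k) = (E .grey)⁻¹ (en .grey k')) :
    k = k' :=
  ((h.spine .grey).en_inj hk hk').1 ((Equiv.injective _) he)

theorem last_mem (h : IsModel τ en kp E) {c : Color} (hc : c ≠ .white) :
    en c (τ.vcount c - 1) ∈ support τ en kp c := by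
  rw [support, mem_spineSet]
  have := h.vcount_pos c
  exact .inl ⟨_, by simp [CactusTree.dcount, hc]; omega, rfl⟩

/-- The last black or grey block is not the root, so its end, the label N, always lies in the
support. Leaving it out loses nothing. -/
theorem insert_filter (h : IsModel τ en kp E) {c : Color} (hc : c ≠ .white) :
    insert (en c (τ.vcount c - 1)) ((support τ en kp c).filter fun x => x.val + 1 < N) =
      support τ en kp c := by
  ext x
  simp only [Finset.mem_insert, Finset.mem_filter]
  constructor
  · rintro (rfl | hx)
    · exact h.last_mem hc
    · exact hx.1
  · intro hx
    by_cases hxN : x.val + 1 < N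
    · exact .inr ⟨hx, hxN⟩
    · left
      have := h.last c
      have := x.isLt
      exact Fin.ext (by omega)

theorem card_support (h : IsModel τ en kp E) (d : Color) :
    (support τ en kp d.next).card + τ.numTriangles d .white =
      τ.dcount d.next + τ.dcount d.next.next := by
  classical
  rw [← τ.card_flagged]
  exact (h.spine d.next).card_spineSet

theorem card_filter_support (h : IsModel τ en kp E) {c : Color} (hc : c ≠ .white) :
    ((support τ en kp c).filter fun x => x.val + 1 < N).card + 1 = (support τ en kp c).card := by
  rw [← Finset.card_insert_of_notMem, h.insert_filter hc]
  have := h.last c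
  simp only [Finset.mem_filter, not_and]
  omega

theorem length_chi (h : IsModel τ en kp E) :
    (encode τ en kp E).χ.length + τ.numTriangles .white .white + τ.numTriangles .black .white =
      τ.vcount .grey := by
  classical
  rw [τ.vcount_grey]
  refine Eq.trans ?_ (card_free h.spine)
  congr 2
  simp only [encode]
  rw [List.filter_map, List.length_map, τ.vcount_grey]
  congr 1
  refine List.filter_congr fun k hk => ?_
  simp only [Function.comp_apply, h.inv_en_grey_mem (List.mem_range.1 hk)]

theorem encode_mem (h : IsModel τ en kp E) :
    encode τ en kp E ∈ I (τ.vcount .white) (τ.vcount .black) (τ.vcount .grey) N := by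
  have hw := h.card_support .grey
  have hb := h.card_support .white
  have hg := h.card_support .black
  have hb' := h.card_filter_support (c := .black) (by simp)
  have hg' := h.card_filter_support (c := .grey) (by simp)
  have v1 := τ.vcount_white
  have v2 := τ.vcount_black
  have v3 := τ.vcount_grey
  have s1 := card_standardizeCompl (E .grey) (support τ en kp .grey)
  have s2 := card_standardizeCompl (E .black) (support τ en kp .black)
  have hχ := h.length_chi
  simp only [Color.next] at hw hb hg
  refine ⟨τ.numTriangles .grey .white, τ.numTriangles .white .white, τ.numTriangles .black .white,
    ⟨(τ.vcount_eq _).symm, (τ.vcount_eq _).symm, (τ.vcount_eq _).symm, rfl, rfl, rfl⟩,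
    ?_, ⟨?_, ?_⟩, ⟨?_, ?_⟩, ⟨?_, by omega⟩, ?_, ?_, ?_⟩
  · simp only [encode]; omega
  · simp only [encode]; omega
  · simp [encode]
  · simp only [encode]; omega
  · simp [encode]
  · refine List.Nodup.filter _ ?_
    refine List.Nodup.map_on (fun k hk k' hk' he => ?_) List.nodup_range
    rw [List.mem_range, v3] at hk hk'
    exact h.inv_en_grey_injOn hk hk' he
  · intro x hx
    simp only [encode, List.mem_filter, decide_eq_true_eq] at hx
    exact hx.2
  · simp only [encode]; omega
  · simp only [encode]; omega

end IsModel

/-! ### Injectivity of the encoding of models -/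

theorem map_eq_of_filter_map_eq {ι α : Type*} {x x' : ι → α} {P : α → Bool} {l : List ι}
    (hP : ∀ k ∈ l, P (x k) = P (x' k)) (h : (l.map x).filter P = (l.map x').filter P) :
    ∀ k ∈ l, P (x k) = true → x k = x' k := by
  induction l with
  | nil => simp
  | cons i l ih =>
    have hi := hP i (by simp)
    have hP' : ∀ k ∈ l, P (x k) = P (x' k) := fun k hk => hP k (by simp [hk])
    simp only [List.map_cons, List.filter_cons, ← hi] at h
    intro k hk hk'
    by_cases hPi : P (x i) = true
    · simp only [hPi, if_true, List.cons.injEq] at h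
      rcases List.mem_cons.1 hk with rfl | hk
      · exact h.1
      · exact ih hP' h.2 k hk hk'
    · rw [if_neg hPi, if_neg hPi] at h
      rcases List.mem_cons.1 hk with rfl | hk
      · exact absurd hk' hPi
      · exact ih hP' h k hk hk'

/-- The supports give the spines by rigidity. Over the supports the inverse transfers are then
known, except for the white labels of the grey last passages, which are treated in `hx`. -/
theorem IsModel.encode_inj {en' kp' : Color → ℕ → Fin N} {E' : Color → Equiv.Perm (Fin N)}
    (h : IsModel τ en kp E) (h' : IsModel τ en' kp' E')
    (he : encode τ en kp E = encode τ en' kp' E') :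
    (∀ c, ∀ k < τ.vcount c, en c k = en' c k) ∧ E = E' := by
  have hlast : ∀ c, en c (τ.vcount c - 1) = en' c (τ.vcount c - 1) := by
    intro c
    have h1 := h.last c
    have h2 := h'.last c
    exact Fin.ext (by omega)
  have hS : ∀ c, support τ en kp c = support τ en' kp' c := by
    intro c
    cases c
    · exact congrArg SevenTuple.S₀ he
    · rw [← h.insert_filter (c := .black) (by simp), ← h'.insert_filter (c := .black) (by simp),
        hlast]
      congr 1
      exact congrArg SevenTuple.S₂ he
    · rw [← h.insert_filter (c := .grey) (by simp), ← h'.insert_filter (c := .grey) (by simp),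
        hlast]
      congr 1
      exact congrArg SevenTuple.S₁ he
  have hU := fun c => (h.spine c).unique (h'.spine c) (τ.kidStart_succ_le c) (hS c)
  have hen := fun c => (hU c).1
  have hkp := fun c => (hU c).2
  -- A label in the white support is named by the white end or child position with which it
  -- coincides; any other one is an entry of χ. The same indices are free in both models, so the
  -- entries match.
  have hx : ∀ k < τ.dcount .grey, (E .grey)⁻¹ (en .grey k) = (E' .grey)⁻¹ (en' .grey k) := by
    have hmem : ∀ k < τ.dcount .grey, ((E .grey)⁻¹ (en .grey k) ∈ support τ en kp .white ↔
        (E' .grey)⁻¹ (en' .grey k) ∈ support τ en kp .white) := by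
      intro k hk
      rw [h.inv_en_grey_mem hk, hS, h'.inv_en_grey_mem hk, hen _ k hk, hkp .black k hk]
      refine or_congr (exists_congr fun i => and_congr_right fun hi => ?_)
        (exists_congr fun i => and_congr_right fun hi => ?_)
      · rw [hkp .grey i hi]
      · rw [hen .black i hi]
    intro k hk
    by_cases hxk : (E .grey)⁻¹ (en .grey k) ∈ support τ en kp .white
    · rcases (h.inv_en_grey_mem hk).1 hxk with ⟨i, hi, h1⟩ | ⟨i, hi, h1⟩
      · rw [(h.inv_en_grey_eq_en hi).2 h1, hen _ i hi, eq_comm, h'.inv_en_grey_eq_en hi,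
          ← hen _ k hk, ← hkp .grey i hi, h1]
      · rw [(h.inv_en_grey_eq_kp hi hk).2 h1, hkp .white i hi, eq_comm,
          h'.inv_en_grey_eq_kp hi hk, ← hkp .black k hk, ← hen .black i hi, h1]
    · have hχ := congrArg SevenTuple.χ he
      simp only [encode] at hχ
      rw [← hS] at hχ
      refine map_eq_of_filter_map_eq ?_ hχ k ?_ ?_
      · intro k hk
        rw [List.mem_range, τ.vcount_grey] at hk
        simp only [hmem k hk]
      · rwa [List.mem_range, τ.vcount_grey]
      · simpa using hxk
  refine ⟨fun c k hk => ?_, ?_⟩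
  · rcases lt_or_ge k (τ.dcount c) with h1 | h1
    · exact hen c k h1
    · have h2 : τ.vcount c ≤ τ.dcount c + 1 := by
        unfold CactusTree.dcount
        split_ifs <;> omega
      obtain rfl : k = τ.vcount c - 1 := by omega
      exact hlast c
  · funext c
    cases c
    · rw [h.white, h'.white]
    · refine eq_of_standardizeCompl_eq (S := support τ en kp .black) ?_ ?_
      · intro s hs
        rw [support, mem_spineSet] at hs
        rcases hs with ⟨k, hk, rfl⟩ | ⟨j, hj, rfl⟩
        · rw [h.kp_white hk, hen _ k hk, h'.kp_white hk]
          exact hkp .white k hk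
        · rw [h.kp_black hj, hkp .black j hj, h'.kp_black hj]
          exact hx j hj
      · conv_rhs => rw [hS]
        exact congrArg SevenTuple.σ₂ he
    · refine eq_of_standardizeCompl_eq (S := support τ en kp .grey) ?_ ?_
      · intro s hs
        rw [support, mem_spineSet] at hs
        rcases hs with ⟨k, hk, rfl⟩ | ⟨j, hj, rfl⟩
        · rw [hx k hk, hen _ k hk]
        · rw [h.en_white hj, hkp .grey j hj, h'.en_white hj]
          exact hen .white j hj
      · conv_rhs => rw [hS]
        exact congrArg SevenTuple.σ₁ he

/-! ### Surjectivity of the encoding of models -/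

theorem exists_map_eq {ι α : Type*} [DecidableEq ι] [Inhabited α] (l : List ι) (hl : l.Nodup)
    (χ : List α) (h : l.length = χ.length) : ∃ y : ι → α, l.map y = χ := by
  refine ⟨fun k => χ.getD (l.idxOf k) default, ?_⟩
  apply List.ext_getElem
  · simpa using h
  · intro i h1 h2
    simp only [List.getElem_map]
    rw [hl.idxOf_getElem, List.getD_eq_getElem _ _ h2]

/-- A childless root would make the whole tree a leaf, without black vertices. As the root is the
last white vertex, its children are the last black ones. -/
theorem CactusTree.kidStart_root_lt (h : 0 < τ.vcount .black) :
    τ.kidStart .white (τ.dcount .white) < τ.dcount .black := by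
  have h1 : τ.kidStart .white (τ.dcount .white + 1) = _ := τ.kidStart_succ τ.getElem?_verts_root
  have h2 : τ.kidStart .white (τ.vcount .white) = τ.dcount .black := τ.kidStart_vcount .white
  rw [τ.vcount_white] at h2
  have h3 : τ.kids.length ≠ 0 := by
    intro h0
    have h4 : τ = .leaf := CactusTree.kids_injective (List.length_eq_zero_iff.1 h0)
    rw [τ.vcount_eq, h4] at h
    simp [CactusTree.numVertices] at h
  simp only at h1
  omega

theorem exists_isModel [NeZero N] {p₁ p₂ p₃ : ℕ} {X : SevenTuple N} (hX : X ∈ I p₁ p₂ p₃ N) :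
    ∃ en kp E, IsModel X.τ en kp E ∧ encode X.τ en kp E = X := by
  classical
  obtain ⟨a, b, c, ⟨rfl, rfl, rfl, rfl, rfl, rfl⟩, h0, ⟨h1, h1'⟩, ⟨h2, h2'⟩, ⟨hχ, hχ'⟩, hχ0, hσ1,
    hσ2⟩ := hX
  obtain ⟨τ, S₀, S₁, S₂, χ, σ₁, σ₂⟩ := X
  simp only at *
  rw [← τ.vcount_eq] at h0 h1 h2 hχ' hσ1 hσ2
  rw [← τ.vcount_eq] at h0 h1 h2 hσ1 hσ2
  have v1 := τ.vcount_white
  have v2 := τ.vcount_black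
  have v3 := τ.vcount_grey
  have z1 : τ.vcount .black = 0 → τ.dcount .grey = 0 := τ.dcount_next_eq_zero (c := .black)
  have z2 : τ.vcount .grey = 0 → τ.dcount .white = 0 := τ.dcount_next_eq_zero (c := .grey)
  -- Without black vertices there are no grey ones, and without grey ones the root is the only white
  -- vertex. The prescribed size of `S₂`, respectively of `S₁`, would then be negative.
  have hpos : ∀ c, 0 < τ.vcount c := by
    intro c
    cases c <;> omega
  have hN := NeZero.pos N
  -- The element d stands for the label N, to be restored in the black and grey supports.
  obtain ⟨d, hd⟩ : ∃ d : Fin N, d.val + 1 = N := ⟨⟨N - 1, by omega⟩, by simp; omega⟩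
  have hd1 : ∀ x : Fin N, x ≤ d := fun x => Fin.le_def.2 (by have := x.isLt; omega)
  have hdS1 : d ∉ S₁ := fun hm => by have := h1' d hm; omega
  have hdS2 : d ∉ S₂ := fun hm => by have := h2' d hm; omega
  let S : Color → Finset (Fin N)
    | .white => S₀
    | .black => insert d S₂
    | .grey => insert d S₁
  have hsp : ∀ c, ∃ en kp : ℕ → Fin N,
      IsSpine (τ.dcount c) (τ.dcount c.next) (τ.kidStart c) (τ.Flagged c) en kp ∧
      spineSet (τ.dcount c) (τ.dcount c.next) en kp = S c ∧ ∀ k, τ.dcount c ≤ k → en k = d := by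
    intro c
    refine exists_isSpine (τ.kidStart_mono c) (τ.kidStart_succ_le c)
      (fun k _ hf => hf.kidStart_lt) (S c) ?_ d
    obtain ⟨e, rfl⟩ : ∃ e : Color, e.next = c := ⟨c.next.next, c.next_next_next⟩
    rw [τ.card_flagged]
    cases e
    · simp only [S, Color.next, Finset.card_insert_of_notMem hdS2]
      omega
    · simp only [S, Color.next, Finset.card_insert_of_notMem hdS1]
      omega
    · simp only [S, Color.next]
      omega
  choose en kp hspine hset hroot using hsp
  -- The last end dominates all ends and, since no child position lies beyond it, all child
  -- positions as well; d is one of them and is the maximum of [N].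
  have hlast' : ∀ c, c ≠ .white → d ∈ S c → en c (τ.vcount c - 1) = d := by
    intro c hc hdS
    have hcp := hpos c
    have hdc : τ.dcount c = τ.vcount c := by simp [CactusTree.dcount, hc]
    apply le_antisymm (hd1 _)
    rw [← hset c, mem_spineSet] at hdS
    rcases hdS with ⟨k, hk, he⟩ | ⟨j, hj, he⟩
    · rw [← he, ← not_lt, (hspine c).en_lt_iff (by omega) hk]
      omega
    · rw [← he, ← not_lt, (hspine c).en_lt_kp _ (by omega) j hj,
        Nat.sub_add_cancel hcp, τ.kidStart_vcount]
      omega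
  have hlast : ∀ c, en c (τ.vcount c - 1) = d := by
    intro c
    cases c
    · exact hroot .white _ (by omega)
    · exact hlast' .black (by simp) (by simp [S])
    · exact hlast' .grey (by simp) (by simp [S])
  -- The position of the last black vertex, a child of the root, lies strictly beyond every end of a
  -- non-root white block.
  have hrootlt : ∀ k < τ.dcount .white, en .white k < en .white (τ.dcount .white) := by
    intro k hk
    rw [hroot .white _ le_rfl]
    have hr := τ.kidStart_root_lt (hpos .black)
    have := τ.kidStart_mono .white hk
    refine lt_of_lt_of_le (((hspine .white).en_lt_kp k hk (τ.dcount .black - 1) ?_).2 ?_) (hd1 _)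
    · simp only [Color.next]
      omega
    · simp only [Nat.succ_eq_add_one] at this
      omega
  -- `y` distributes the entries of χ, in order, over the free grey vertices; `card_free` says that
  -- their number is the length of χ.
  obtain ⟨y, hy⟩ := exists_map_eq _ (List.nodup_range.filter _) χ
    (by have := card_free hspine; omega :
      ((List.range (τ.dcount .grey)).filter fun k => ¬ ((∃ i < τ.dcount .white,
        kp .grey i = en .grey k) ∨ ∃ i < τ.dcount .black, en .black i = kp .black k)).length =
          χ.length)
  -- `x k` is the intended white label of the last passage of the k-th grey block: forced when it
  -- coincides with a white end or child position, otherwise taken from χ.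
  let x : ℕ → Fin N := fun k =>
    if h : ∃ i < τ.dcount .white, kp .grey i = en .grey k then en .white h.choose
    else if h : ∃ i < τ.dcount .black, en .black i = kp .black k then kp .white h.choose
    else y k
  have hx1 : ∀ k, ∀ i < τ.dcount .white, kp .grey i = en .grey k → x k = en .white i := by
    intro k i hi he
    have hex : ∃ i < τ.dcount .white, kp .grey i = en .grey k := ⟨i, hi, he⟩
    have : x k = en .white hex.choose := dif_pos hex
    rw [this, ((hspine .grey).kp_inj hex.choose_spec.1 hi).1 (hex.choose_spec.2.trans he.symm)]
  have hexcl : ∀ k < τ.dcount .grey, ∀ i < τ.dcount .black, en .black i = kp .black k →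
      ¬ ∃ i < τ.dcount .white, kp .grey i = en .grey k := by
    intro k hk i hi he hex
    obtain ⟨hf, hf'⟩ := ((hspine .black).kp_eq_en (τ.kidStart_succ_le .black) hi hk).1 he.symm
    refine hf.not_flagged ?_
    rw [← hf', Nat.add_sub_cancel]
    exact ((hspine .grey).flag k hk).2 hex
  have hx2 : ∀ k < τ.dcount .grey, ∀ i < τ.dcount .black, en .black i = kp .black k →
      x k = kp .white i := by
    intro k hk i hi he
    have hex : ∃ i < τ.dcount .black, en .black i = kp .black k := ⟨i, hi, he⟩
    have : x k = kp .white hex.choose :=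
      (dif_neg (hexcl k hk i hi he)).trans (dif_pos hex)
    rw [this, ((hspine .black).en_inj hex.choose_spec.1 hi).1 (hex.choose_spec.2.trans he.symm)]
  have hx3 : ∀ k < τ.dcount .grey, ¬ ((∃ i < τ.dcount .white, kp .grey i = en .grey k) ∨
      ∃ i < τ.dcount .black, en .black i = kp .black k) → x k = y k ∧ y k ∈ χ := by
    intro k hk hn
    refine ⟨(dif_neg fun h => hn (.inl h)).trans (dif_neg fun h => hn (.inr h)), ?_⟩
    rw [← hy]
    exact List.mem_map_of_mem (List.mem_filter.2 ⟨List.mem_range.2 hk, by simpa using hn⟩)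
  have hS0e : ∀ i < τ.dcount .white, en .white i ∈ S₀ := by
    intro i hi
    have : S₀ = S .white := rfl
    rw [this, ← hset .white, mem_spineSet]
    exact .inl ⟨i, hi, rfl⟩
  have hS0k : ∀ i < τ.dcount .black, kp .white i ∈ S₀ := by
    intro i hi
    have : S₀ = S .white := rfl
    rw [this, ← hset .white, mem_spineSet]
    exact .inr ⟨i, hi, rfl⟩
  have hxS : ∀ k < τ.dcount .grey, (x k ∈ S₀ ↔ (∃ i < τ.dcount .white, kp .grey i = en .grey k) ∨
      ∃ i < τ.dcount .black, en .black i = kp .black k) := by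
    intro k hk
    constructor
    · intro hm
      by_contra hn
      obtain ⟨e1, e2⟩ := hx3 k hk hn
      exact hχ0 _ e2 (e1 ▸ hm)
    · rintro (⟨i, hi, he⟩ | ⟨i, hi, he⟩)
      · rw [hx1 k i hi he]
        exact hS0e i hi
      · rw [hx2 k hk i hi he]
        exact hS0k i hi
  -- Such a double coincidence would make the black vertex i' both the rightmost child of a flagged
  -- vertex and flagged itself.
  have hfl : ∀ i < τ.dcount .white, ∀ i' < τ.dcount .black, ∀ k < τ.dcount .grey,
      en .white i = kp .white i' → en .black i' ≠ kp .black k := by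
    intro i hi i' hi' k hk he he'
    obtain ⟨g1, g2⟩ := ((hspine .white).kp_eq_en (τ.kidStart_succ_le .white) hi hi').1 he.symm
    refine g1.not_flagged ?_
    rw [← g2, Nat.add_sub_cancel]
    exact ((hspine .black).flag i' hi').2 ⟨k, hk, he'.symm⟩
  -- The labels `x k` must have the same coincidences with the white spine as the grey and black
  -- spines prescribe. With `hx2'` and `hxinj`, this makes the partial maps below well defined and
  -- injective.
  have hx1' : ∀ k < τ.dcount .grey, ∀ i < τ.dcount .white,
      (en .white i = x k ↔ kp .grey i = en .grey k) := by
    intro k hk i hi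
    refine ⟨fun he => ?_, fun he => (hx1 k i hi he).symm⟩
    rcases (hxS k hk).1 (he ▸ hS0e i hi) with ⟨i', hi', he'⟩ | ⟨i', hi', he'⟩
    · rw [hx1 k i' hi' he', (hspine .white).en_inj hi hi'] at he
      rwa [he]
    · rw [hx2 k hk i' hi' he'] at he
      exact absurd he' (hfl i hi i' hi' k hk he)
  have hx2' : ∀ k < τ.dcount .grey, ∀ i < τ.dcount .black,
      (kp .white i = x k ↔ en .black i = kp .black k) := by
    intro k hk i hi
    refine ⟨fun he => ?_, fun he => (hx2 k hk i hi he).symm⟩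
    rcases (hxS k hk).1 (he ▸ hS0k i hi) with ⟨i', hi', he'⟩ | ⟨i', hi', he'⟩
    · rw [hx1 k i' hi' he'] at he
      obtain ⟨g1, g2⟩ :=
        ((hspine .white).kp_eq_en (τ.kidStart_succ_le .white) hi' hi).1 he
      have g3 : τ.Flagged .grey k := ((hspine .grey).flag k hk).2 ⟨i', hi', he'⟩
      have g4 := ((hspine .grey).kp_eq_en (τ.kidStart_succ_le .grey) hk hi').1 he'
      refine absurd g1 ?_
      have := g3.not_flagged
      rwa [← g4.2, Nat.add_sub_cancel] at this
    · rw [hx2 k hk i' hi' he', (hspine .white).kp_inj hi hi'] at he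
      rwa [he]
  have hxinj : ∀ k < τ.dcount .grey, ∀ k' < τ.dcount .grey, x k = x k' → k = k' := by
    intro k hk k' hk' he
    by_cases hm : x k ∈ S₀
    · rcases (hxS k hk).1 hm with ⟨i, hi, e1⟩ | ⟨i, hi, e1⟩
      · have e2 := (hx1' k' hk' i hi).1 ((hx1 k i hi e1).symm.trans he)
        exact ((hspine .grey).en_inj hk hk').1 (e1.symm.trans e2)
      · have e2 := (hx2' k' hk' i hi).1 ((hx2 k hk i hi e1).symm.trans he)
        exact ((hspine .black).kp_inj hk hk').1 (e1.symm.trans e2)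
    · have hm' : x k' ∉ S₀ := he ▸ hm
      rw [hxS k hk] at hm
      rw [hxS k' hk'] at hm'
      rw [(hx3 k hk hm).1, (hx3 k' hk' hm').1] at he
      rw [← hy] at hχ
      exact List.inj_on_of_nodup_map hχ
        (List.mem_filter.2 ⟨List.mem_range.2 hk, by simpa using hm⟩)
        (List.mem_filter.2 ⟨List.mem_range.2 hk', by simpa using hm'⟩) he
  -- The transfer to grey labels is prescribed on the last passages of the white and grey blocks and
  -- completed by `σ₁`; the transfer to black labels is built in the same way with `σ₂`.
  obtain ⟨Eg, hEg, hsg⟩ := exists_standardizeCompl_eq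
    (Sum.elim (fun i : Fin (τ.dcount .white) => en .white i)
      (fun k : Fin (τ.dcount .grey) => x k))
    (Sum.elim (fun i : Fin (τ.dcount .white) => kp .grey i)
      (fun k : Fin (τ.dcount .grey) => en .grey k)) (by
      rintro (⟨i, hi⟩ | ⟨k, hk⟩) (⟨i', hi'⟩ | ⟨k', hk'⟩)
      · simp only [Sum.elim_inl]
        rw [(hspine .white).en_inj hi hi', (hspine .grey).kp_inj hi hi']
      · simp only [Sum.elim_inl, Sum.elim_inr]
        exact hx1' k' hk' i hi
      · simp only [Sum.elim_inl, Sum.elim_inr]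
        rw [eq_comm, hx1' k hk i' hi', eq_comm]
      · simp only [Sum.elim_inr]
        rw [(hspine .grey).en_inj hk hk']
        exact ⟨hxinj k hk k' hk', fun h => by rw [h]⟩)
    (S .grey) (by
      rw [← hset .grey]
      ext s
      rw [mem_spineSet, or_comm]
      simp [Fin.exists_iff, Color.next]) σ₁ (by
      simp only [S, Finset.card_insert_of_notMem hdS1]
      omega)
  obtain ⟨Eb, hEb, hsb⟩ := exists_standardizeCompl_eq
    (Sum.elim (fun i : Fin (τ.dcount .black) => kp .white i)
      (fun k : Fin (τ.dcount .grey) => x k))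
    (Sum.elim (fun i : Fin (τ.dcount .black) => en .black i)
      (fun k : Fin (τ.dcount .grey) => kp .black k)) (by
      rintro (⟨i, hi⟩ | ⟨k, hk⟩) (⟨i', hi'⟩ | ⟨k', hk'⟩)
      · simp only [Sum.elim_inl]
        rw [(hspine .white).kp_inj hi hi', (hspine .black).en_inj hi hi']
      · simp only [Sum.elim_inl, Sum.elim_inr]
        exact hx2' k' hk' i hi
      · simp only [Sum.elim_inl, Sum.elim_inr]
        rw [eq_comm, hx2' k hk i' hi', eq_comm]
      · simp only [Sum.elim_inr]
        rw [(hspine .black).kp_inj hk hk']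
        exact ⟨hxinj k hk k' hk', fun h => by rw [h]⟩)
    (S .black) (by
      rw [← hset .black]
      ext s
      rw [mem_spineSet]
      simp [Fin.exists_iff, Color.next]) σ₂ (by
      simp only [S, Finset.card_insert_of_notMem hdS2]
      omega)
  have hEg1 : ∀ i < τ.dcount .white, Eg⁻¹ (kp .grey i) = en .white i := fun i hi =>
    Equiv.Perm.inv_eq_iff_eq.2 (hEg (.inl ⟨i, hi⟩)).symm
  have hEg2 : ∀ k < τ.dcount .grey, Eg⁻¹ (en .grey k) = x k := fun k hk =>
    Equiv.Perm.inv_eq_iff_eq.2 (hEg (.inr ⟨k, hk⟩)).symm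
  have hEb1 : ∀ i < τ.dcount .black, Eb⁻¹ (en .black i) = kp .white i := fun i hi =>
    Equiv.Perm.inv_eq_iff_eq.2 (hEb (.inl ⟨i, hi⟩)).symm
  have hEb2 : ∀ k < τ.dcount .grey, Eb⁻¹ (kp .black k) = x k := fun k hk =>
    Equiv.Perm.inv_eq_iff_eq.2 (hEb (.inr ⟨k, hk⟩)).symm
  let E : Color → Equiv.Perm (Fin N)
    | .white => 1
    | .black => Eb
    | .grey => Eg
  refine ⟨en, kp, E, ⟨hpos, hspine, fun c => by rw [hlast]; exact hd, hrootlt, rfl, ?_⟩, ?_⟩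
  · intro c j hj
    cases c
    · exact (hEb1 j hj).symm
    · exact (hEb2 j hj).trans (hEg2 j hj).symm
    · exact hEg1 j hj
  · have hsup : ∀ c, support τ en kp c = S c := hset
    simp only [encode, SevenTuple.mk.injEq, true_and, hsup]
    refine ⟨rfl, ?_, ?_, ?_, hsg, hsb⟩
    · ext z
      simp only [S, Finset.mem_filter, Finset.mem_insert]
      constructor
      · rintro ⟨rfl | hz, hz'⟩
        · omega
        · exact hz
      · exact fun hz => ⟨.inr hz, h1' z hz⟩
    · ext z
      simp only [S, Finset.mem_filter, Finset.mem_insert]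
      constructor
      · rintro ⟨rfl | hz, hz'⟩
        · omega
        · exact hz
      · exact fun hz => ⟨.inr hz, h2' z hz⟩
    · rw [v3, List.filter_map, ← hy]
      have e1 : (List.range (τ.dcount .grey)).filter
          ((fun t => decide (t ∉ S .white)) ∘ fun k => (E .grey)⁻¹ (en .grey k)) =
          (List.range (τ.dcount .grey)).filter fun k => ¬ ((∃ i < τ.dcount .white,
            kp .grey i = en .grey k) ∨ ∃ i < τ.dcount .black, en .black i = kp .black k) := by
        refine List.filter_congr fun k hk => ?_
        have hk' := List.mem_range.1 hk
        have e2 : (E .grey)⁻¹ (en .grey k) = x k := hEg2 k hk'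
        simp only [Function.comp_apply, e2]
        exact decide_eq_decide.2 (not_congr (hxS k hk'))
      rw [e1]
      refine List.map_congr_left fun k hk => ?_
      obtain ⟨hk1, hk2⟩ := List.mem_filter.1 hk
      have hk' := List.mem_range.1 hk1
      exact (hEg2 k hk').trans (hx3 k hk' (by simpa using hk2)).1

end Model

end Cacti

namespace Cacti

/-! ### Tours determined by a tree of last exits -/

section Tour

variable {ε V : Type*} (src : ε → V) (φ : Equiv.Perm ε)

/-- The sources along a trail are its targets shifted by one place. Counting occurrences of a vertex
shows that departures and arrivals differ only at the two extremities. -/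
theorem map_append_eq_of_isChain (l : List ε) (e : ε)
    (h : (e :: l).IsChain fun e e' => src e' = src (φ e)) :
    ∃ f, (e :: l).getLast? = some f ∧
      (e :: l).map src ++ [src (φ f)] = src e :: (e :: l).map fun e => src (φ e) := by
  induction l generalizing e with
  | nil => exact ⟨e, rfl, rfl⟩
  | cons e' l ih =>
    rw [List.isChain_cons_cons] at h
    obtain ⟨f, h1, h2⟩ := ih e' h.2
    refine ⟨f, by rw [List.getLast?_cons_cons, h1], ?_⟩
    rw [List.map_cons, List.cons_append, h2]
    simp [h.1]

open Classical in
theorem countP_le_card [Fintype ε] {p : List ε} (hp : p.Nodup) (P : ε → Prop) :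
    p.countP P ≤ (Finset.univ.filter P).card ∧
      (p.countP P = (Finset.univ.filter P).card ↔ ∀ e, P e → e ∈ p) := by
  have h1 : p.countP P = (p.toFinset.filter P).card := by
    rw [List.countP_eq_length_filter, ← List.toFinset_card_of_nodup (hp.filter _)]
    congr 1
    ext e
    simp
  have hsub : p.toFinset.filter P ⊆ Finset.univ.filter P :=
    Finset.filter_subset_filter _ (Finset.subset_univ _)
  rw [h1]
  refine ⟨Finset.card_le_card hsub, ?_⟩
  constructor
  · intro h e he
    have := Finset.eq_of_subset_of_card_le hsub h.ge
    have he' : e ∈ Finset.univ.filter P := by simpa using he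
    rw [← this] at he'
    simpa using (Finset.mem_filter.1 he').1
  · intro h
    congr 1
    ext e
    simp only [Finset.mem_filter, List.mem_toFinset, Finset.mem_univ, true_and,
      and_iff_right_iff_imp]
    exact h e

/-- A directed graph with arcs `ε`, in which the arc `e` leads from `src e` to `src (φ e)`, such
that from each vertex the last arcs lead to `r`, has a tour starting at `r` that contains all
arcs and uses the arcs starting at each vertex in increasing order. -/
theorem exists_tour [Fintype ε] [LinearOrder ε] (r : V) (hr : ∃ e, src e = r) (ρ : V → ℕ)
    (h : ∀ e, (∀ e', src e' = src e → e' ≤ e) → src e ≠ r → ρ (src (φ e)) < ρ (src e)) :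
    ∃ p : List ε, p.Nodup ∧ (∀ e, e ∈ p) ∧ (∃ e, p.head? = some e ∧ src e = r) ∧
      (∃ e, p.getLast? = some e ∧ src (φ e) = r) ∧
      (p.IsChain fun e e' => src e' = src (φ e)) ∧
      p.Pairwise fun e e' => src e = src e' → e < e' := by
  classical
  -- Valid trails leave each vertex through its arcs in increasing order, and by the last clause the
  -- arcs used at a vertex form an initial segment. A valid trail of maximal length is chosen.
  let Valid : List ε → Prop := fun p => p.Nodup ∧ (∃ e, p.head? = some e ∧ src e = r) ∧
    (p.IsChain fun e e' => src e' = src (φ e)) ∧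
    (p.Pairwise fun e e' => src e = src e' → e < e') ∧
    ∀ e ∈ p, ∀ e', src e' = src e → e' < e → e' ∈ p
  have hmin : ∀ w, (∃ e, src e = w) → ∃ e, src e = w ∧ ∀ e', src e' = w → e ≤ e' := by
    intro w hw
    have hne : (Finset.univ.filter fun e => src e = w).Nonempty := by
      obtain ⟨e, he⟩ := hw
      exact ⟨e, by simpa using he⟩
    refine ⟨_, (Finset.mem_filter.1 (Finset.min'_mem _ hne)).2, fun e' he' => ?_⟩
    exact Finset.min'_le _ _ (by simpa using he')
  have hex : ∃ k p, Valid p ∧ k = Fintype.card ε - p.length := by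
    obtain ⟨e, he, hle⟩ := hmin r hr
    refine ⟨_, [e], ⟨by simp, ⟨e, rfl, he⟩, by simp, by simp, ?_⟩, rfl⟩
    intro e₁ he₁ e' he' hlt
    simp only [List.mem_singleton] at he₁
    subst he₁
    exact absurd hlt (not_lt.2 (hle e' (he'.trans he)))
  obtain ⟨p, hp, hpk⟩ := Nat.find_spec hex
  have hmax : ∀ q, Valid q → q.length ≤ p.length := by
    intro q hq
    have := Nat.find_min' hex ⟨q, hq, rfl⟩
    have h1 := hq.1.length_le_card
    have h2 := hp.1.length_le_card
    omega
  obtain ⟨hnd, ⟨e₀, he₀, hr₀⟩, hch, hpw, hcl⟩ := hp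
  obtain ⟨l, rfl⟩ : ∃ l, p = e₀ :: l := by
    cases p with
    | nil => simp at he₀
    | cons e l => exact ⟨l, by simp at he₀; rw [he₀]⟩
  obtain ⟨f, hf, hmap⟩ := map_append_eq_of_isChain src φ l e₀ hch
  -- At the final vertex every arc has been used; otherwise the least unused one would prolong the
  -- trail.
  have hnot_before : ∀ e, src e = src (φ f) → e ∈ e₀ :: l := by
    by_contra hn
    push Not at hn
    have hne : (Finset.univ.filter fun e => src e = src (φ f) ∧ e ∉ e₀ :: l).Nonempty := by
      obtain ⟨e, he⟩ := hn
      exact ⟨e, by simpa using he⟩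
    set e₁ := Finset.min' _ hne with he₁
    have hm := (Finset.mem_filter.1 (Finset.min'_mem _ hne)).2
    rw [← he₁] at hm
    have hle : ∀ e', src e' = src (φ f) → e' < e₁ → e' ∈ e₀ :: l := by
      intro e' he' hlt
      by_contra hn'
      exact not_le.2 hlt (Finset.min'_le _ _ (by
        simp only [Finset.mem_filter, Finset.mem_univ, true_and]
        exact ⟨he', hn'⟩))
    have hv : Valid ((e₀ :: l) ++ [e₁]) := by
      refine ⟨?_, ⟨e₀, rfl, hr₀⟩, ?_, ?_, ?_⟩
      · rw [List.nodup_append]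
        refine ⟨hnd, by simp, ?_⟩
        intro a ha b hb hab
        simp only [List.mem_singleton] at hb
        exact hm.2 (by rw [← hb, ← hab]; exact ha)
      · rw [List.isChain_append]
        refine ⟨hch, by simp, ?_⟩
        intro a ha b hb
        rw [hf] at ha
        simp only [List.head?_cons, Option.mem_some_iff] at ha hb
        rw [← ha, ← hb]
        exact hm.1
      · rw [List.pairwise_append]
        refine ⟨hpw, by simp, ?_⟩
        intro a ha b hb hab
        simp only [List.mem_singleton] at hb
        subst hb
        by_contra hlt
        rcases (not_lt.1 hlt).lt_or_eq with h1 | h1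
        · exact hm.2 (hcl a ha _ hab.symm h1)
        · exact hm.2 (h1 ▸ ha)
      · intro e he e' he' hlt
        rcases List.mem_append.1 he with he | he
        · exact List.mem_append_left _ (hcl e he e' he' hlt)
        · simp only [List.mem_singleton] at he
          subst he
          exact List.mem_append_left _ (hle e' (he'.trans hm.1) hlt)
    have := hmax _ hv
    simp at this
  have hcount : ∀ w, (e₀ :: l).countP (fun e => src e = w) + (if src (φ f) = w then 1 else 0) =
      (if src e₀ = w then 1 else 0) + (e₀ :: l).countP (fun e => src (φ e) = w) := by
    intro w
    generalize e₀ :: l = q at hmap ⊢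
    have h1 := congrArg (List.countP (· = w)) hmap
    simp only [List.countP_append, List.countP_map, List.countP_cons, List.countP_nil,
      Function.comp_def, decide_eq_true_eq, zero_add] at h1
    rw [h1, add_comm]
  -- Since φ is a permutation, each vertex has as many incoming as outgoing arcs.
  have hcard : ∀ w, (Finset.univ.filter fun e => src (φ e) = w).card =
      (Finset.univ.filter fun e => src e = w).card := by
    intro w
    refine Finset.card_bij (fun e _ => φ e) ?_ ?_ ?_
    · intro e he
      simpa using he
    · intro e _ e' _ hee
      exact φ.injective hee
    · intro e he
      exact ⟨φ.symm e, by simpa using he, by simp⟩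
  -- A final vertex other than r would have been entered once more than it was left, although all
  -- its outgoing arcs were used: more arrivals than incoming arcs.
  have hend : src (φ f) = r := by
    by_contra hne
    have h1 := hcount (src (φ f))
    rw [if_pos rfl, if_neg (by rw [hr₀]; exact fun h' => hne h'.symm)] at h1
    have h2 := (countP_le_card hnd (fun e => src e = src (φ f))).2.2 hnot_before
    have h3 := (countP_le_card hnd (fun e => src (φ e) = src (φ f))).1
    rw [hcard] at h3
    omega
  -- The trail is now closed, so a vertex whose outgoing arcs are exhausted has its incoming arcs
  -- exhausted too.
  have hin : ∀ w, (∀ e, src e = w → e ∈ e₀ :: l) → ∀ e, src (φ e) = w → e ∈ e₀ :: l := by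
    intro w hw
    have h1 := hcount w
    rw [hend, hr₀] at h1
    have h2 := (countP_le_card hnd (fun e => src e = w)).2.2 hw
    refine (countP_le_card hnd (fun e => src (φ e) = w)).2.1 ?_
    rw [hcard]
    omega
  -- Exhaustion spreads from r along the last arcs. The last arc at w enters a vertex of smaller ρ,
  -- so it was used, and with it all earlier arcs at w.
  have hall : ∀ k w, ρ w = k → ∀ e, src e = w → e ∈ e₀ :: l := by
    intro k
    induction k using Nat.strong_induction_on with
    | _ k ih =>
      rintro w rfl e he
      by_cases hwr : w = r
      · exact hnot_before e (by rw [he, hwr, hend])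
      · have hne : (Finset.univ.filter fun e => src e = w).Nonempty := ⟨e, by simpa using he⟩
        set m := Finset.max' _ hne with hm
        have hm1 : src m = w := (Finset.mem_filter.1 (Finset.max'_mem _ hne)).2
        have hm2 : ∀ e', src e' = w → e' ≤ m := fun e' he' =>
          Finset.le_max' _ _ (by simpa using he')
        have h1 := h m (fun e' he' => hm2 e' (he'.trans hm1)) (by rwa [hm1])
        rw [hm1] at h1
        have h2 := hin _ (ih _ h1 _ rfl) m rfl
        rcases (hm2 e he).lt_or_eq with h3 | h3
        · exact hcl m h2 e (he.trans hm1.symm) h3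
        · rwa [h3]
  exact ⟨e₀ :: l, hnd, fun e => hall _ _ rfl e rfl, ⟨e₀, he₀, hr₀⟩,
    ⟨f, hf, hend⟩, hch, hpw⟩

end Tour

end Cacti

namespace Cacti

/-! ### Boundary walk, blocks and children in a partitioned cactus -/

theorem perm_apply_inv {α : Type*} (f : Equiv.Perm α) (x : α) : f (f⁻¹ x) = x :=
  f.apply_symm_apply x

theorem perm_inv_apply {α : Type*} (f : Equiv.Perm α) (x : α) : f⁻¹ (f x) = x :=
  f.symm_apply_apply x

theorem val_finRotate {N : ℕ} (i : Fin N) :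
    (finRotate N i).val = if i.val + 1 < N then i.val + 1 else 0 := by
  obtain ⟨n, rfl⟩ := Nat.exists_eq_succ_of_ne_zero i.pos.ne'
  rw [coe_finRotate]
  have : i = Fin.last n ↔ ¬ i.val + 1 < n + 1 := by
    rw [Fin.ext_iff, Fin.val_last]
    have := i.isLt
    omega
  split_ifs <;> simp_all

/-- `Tuple.sort` is stable, so ties are broken by the index; this gives the increasing order inside
each block. -/
theorem sort_inv_lt_iff {n : ℕ} (f : Fin n → ℕ) (i j : Fin n) :
    (Tuple.sort f)⁻¹ i < (Tuple.sort f)⁻¹ j ↔ f i < f j ∨ f i = f j ∧ i < j := by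
  obtain ⟨h1, h2⟩ := Tuple.eq_sort_iff.1 (rfl : Tuple.sort f = Tuple.sort f)
  set σ := Tuple.sort f
  have key : ∀ i j, f i < f j ∨ f i = f j ∧ i < j → σ⁻¹ i < σ⁻¹ j := by
    rintro i j (h | ⟨h, hij⟩)
    · by_contra hn
      have := h1 (not_lt.1 hn)
      simp only [Function.comp_apply, perm_apply_inv] at this
      omega
    · by_contra hn
      rcases (not_lt.1 hn).lt_or_eq with h3 | h3
      · have := h2 _ _ h3 (by rw [perm_apply_inv, perm_apply_inv]; exact h.symm)
        simp only [perm_apply_inv] at this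
        exact this.asymm hij
      · exact hij.ne' (Equiv.injective _ h3)
  refine ⟨fun h => ?_, key i j⟩
  by_contra hn
  push Not at hn
  rcases lt_trichotomy i j with hij | rfl | hij
  · have : f j < f i := lt_of_le_of_ne hn.1 fun he => (hn.2 he.symm).not_gt hij
    exact h.asymm (key j i (.inl this))
  · exact lt_irrefl _ h
  · refine h.asymm (key j i ?_)
    rcases hn.1.lt_or_eq with h3 | h3
    · exact .inl h3
    · exact .inr ⟨h3, hij⟩

namespace FiveTuple

variable {N : ℕ}

/-- The permutation attached to the color `c`. -/
def perm (C : FiveTuple N) : Color → Equiv.Perm (Fin N)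
  | .white => C.α₁
  | .black => C.α₂
  | .grey => C.α₃

/-- The effect of moving along the boundary on the traversal labels. -/
def step (N : ℕ) : Color → Equiv.Perm (Fin N)
  | .white => finRotate N
  | .black => 1
  | .grey => 1

/-- The blocks of each color are unions of cycles of the permutation of this color. -/
def IsCactus (C : FiveTuple N) : Prop := ∀ c, BlocksAreUnionsOfCycles (C.part c) (C.perm c)

theorem mem_CC_iff {p₁ p₂ p₃ : ℕ} {C : FiveTuple N} :
    C ∈ CC p₁ p₂ p₃ N ↔ C.IsCactus ∧ (C.part .white).parts.card = p₁ ∧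
      (C.part .black).parts.card = p₂ ∧ (C.part .grey).parts.card = p₃ := by
  constructor
  · rintro ⟨h1, h2, h3, h4, h5, h6⟩
    exact ⟨fun c => by cases c <;> assumption, h1, h2, h3⟩
  · rintro ⟨h, h1, h2, h3⟩
    exact ⟨h1, h2, h3, h .white, h .black, h .grey⟩

/-- The step of the boundary walk. After the visit with label m of color `c.next`, at the triangle
t, comes the visit with label `step N c m` of color c, at the triangle `C.perm c t`. In a cactus
this triangle lies in the same block of color c as t. -/
theorem trav_perm (C : FiveTuple N) (c : Color) (t : Fin N) :
    C.trav c (C.perm c t) = step N c (C.trav c.next t) := by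
  have h : C.trav c * C.perm c = step N c * C.trav c.next := by
    cases c <;> simp [trav, perm, step, α₃, Color.next, mul_assoc]
  exact DFunLike.congr_fun h t

/-- The block of color `c` of the triangle `t`. -/
def block (C : FiveTuple N) (c : Color) (t : Fin N) : Finset (Fin N) := (C.part c).part t

variable {C : FiveTuple N} {c : Color}

theorem mem_block_self (C : FiveTuple N) (c : Color) (t : Fin N) : t ∈ C.block c t :=
  ((C.part c).mem_part_self).2 (Finset.mem_univ t)

theorem block_mem (C : FiveTuple N) (c : Color) (t : Fin N) : C.block c t ∈ (C.part c).parts :=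
  (C.part c).part_mem.2 (Finset.mem_univ t)

theorem mem_iff_block_eq {B : Finset (Fin N)} (hB : B ∈ (C.part c).parts) {t : Fin N} :
    t ∈ B ↔ C.block c t = B :=
  ((C.part c).part_eq_iff_mem hB).symm

theorem exists_block_eq {B : Finset (Fin N)} (hB : B ∈ (C.part c).parts) :
    ∃ t, C.block c t = B := by
  obtain ⟨t, ht⟩ := (C.part c).nonempty_of_mem_parts hB
  exact ⟨t, (mem_iff_block_eq hB).1 ht⟩

theorem IsCactus.block_perm (hC : C.IsCactus) (c : Color) (t : Fin N) :
    C.block c (C.perm c t) = C.block c t := by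
  rw [← mem_iff_block_eq (C.block_mem c t)]
  exact hC c _ (C.block_mem c t) t (C.mem_block_self c t) _ ⟨1, by simp⟩

variable [NeZero N]

theorem root_eq (C : FiveTuple N) : C.root = C.block .white 0 := rfl

theorem root_mem (C : FiveTuple N) : C.root ∈ (C.part .white).parts := C.block_mem .white 0

theorem mem_nonRoot {B : Finset (Fin N)} :
    B ∈ C.nonRoot c ↔ B ∈ (C.part c).parts ∧ ¬ (c = .white ∧ B = C.root) := by
  simp [nonRoot]

theorem image_trav_max {B : Finset (Fin N)} (hB : B.Nonempty) :
    (B.image (C.trav c)).max = C.maxLabel c B := by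
  obtain ⟨m, hm⟩ := Finset.max_of_nonempty (hB.image (C.trav c))
  rw [maxLabel, hm]
  rfl

theorem trav_le_maxLabel {B : Finset (Fin N)} {t : Fin N} (ht : t ∈ B) :
    C.trav c t ≤ C.maxLabel c B :=
  Finset.le_max_of_eq (Finset.mem_image_of_mem _ ht) (image_trav_max ⟨t, ht⟩)

theorem trav_lastPassage (C : FiveTuple N) (c : Color) (B : Finset (Fin N)) :
    C.trav c (C.lastPassage c B) = C.maxLabel c B := by
  simp [lastPassage]

theorem lastPassage_mem {B : Finset (Fin N)} (hB : B ∈ (C.part c).parts) :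
    C.lastPassage c B ∈ B := by
  have h := Finset.mem_of_max (image_trav_max (C := C) (c := c)
    ((C.part c).nonempty_of_mem_parts hB))
  obtain ⟨t, ht, he⟩ := Finset.mem_image.1 h
  rw [lastPassage, ← he]
  simpa using ht

theorem block_lastPassage {B : Finset (Fin N)} (hB : B ∈ (C.part c).parts) :
    C.block c (C.lastPassage c B) = B :=
  (mem_iff_block_eq hB).1 (lastPassage_mem hB)

theorem maxLabel_eq {B : Finset (Fin N)} {t : Fin N} (ht : t ∈ B)
    (h : ∀ s ∈ B, C.trav c s ≤ C.trav c t) : C.maxLabel c B = C.trav c t := by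
  refine le_antisymm ?_ (trav_le_maxLabel ht)
  have h1 := Finset.mem_of_max (image_trav_max (C := C) (c := c) ⟨t, ht⟩)
  obtain ⟨s, hs, he⟩ := Finset.mem_image.1 h1
  rw [← he]
  exact h s hs

theorem mem_lastPassages {t : Fin N} :
    t ∈ C.lastPassages c ↔ ∃ B ∈ C.nonRoot c, C.lastPassage c B = t := by
  simp [lastPassages]

/-- The children of a block, listed by their last passages. -/
theorem map_children (C : FiveTuple N) (c : Color) (B : Finset (Fin N)) :
    (C.children c B).map (fun D => C.trav c (C.lastPassage c.next D)) =
      (((C.lastPassages c.next).filter (· ∈ B)).image (C.trav c)).sort (· ≤ ·) := by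
  rw [children, List.map_map]
  conv_rhs => rw [← List.map_id (Finset.sort _ _)]
  refine List.map_congr_left fun l hl => ?_
  rw [Finset.mem_sort, Finset.mem_image] at hl
  obtain ⟨t, ht, rfl⟩ := hl
  obtain ⟨D, hD, rfl⟩ := mem_lastPassages.1 (Finset.mem_filter.1 ht).1
  have := block_lastPassage (mem_nonRoot.1 hD).1
  rw [block] at this
  simp [this]

theorem mem_children {B D : Finset (Fin N)} :
    D ∈ C.children c B ↔ D ∈ C.nonRoot c.next ∧ C.lastPassage c.next D ∈ B := by
  simp only [children, List.mem_map, Finset.mem_sort, Finset.mem_image, Finset.mem_filter,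
    mem_lastPassages]
  constructor
  · rintro ⟨l, ⟨t, ⟨⟨D', hD', rfl⟩, ht⟩, rfl⟩, rfl⟩
    have h := block_lastPassage (mem_nonRoot.1 hD').1
    rw [block] at h
    simp only [perm_inv_apply, h]
    exact ⟨hD', ht⟩
  · rintro ⟨hD, ht⟩
    have h := block_lastPassage (mem_nonRoot.1 hD).1
    rw [block] at h
    exact ⟨_, ⟨_, ⟨⟨D, hD, rfl⟩, ht⟩, rfl⟩, by simp [h]⟩

theorem pairwise_children (C : FiveTuple N) (c : Color) (B : Finset (Fin N)) :
    (C.children c B).Pairwise fun D D' =>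
      C.trav c (C.lastPassage c.next D) < C.trav c (C.lastPassage c.next D') := by
  rw [← List.pairwise_map (f := fun D => C.trav c (C.lastPassage c.next D)) (R := (· < ·)),
    map_children]
  exact (Finset.sortedLT_sort _).pairwise

theorem nodup_children (C : FiveTuple N) (c : Color) (B : Finset (Fin N)) :
    (C.children c B).Nodup :=
  (C.pairwise_children c B).imp fun h he => h.ne (by rw [he])

theorem eq_children {B : Finset (Fin N)} {l : List (Finset (Fin N))}
    (hl : l.Pairwise fun D D' =>
      C.trav c (C.lastPassage c.next D) < C.trav c (C.lastPassage c.next D'))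
    (h : ∀ D, D ∈ l ↔ D ∈ C.nonRoot c.next ∧ C.lastPassage c.next D ∈ B) :
    C.children c B = l := by
  refine List.Perm.eq_of_pairwise (le := fun D D' =>
      C.trav c (C.lastPassage c.next D) < C.trav c (C.lastPassage c.next D')) ?_
    (C.pairwise_children c B) hl ?_
  · intro a b _ _ h1 h2
    exact absurd h1 h2.asymm
  · rw [List.perm_ext_iff_of_nodup (C.nodup_children c B)
      (hl.imp fun h he => h.ne (by rw [he]))]
    intro D
    rw [mem_children, h]

/-! ### The order of the visits -/

/-- The position of a color in the boundary walk. -/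
def shift : Color → ℕ
  | .white => 0
  | .grey => 1
  | .black => 2

/-- One less than the time of the last visit for the non-root blocks; the last time for the
root. -/
def rank (C : FiveTuple N) (c : Color) (B : Finset (Fin N)) : ℕ :=
  if c = .white ∧ B = C.root then 3 * N - 1 else 3 * (C.maxLabel c B).val + shift c - 1

theorem rank_lt (C : FiveTuple N) (c : Color) (B : Finset (Fin N)) : C.rank c B < 3 * N := by
  have h1 := (C.maxLabel c B).isLt
  have h2 : shift c ≤ 2 := by cases c <;> simp [shift]
  unfold rank
  split_ifs <;> omega

/-- The last visit of D is followed at once by a visit of its parent B, so B is left later. The walk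
closes up only after the last black label, where it returns to the root; giving the root the rank 3N
- 1 and lowering the other times by one keeps the inequality strict there. -/
theorem IsCactus.rank_children_lt (hC : C.IsCactus) {B D : Finset (Fin N)}
    (hB : B ∈ (C.part c).parts) (hD : D ∈ C.children c B) :
    C.rank c.next D < C.rank c B := by
  obtain ⟨h1, h2⟩ := mem_children.1 hD
  obtain ⟨h3, h4⟩ := mem_nonRoot.1 h1
  set t := C.lastPassage c.next D with ht
  have h5 : C.trav c (C.perm c t) = step N c (C.maxLabel c.next D) := by
    rw [trav_perm, ht, trav_lastPassage]
  have h6 : C.perm c t ∈ B := by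
    rw [mem_iff_block_eq hB, hC.block_perm, ← mem_iff_block_eq hB]
    exact h2
  have h7 : step N c (C.maxLabel c.next D) ≤ C.maxLabel c B := h5 ▸ trav_le_maxLabel h6
  have h8 := (C.maxLabel c.next D).isLt
  have h9 := (C.maxLabel c B).isLt
  have hrD : C.rank c.next D = 3 * (C.maxLabel c.next D).val + shift c.next - 1 := if_neg h4
  rw [hrD]
  cases c
  · simp only [step, Color.next, shift] at *
    by_cases hl : (C.maxLabel .black D).val + 1 < N
    · have h10 : (finRotate N (C.maxLabel .black D)).val = (C.maxLabel .black D).val + 1 := by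
        rw [val_finRotate, if_pos hl]
      rw [Fin.le_def, h10] at h7
      unfold rank
      simp only [shift]
      split_ifs <;> omega
    · have h10 : finRotate N (C.maxLabel .black D) = 0 := by
        apply Fin.ext
        rw [val_finRotate, if_neg hl]
        rfl
      have h11 : B = C.root := by
        rw [root_eq, eq_comm, ← mem_iff_block_eq hB, ← h10, ← h5]
        exact h6
      have : C.rank .white B = 3 * N - 1 := if_pos ⟨rfl, h11⟩
      omega
  · simp only [step, Color.next, shift, Equiv.Perm.coe_one, id_eq, Fin.le_def] at *
    simp only [rank, shift, reduceCtorEq, false_and, if_false]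
    omega
  · simp only [step, Color.next, shift, Equiv.Perm.coe_one, id_eq, Fin.le_def] at *
    -- A white block with largest label 0 contains the first triangle and is the root. Hence the
    -- subtraction in the rank of a white child is not truncated.
    have h10 : (C.maxLabel .white D).val ≠ 0 := by
      intro h0
      refine h4 ⟨trivial, ?_⟩
      have : t = 0 := by
        have : C.trav .white t = 0 := by
          rw [ht, trav_lastPassage]
          exact Fin.ext h0
        simpa [trav] using this
      rw [root_eq, eq_comm, ← mem_iff_block_eq h3, ← this]
      exact lastPassage_mem h3
    simp only [rank, shift, reduceCtorEq, false_and, if_false]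
    omega

end FiveTuple

end Cacti

namespace Cacti

namespace FiveTuple

variable {N : ℕ} [NeZero N] {C : FiveTuple N} {c : Color}

/-! ### The listing of the blocks -/

theorem level_eq_levels (C : FiveTuple N) (n : ℕ) : C.level n = levels C.children C.root n := by
  induction n with
  | zero => rfl
  | succ n ih => rw [level, levels, ih]

theorem reverseLabelled_eq (C : FiveTuple N) (c : Color) :
    C.reverseLabelled c = revLevels C.children C.root (3 * N) c := by
  unfold reverseLabelled revLevels
  exact List.flatMap_congr fun n _ => C.level_eq_levels n

theorem three_mul_pos (N : ℕ) [NeZero N] : 0 < 3 * N := by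
  have := NeZero.pos N
  omega

theorem IsCactus.children_spec (hC : C.IsCactus) (c : Color) (B : Finset (Fin N))
    (hB : B ∈ (C.part c).parts) : ∀ D ∈ C.children c B,
      D ∈ (C.part c.next).parts ∧ C.rank c.next D < C.rank c B :=
  fun _ hD => ⟨(mem_nonRoot.1 (mem_children.1 hD).1).1, hC.rank_children_lt hB hD⟩

theorem IsCactus.isListing (hC : C.IsCactus) :
    IsListing C.children C.root C.reverseLabelled := by
  have h : levels C.children C.root (3 * N) = [] := by
    have := levels_eq_nil (ch := C.children) (r := C.root) (fun c B => B ∈ (C.part c).parts)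
      C.rank (3 * N - 1) C.root_mem (by have := C.rank_lt .white C.root; omega) hC.children_spec
    rwa [Nat.sub_add_cancel (three_mul_pos N)] at this
  have := isListing_revLevels h
  intro c
  rw [reverseLabelled_eq, reverseLabelled_eq]
  exact this c

theorem IsCactus.mem_parts (hC : C.IsCactus) {B : Finset (Fin N)}
    (hB : B ∈ C.reverseLabelled c) : B ∈ (C.part c).parts := by
  rw [reverseLabelled_eq] at hB
  obtain ⟨n, -, rfl, h⟩ := mem_revLevels.1 hB
  exact (rank_levels (ch := C.children) (r := C.root) (fun c B => B ∈ (C.part c).parts)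
      C.rank (3 * N - 1) C.root_mem (by have := C.rank_lt .white C.root; omega)
      hC.children_spec n B h).1

theorem IsCactus.eq_reverseLabelled (hC : C.IsCactus) {A : Color → List (Finset (Fin N))}
    (hA : IsListing C.children C.root A) (h : ∀ c, ∀ B ∈ A c, B ∈ (C.part c).parts) (c : Color) :
    A c = C.reverseLabelled c := by
  rw [reverseLabelled_eq, hA.eq_revLevels C.rank (3 * N - 1)
    (fun c B hB D hD => hC.rank_children_lt (h c B hB) hD)
    (fun c B _ => by have := C.rank_lt c B; omega),
    Nat.sub_add_cancel (three_mul_pos N)]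

theorem sum_map_ite_eq_count {α : Type*} [DecidableEq α] (l : List α) (a : α) :
    (l.map fun b => if b = a then 1 else 0).sum = l.count a := by
  induction l with
  | nil => rfl
  | cons b l ih => simp [List.count_cons, ih, add_comm]

/-- By the listing equation a non-root block occurs as often as its unique parent, and the parent
has a larger rank; the root occurs once because it is nobody's child. -/
theorem IsCactus.count_eq_one (hC : C.IsCactus) {B : Finset (Fin N)}
    (hB : B ∈ (C.part c).parts) : (C.reverseLabelled c).count B = 1 := by
  obtain ⟨k, hk⟩ : ∃ k, k = 3 * N - C.rank c B := ⟨_, rfl⟩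
  induction k using Nat.strong_induction_on generalizing c B with
  | _ k ih =>
    subst hk
    obtain ⟨d, rfl⟩ : ∃ d : Color, d.next = c := ⟨c.next.next, c.next_next_next⟩
    rw [hC.isListing d, List.count_append, List.count_flatMap]
    by_cases hr : d.next = .white ∧ B = C.root
    · have h0 : ((C.reverseLabelled d).map (List.count B ∘ C.children d)).sum = 0 := by
        rw [List.sum_eq_zero]
        intro x hx
        obtain ⟨B', -, rfl⟩ := List.mem_map.1 hx
        refine List.count_eq_zero.2 fun hm => ?_
        exact (mem_nonRoot.1 (mem_children.1 hm).1).2 hr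
      rw [h0, rootList, if_pos hr.1, hr.2]
      simp
    · have hmem : B ∈ C.nonRoot d.next := mem_nonRoot.2 ⟨hB, hr⟩
      obtain ⟨P, hP⟩ : ∃ P, P = C.block d (C.lastPassage d.next B) := ⟨_, rfl⟩
      have hBP : B ∈ C.children d P := mem_children.2 ⟨hmem, hP ▸ C.mem_block_self _ _⟩
      have hPm : P ∈ (C.part d).parts := hP ▸ C.block_mem d (C.lastPassage d.next B)
      have h1 : (C.reverseLabelled d).map (List.count B ∘ C.children d) =
          (C.reverseLabelled d).map fun B' => if B' = P then 1 else 0 := by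
        refine List.map_congr_left fun B' hB' => ?_
        simp only [Function.comp_apply]
        have hB'm := hC.mem_parts hB'
        split_ifs with h
        · rw [h]
          exact List.count_eq_one_of_mem (C.nodup_children d P) hBP
        · refine List.count_eq_zero.2 fun hm => h ?_
          rw [hP, eq_comm, ← mem_iff_block_eq hB'm]
          exact (mem_children.1 hm).2
      rw [h1, sum_map_ite_eq_count]
      have h2 := hC.rank_children_lt hPm hBP
      have h3 := C.rank_lt d P
      rw [ih _ (by omega) hPm rfl]
      have h4 : (rootList C.root d.next).count B = 0 := by
        refine List.count_eq_zero.2 fun hm => hr ?_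
        unfold rootList at hm
        split_ifs at hm with h
        · exact ⟨h, by simpa using hm⟩
        · simp at hm
      rw [h4]

theorem IsCactus.mem_reverseLabelled (hC : C.IsCactus) {B : Finset (Fin N)} :
    B ∈ C.reverseLabelled c ↔ B ∈ (C.part c).parts := by
  refine ⟨hC.mem_parts, fun h => ?_⟩
  rw [← List.one_le_count_iff, hC.count_eq_one h]

theorem IsCactus.nodup_reverseLabelled (hC : C.IsCactus) : (C.reverseLabelled c).Nodup := by
  rw [List.nodup_iff_count_le_one]
  intro B
  by_cases hB : B ∈ C.reverseLabelled c
  · rw [hC.count_eq_one (hC.mem_parts hB)]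
  · rw [List.count_eq_zero.2 hB]
    omega

theorem IsCactus.length_reverseLabelled (hC : C.IsCactus) :
    (C.reverseLabelled c).length = (C.part c).parts.card := by
  rw [← List.toFinset_card_of_nodup hC.nodup_reverseLabelled]
  congr 1
  ext B
  rw [List.mem_toFinset, hC.mem_reverseLabelled]

/-! ### The cactus tree -/

/-- The block forms a triangle with its parent and its rightmost child, provided that it is not
the root. -/
def isTop (C : FiveTuple N) (c : Color) (B : Finset (Fin N)) : Bool :=
  match (C.children c B).getLast? with
  | none => false
  | some D => C.lastPassage c B = C.lastPassage c.next D

theorem isTop_iff {B : Finset (Fin N)} : C.isTop c B = true ↔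
    ∃ D, (C.children c B).getLast? = some D ∧ C.lastPassage c B = C.lastPassage c.next D := by
  unfold isTop
  split <;> simp_all

/-- The cactus tree whose root has the children of `B`. -/
def subtree (C : FiveTuple N) (c : Color) (B : Finset (Fin N)) : CactusTree :=
  C.treeAux (3 * N) c (C.children c B)

/-- The vertex of the cactus tree corresponding to a block. -/
def vertex (C : FiveTuple N) (c : Color) (B : Finset (Fin N)) : CactusTree × Bool :=
  (C.subtree c B, if c = .white ∧ B = C.root then false else C.isTop c B)

/-- The cactus tree obtained by adding the polygon of `B` on the left of the root. -/
def addPolygon (C : FiveTuple N) (d : ℕ) (c : Color) (B : Finset (Fin N))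
    (rest : CactusTree) : CactusTree :=
  match (C.children c B).getLast? with
  | none => .edge .leaf rest
  | some D =>
    if C.lastPassage c B = C.lastPassage c.next D then
      .triangle (C.treeAux d c (C.children c B).dropLast)
        (C.treeAux d c.next (C.children c.next D)) rest
    else
      .edge (C.treeAux d c (C.children c B)) rest

theorem treeAux_succ (C : FiveTuple N) (d : ℕ) (c : Color) (l : List (Finset (Fin N))) :
    C.treeAux (d + 1) c l = l.foldr (C.addPolygon d c.next) .leaf := rfl

theorem treeAux_nil (C : FiveTuple N) (d : ℕ) (c : Color) : C.treeAux d c [] = .leaf := by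
  cases d <;> rfl

theorem foldr_congr_of_mem {α β : Type*} {f g : α → β → β} {b : β} {l : List α}
    (h : ∀ a ∈ l, f a = g a) : l.foldr f b = l.foldr g b := by
  induction l with
  | nil => rfl
  | cons a l ih =>
    rw [List.foldr_cons, List.foldr_cons, h a (by simp), ih fun a ha => h a (by simp [ha])]

/-- Ranks decrease from parent to child, so a depth bound exceeding the ranks never cuts the
recursion. -/
theorem IsCactus.treeAux_eq (hC : C.IsCactus) {d d' : ℕ} (hd : d ≤ d')
    {l : List (Finset (Fin N))} (hl : ∀ B ∈ l, B ∈ (C.part c.next).parts ∧ C.rank c.next B < d) :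
    C.treeAux d c l = C.treeAux d' c l := by
  induction d generalizing d' c l with
  | zero =>
    cases l with
    | nil => rw [treeAux_nil, treeAux_nil]
    | cons B l => exact absurd (hl B (by simp)).2 (by omega)
  | succ d ih =>
    obtain ⟨d', rfl⟩ := Nat.exists_eq_succ_of_ne_zero (show d' ≠ 0 by omega)
    rw [treeAux_succ, Nat.succ_eq_add_one, treeAux_succ]
    refine foldr_congr_of_mem fun B hB => ?_
    obtain ⟨h1, h2⟩ := hl B hB
    have h3 : ∀ D ∈ C.children c.next B, D ∈ (C.part c.next.next).parts ∧
        C.rank c.next.next D < d := fun D hD => by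
      have := hC.children_spec _ B h1 D hD
      exact ⟨this.1, by omega⟩
    funext rest
    unfold addPolygon
    split
    · rfl
    · next D hD =>
      have hDm : D ∈ C.children c.next B := List.mem_of_getLast? hD
      have h4 := h3 D hDm
      have hd' : d ≤ d' := by omega
      rw [ih hd' h3, ih hd' fun E hE => h3 E (List.mem_of_mem_dropLast hE),
        ih hd' (c := c.next.next) (l := C.children c.next.next D)]
      intro E hE
      have := hC.children_spec _ D h4.1 E hE
      exact ⟨this.1, by omega⟩

theorem foldr_addPolygon_edge (C : FiveTuple N) (d : ℕ) (c : Color) (l : List (Finset (Fin N)))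
    (u : CactusTree) : l.foldr (C.addPolygon d c) (.edge u .leaf) =
      (l.foldr (C.addPolygon d c) .leaf).snoc u := by
  induction l with
  | nil => rfl
  | cons B l ih =>
    rw [List.foldr_cons, ih, List.foldr_cons]
    unfold addPolygon
    split
    · rfl
    · split_ifs <;> rfl

/-- No block shares its last passage with its rightmost child and its rightmost grandchild. -/
theorem IsCactus.isTop_eq_false (hC : C.IsCactus) {B D : Finset (Fin N)} (hB : B ∈ C.nonRoot c)
    (hD : D ∈ C.children c B) (h : C.lastPassage c B = C.lastPassage c.next D) :
    C.isTop c.next D = false := by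
  rw [← Bool.not_eq_true, isTop_iff]
  rintro ⟨F, hF, he⟩
  have hBp := (mem_nonRoot.1 hB).1
  have hDp := (hC.children_spec _ B hBp D hD).1
  have hF' := List.mem_of_getLast? hF
  have hFp := (hC.children_spec _ D hDp F hF').1
  have hc := c.next_next_next
  -- The common triangle lies in F, so B would be a child of F and the ranks would decrease around a
  -- cycle of three blocks.
  have hB' : B ∈ C.children c.next.next F := by
    rw [mem_children, hc]
    refine ⟨hB, ?_⟩
    rw [h, he]
    exact lastPassage_mem hFp
  have h1 := hC.rank_children_lt hBp hD
  have h2 := hC.rank_children_lt hDp hF'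
  have h3 := hC.rank_children_lt hFp hB'
  rw [hc] at h3
  omega

/-- In a triangle the rightmost child D is cut off from the subtree of B, and `kids` puts it back by
`snoc`. The result is the full subtree of B because D does not itself start a triangle with B
(`isTop_eq_false`), so its polygon at B is an edge. -/
theorem IsCactus.kids_treeAux (hC : C.IsCactus) {l : List (Finset (Fin N))}
    (hl : ∀ B ∈ l, B ∈ C.nonRoot c.next) :
    (C.treeAux (3 * N) c l).kids = l.map (C.vertex c.next) := by
  obtain ⟨d, hd⟩ := Nat.exists_eq_succ_of_ne_zero (three_mul_pos N).ne'
  rw [Nat.succ_eq_add_one] at hd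
  rw [hd, treeAux_succ]
  induction l with
  | nil => rfl
  | cons B l ih =>
    have hB := hl B (by simp)
    obtain ⟨hBp, hBr⟩ := mem_nonRoot.1 hB
    rw [List.foldr_cons, List.map_cons, ← ih fun B hB => hl B (by simp [hB])]
    generalize l.foldr (C.addPolygon d c.next) .leaf = rest
    have hrk := C.rank_lt c.next B
    have h3 : ∀ D ∈ C.children c.next B, D ∈ (C.part c.next.next).parts ∧
        C.rank c.next.next D < d := fun D hD => by
      have := hC.children_spec _ B hBp D hD
      exact ⟨this.1, by omega⟩
    have hst : ∀ l : List (Finset (Fin N)), (∀ D ∈ l, D ∈ C.children c.next B) →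
        C.treeAux d c.next l = C.treeAux (d + 1) c.next l := fun l hl =>
      hC.treeAux_eq (by omega) fun D hD => h3 D (hl D hD)
    unfold vertex
    rw [if_neg hBr]
    unfold addPolygon isTop subtree
    rw [hd]
    split
    · next h =>
      rw [List.getLast?_eq_none_iff] at h
      rw [h, treeAux_nil]
      rfl
    · next D hD =>
      have hDm : D ∈ C.children c.next B := List.mem_of_getLast? hD
      split_ifs with he
      · have hlist : C.children c.next B = (C.children c.next B).dropLast ++ [D] :=
          (List.dropLast_append_getLast? D hD).symm
        have hDt := hC.isTop_eq_false hB hDm he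
        have hDe : C.addPolygon d c.next.next D .leaf =
            .edge (C.treeAux d c.next.next (C.children c.next.next D)) .leaf := by
          unfold addPolygon
          split
          · next h =>
            rw [List.getLast?_eq_none_iff] at h
            rw [h, treeAux_nil]
          · next F hF =>
            rw [if_neg]
            intro hDF
            rw [isTop_iff.2 ⟨F, hF, hDF⟩] at hDt
            exact absurd hDt (by simp)
        have h5 : C.treeAux (d + 1) c.next (C.children c.next B) =
            (C.treeAux d c.next (C.children c.next B).dropLast).snoc
              (C.treeAux d c.next.next (C.children c.next.next D)) := by
          conv_lhs => rw [hlist]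
          rw [treeAux_succ, List.foldr_append, List.foldr_cons, List.foldr_nil, hDe,
            foldr_addPolygon_edge, ← treeAux_succ, hst]
          exact fun E hE => List.mem_of_mem_dropLast hE
        rw [h5, CactusTree.kids]
        simp [he]
      · rw [CactusTree.kids, hst _ fun D hD => hD]
        simp [he]

theorem IsCactus.kids_subtree (hC : C.IsCactus) (c : Color) (B : Finset (Fin N)) :
    (C.subtree c B).kids = (C.children c B).map (C.vertex c.next) :=
  hC.kids_treeAux fun _ hD => (mem_children.1 hD).1

theorem vertex_root (C : FiveTuple N) : C.vertex .white C.root = (C.tree, false) := by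
  simp [vertex, subtree, tree]

/-- The list of blocks, mapped to subtrees, satisfies the listing equation of the cactus tree, whose
solution is unique. -/
theorem IsCactus.map_vertex (hC : C.IsCactus) (c : Color) :
    (C.reverseLabelled c).map (C.vertex c) = C.tree.verts c := by
  have h1 : ∀ c, (C.reverseLabelled c).map (C.vertex c) =
      revLevels CactusTree.kidsOf (C.tree, false) (3 * N) c := by
    intro c
    rw [reverseLabelled_eq, map_revLevels (ch' := CactusTree.kidsOf) (C.vertex) (3 * N)
      (fun c B _ => (hC.kids_subtree c B).symm), vertex_root]
  have h2 : IsListing CactusTree.kidsOf (C.tree, false)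
      fun c => (C.reverseLabelled c).map (C.vertex c) := by
    intro c
    beta_reduce
    rw [hC.isListing c, List.map_append, List.map_flatMap, List.flatMap_map]
    congr 1
    · exact List.flatMap_congr fun B _ => (hC.kids_subtree c B).symm
    · unfold rootList
      split_ifs with h
      · rw [h, List.map_singleton, vertex_root]
      · rfl
  refine congrFun (CactusTree.eq_verts _ h2 fun c v hv => ?_) c
  beta_reduce at hv
  rw [h1] at hv
  obtain ⟨n, -, -, hv⟩ := mem_revLevels.1 hv
  have := (rank_levels (fun _ _ => True) (fun _ (v : CactusTree × Bool) => v.1.size) C.tree.size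
    trivial le_rfl (fun _ _ _ _ h => ⟨trivial, CactusTree.size_lt_of_mem_kids h⟩) n v hv).2
  exact le_trans (Nat.le_add_right _ n) this

end FiveTuple

end Cacti

namespace Cacti

namespace FiveTuple

variable {N : ℕ} [NeZero N] {C : FiveTuple N} {c : Color}

/-! ### The relabelled cactus of a partitioned cactus -/

/-- The `k`-th block of color `c`. -/
def nthBlock (C : FiveTuple N) (c : Color) (k : ℕ) : Finset (Fin N) :=
  (C.reverseLabelled c).getD k ∅

/-- The number of the block of color `c` that contains `t`. -/
def blockIdx (C : FiveTuple N) (c : Color) (t : Fin N) : ℕ :=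
  (C.reverseLabelled c).idxOf (C.block c t)

/-- The new label of color `c` of the triangle `t`. -/
def newLabel (C : FiveTuple N) (c : Color) : Equiv.Perm (Fin N) := C.relabel c * C.trav c

/-- The new label of the last passage of the `k`-th block. -/
def newEnd (C : FiveTuple N) (c : Color) (k : ℕ) : Fin N :=
  C.newLabel c (C.lastPassage c (C.nthBlock c k))

/-- The new label of color `c` of the last passage of the `j`-th block of color `c.next`. -/
def newKid (C : FiveTuple N) (c : Color) (j : ℕ) : Fin N :=
  C.newLabel c (C.lastPassage c.next (C.nthBlock c.next j))

/-- The permutation from new white labels to new labels of color `c`. -/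
def transfer (C : FiveTuple N) (c : Color) : Equiv.Perm (Fin N) :=
  C.newLabel c * (C.newLabel .white)⁻¹

theorem newLabel_lt_iff (C : FiveTuple N) (c : Color) (s t : Fin N) :
    C.newLabel c s < C.newLabel c t ↔ C.blockIdx c s < C.blockIdx c t ∨
      C.blockIdx c s = C.blockIdx c t ∧ C.trav c s < C.trav c t := by
  have h := sort_inv_lt_iff (C.reverseLabel c) (C.trav c s) (C.trav c t)
  simp only [reverseLabel, perm_inv_apply] at h
  exact h

theorem nthBlock_eq {k : ℕ} (hk : k < (C.reverseLabelled c).length) :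
    C.nthBlock c k = (C.reverseLabelled c)[k] :=
  List.getD_eq_getElem _ _ hk

/-- A child that shares the last passage of B carries the largest traversal label of B, so it is
automatically the rightmost child. -/
theorem isTop_iff_exists_nonRoot {B : Finset (Fin N)} (hB : B ∈ (C.part c).parts) :
    C.isTop c B = true ↔
      ∃ D ∈ C.nonRoot c.next, C.lastPassage c.next D = C.lastPassage c B := by
  rw [isTop_iff]
  constructor
  · rintro ⟨D, hD, he⟩
    exact ⟨D, (mem_children.1 (List.mem_of_getLast? hD)).1, he.symm⟩
  · rintro ⟨D', hD'', he⟩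
    have hD : D' ∈ C.children c B := mem_children.2 ⟨hD'', he ▸ lastPassage_mem hB⟩
    obtain ⟨D, hD'⟩ : ∃ D, (C.children c B).getLast? = some D :=
      ⟨_, List.getLast?_eq_some_getLast (List.ne_nil_of_mem hD)⟩
    refine ⟨D, hD', ?_⟩
    suffices D' = D by rw [← he, this]
    by_contra hne
    have hlist := List.dropLast_append_getLast? D hD'
    have hp := C.pairwise_children c B
    rw [← hlist] at hp hD
    have h1 : D' ∈ (C.children c B).dropLast := by
      rcases List.mem_append.1 hD with h | h
      · exact h
      · exact absurd (List.mem_singleton.1 h) hne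
    have h2 := (List.pairwise_append.1 hp).2.2 _ h1 D (by simp)
    rw [he, trav_lastPassage] at h2
    exact absurd (trav_le_maxLabel (mem_children.1 (List.mem_of_getLast? hD')).2) (not_le.2 h2)

namespace IsCactus

variable (hC : C.IsCactus)
include hC

theorem nthBlock_mem {k : ℕ} (hk : k < (C.reverseLabelled c).length) :
    C.nthBlock c k ∈ (C.part c).parts := by
  rw [nthBlock_eq hk]
  exact hC.mem_parts (List.getElem_mem hk)

theorem blockIdx_lt (c : Color) (t : Fin N) : C.blockIdx c t < (C.reverseLabelled c).length :=
  List.idxOf_lt_length_iff.2 (hC.mem_reverseLabelled.2 (C.block_mem c t))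

theorem blockIdx_eq_iff {k : ℕ} (hk : k < (C.reverseLabelled c).length) {t : Fin N} :
    C.blockIdx c t = k ↔ t ∈ C.nthBlock c k := by
  rw [mem_iff_block_eq (hC.nthBlock_mem hk), nthBlock_eq hk]
  constructor
  · rintro rfl
    exact (List.getElem_idxOf hk).symm
  · intro h
    rw [blockIdx, h, hC.nodup_reverseLabelled.idxOf_getElem]

theorem blockIdx_lastPassage {k : ℕ} (hk : k < (C.reverseLabelled c).length) :
    C.blockIdx c (C.lastPassage c (C.nthBlock c k)) = k :=
  (hC.blockIdx_eq_iff hk).2 (lastPassage_mem (hC.nthBlock_mem hk))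

/-- New labels are ordered by block and then by traversal label, and the last passage has the
largest traversal label: its new label closes the interval of the block. -/
theorem newLabel_le_newEnd_iff {k : ℕ} (hk : k < (C.reverseLabelled c).length) {t : Fin N} :
    C.newLabel c t ≤ C.newEnd c k ↔ C.blockIdx c t ≤ k := by
  rw [newEnd, ← not_lt, newLabel_lt_iff, hC.blockIdx_lastPassage hk, ← not_lt, not_iff_not]
  refine ⟨?_, .inl⟩
  rintro (h | ⟨h, h'⟩)
  · exact h
  · rw [trav_lastPassage] at h'
    exact absurd (trav_le_maxLabel ((hC.blockIdx_eq_iff hk).1 h.symm)) (not_le.2 h')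

theorem newEnd_lt {k k' : ℕ} (h : k < k') (hk' : k' < (C.reverseLabelled c).length) :
    C.newEnd c k < C.newEnd c k' := by
  rw [newEnd, newEnd, newLabel_lt_iff, hC.blockIdx_lastPassage hk',
    hC.blockIdx_lastPassage (h.trans hk')]
  exact .inl h

theorem length_eq_vcount : (C.reverseLabelled c).length = C.tree.vcount c := by
  rw [CactusTree.vcount, ← hC.map_vertex, List.length_map]

theorem nthBlock_root : C.nthBlock .white (C.tree.dcount .white) = C.root := by
  have h := hC.isListing .grey
  have h1 := hC.length_eq_vcount (c := .white)
  rw [C.tree.vcount_white] at h1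
  simp only [Color.next, rootList, if_true] at h
  rw [h, List.length_append, List.length_singleton] at h1
  rw [nthBlock, h, ← Nat.succ_injective h1, List.getD_eq_getElem?_getD,
    List.getElem?_concat_length]
  rfl

theorem nthBlock_mem_nonRoot {k : ℕ} (hk : k < C.tree.dcount c) :
    C.nthBlock c k ∈ C.nonRoot c := by
  have hk' : k < (C.reverseLabelled c).length := by
    rw [hC.length_eq_vcount]
    exact hk.trans_le (C.tree.dcount_le c)
  refine mem_nonRoot.2 ⟨hC.nthBlock_mem hk', ?_⟩
  rintro ⟨rfl, h⟩
  have hd : C.tree.dcount .white < (C.reverseLabelled .white).length := by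
    rw [hC.length_eq_vcount, C.tree.vcount_white]
    omega
  rw [← hC.nthBlock_root, nthBlock_eq hk', nthBlock_eq hd,
    hC.nodup_reverseLabelled.getElem_inj_iff] at h
  omega

theorem exists_nthBlock_eq {B : Finset (Fin N)} (hB : B ∈ (C.part c).parts) :
    ∃ k < C.tree.vcount c, C.nthBlock c k = B := by
  obtain ⟨t, rfl⟩ := exists_block_eq hB
  have := hC.blockIdx_lt c t
  refine ⟨C.blockIdx c t, by rwa [← hC.length_eq_vcount], ?_⟩
  exact ((mem_iff_block_eq (hC.nthBlock_mem this)).1 ((hC.blockIdx_eq_iff this).1 rfl)).symm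

theorem mem_nonRoot_iff {B : Finset (Fin N)} :
    B ∈ C.nonRoot c ↔ ∃ k < C.tree.dcount c, C.nthBlock c k = B := by
  constructor
  · intro hB
    obtain ⟨hB, hr⟩ := mem_nonRoot.1 hB
    obtain ⟨k, hk, rfl⟩ := hC.exists_nthBlock_eq hB
    refine ⟨k, ?_, rfl⟩
    by_cases hc : c = .white
    · subst hc
      rw [C.tree.vcount_white] at hk
      rcases Nat.lt_succ_iff_lt_or_eq.1 hk with h | rfl
      · exact h
      · exact absurd ⟨rfl, hC.nthBlock_root⟩ hr
    · simpa [CactusTree.dcount, hc] using hk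
  · rintro ⟨k, hk, rfl⟩
    exact hC.nthBlock_mem_nonRoot hk

theorem kidStart_eq (c : Color) (k : ℕ) :
    C.tree.kidStart c k = kidCount (C.reverseLabelled c) (C.children c) k := by
  unfold CactusTree.kidStart kidCount
  rw [← hC.map_vertex, ← List.map_take, List.flatMap_map, List.length_flatMap,
    List.length_flatMap]
  congr 1
  refine List.map_congr_left fun B _ => ?_
  have := congrArg List.length (hC.kids_subtree c B)
  rw [List.length_map] at this
  exact this

theorem exists_parent {j : ℕ} (hj : j < C.tree.dcount c.next) :
    ∃ i < C.tree.vcount c, C.tree.kidStart c i ≤ j ∧ j < C.tree.kidStart c (i + 1) ∧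
      C.blockIdx c (C.lastPassage c.next (C.nthBlock c.next j)) = i ∧
      (C.children c (C.nthBlock c i))[j - C.tree.kidStart c i]? = some (C.nthBlock c.next j) := by
  have hj' : j < ((C.reverseLabelled c).flatMap (C.children c)).length := by
    rwa [← kidCount_length, ← hC.kidStart_eq, hC.length_eq_vcount, C.tree.kidStart_vcount]
  obtain ⟨i, hi, h1, h2, ho, h3⟩ := exists_kidCount_le hj'
  rw [← hC.kidStart_eq] at h1 h2
  simp only [← hC.kidStart_eq] at ho h3
  have h4 : C.nthBlock c.next j = ((C.reverseLabelled c).flatMap (C.children c))[j] := by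
    rw [nthBlock, hC.isListing c, List.getD_append _ _ _ _ hj', List.getD_eq_getElem _ _ hj']
  refine ⟨i, by rwa [← hC.length_eq_vcount], h1, h2, ?_, ?_⟩
  · rw [hC.blockIdx_eq_iff hi, nthBlock_eq hi]
    refine (mem_children.1 ?_).2
    rw [h4, h3]
    exact List.getElem_mem _
  · rw [h4, h3, nthBlock_eq hi]
    exact List.getElem?_eq_getElem ho

/-- Children of different parents lie in different intervals, in the order of the parents; children
of one parent are sorted by traversal label. -/
theorem newKid_lt {j j' : ℕ} (h : j < j') (hj' : j' < C.tree.dcount c.next) :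
    C.newKid c j < C.newKid c j' := by
  obtain ⟨i, hi, h1, h2, h3, h4⟩ := hC.exists_parent (h.trans hj')
  obtain ⟨i', hi', h1', h2', h3', h4'⟩ := hC.exists_parent hj'
  rw [newKid, newKid, newLabel_lt_iff, h3, h3']
  have hle : i ≤ i' := by
    by_contra hn
    have := C.tree.kidStart_mono c (show i' + 1 ≤ i by omega)
    omega
  rcases hle.lt_or_eq with hlt | rfl
  · exact .inl hlt
  · refine .inr ⟨rfl, ?_⟩
    obtain ⟨o, ho⟩ := List.getElem?_eq_some_iff.1 h4
    obtain ⟨o', ho'⟩ := List.getElem?_eq_some_iff.1 h4'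
    rw [← ho, ← ho']
    exact List.pairwise_iff_getElem.1 (C.pairwise_children c (C.nthBlock c i)) _ _ o o' (by omega)

theorem newEnd_lt_newKid {k j : ℕ} (hk : k < C.tree.vcount c) (hj : j < C.tree.dcount c.next) :
    C.newEnd c k < C.newKid c j ↔ C.tree.kidStart c (k + 1) ≤ j := by
  obtain ⟨i, hi, h1, h2, h3, h4⟩ := hC.exists_parent hj
  rw [← not_le, newKid, hC.newLabel_le_newEnd_iff (by rwa [hC.length_eq_vcount]), h3, not_le]
  constructor
  · intro h
    exact (C.tree.kidStart_mono c h).trans h1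
  · intro h
    by_contra hn
    have := C.tree.kidStart_mono c (show i + 1 ≤ k + 1 by omega)
    omega

theorem flagged_iff {k : ℕ} (hk : k < C.tree.dcount c) :
    C.tree.Flagged c k ↔ C.isTop c (C.nthBlock c k) = true := by
  have hk' : k < (C.reverseLabelled c).length := by
    rw [hC.length_eq_vcount]
    exact hk.trans_le (C.tree.dcount_le c)
  have hr := (mem_nonRoot.1 (hC.nthBlock_mem_nonRoot hk)).2
  rw [nthBlock_eq hk'] at hr ⊢
  rw [CactusTree.Flagged, ← hC.map_vertex, List.getElem?_map, List.getElem?_eq_getElem hk',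
    Option.map_some, vertex, if_neg hr]
  simp

theorem isTop_iff_exists {k : ℕ} (hk : k < C.tree.dcount c) :
    C.isTop c (C.nthBlock c k) = true ↔
      ∃ j < C.tree.dcount c.next, C.newKid c j = C.newEnd c k := by
  rw [isTop_iff_exists_nonRoot (mem_nonRoot.1 (hC.nthBlock_mem_nonRoot hk)).1]
  constructor
  · rintro ⟨D, hD, he⟩
    obtain ⟨j, hj, rfl⟩ := hC.mem_nonRoot_iff.1 hD
    exact ⟨j, hj, by rw [newKid, newEnd, he]⟩
  · rintro ⟨j, hj, he⟩
    exact ⟨_, hC.nthBlock_mem_nonRoot hj, (C.newLabel c).injective he⟩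

theorem isModel : IsModel C.tree C.newEnd C.newKid C.transfer where
  vcount_pos c := by
    rw [← hC.length_eq_vcount]
    exact (Nat.zero_le _).trans_lt (hC.blockIdx_lt c 0)
  spine c :=
    { en_lt := fun k k' h hk' => hC.newEnd_lt h (by
        rw [hC.length_eq_vcount]
        exact hk'.trans_le (C.tree.dcount_le c))
      kp_lt := fun j j' h hj' => hC.newKid_lt h hj'
      en_lt_kp := fun k hk j hj => hC.newEnd_lt_newKid (hk.trans_le (C.tree.dcount_le c)) hj
      flag := fun k hk => (hC.flagged_iff hk).trans (hC.isTop_iff_exists hk) }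
  last c := by
    have hN := NeZero.pos N
    obtain ⟨t, ht⟩ := (C.newLabel c).surjective ⟨N - 1, by omega⟩
    have h1 := hC.blockIdx_lt c t
    rw [hC.length_eq_vcount] at h1
    have h2 := (hC.newLabel_le_newEnd_iff (c := c) (k := C.tree.vcount c - 1) (t := t)
      (by rw [hC.length_eq_vcount]; omega)).2 (by omega)
    rw [ht, Fin.le_def] at h2
    have := (C.newEnd c (C.tree.vcount c - 1)).isLt
    simp only at h2
    omega
  root k hk := hC.newEnd_lt hk (by rw [hC.length_eq_vcount, C.tree.vcount_white]; omega)
  white := by simp [transfer]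
  kid c j _ := by
    simp only [transfer, newKid, newEnd, mul_inv_rev, inv_inv, Equiv.Perm.mul_apply,
      perm_inv_apply]

theorem image_lastPassages (f : Fin N → Fin N) :
    (C.lastPassages c).image f =
      (Finset.range (C.tree.dcount c)).image fun k => f (C.lastPassage c (C.nthBlock c k)) := by
  ext x
  simp only [Finset.mem_image, mem_lastPassages, Finset.mem_range]
  constructor
  · rintro ⟨t, ⟨B, hB, rfl⟩, rfl⟩
    obtain ⟨k, hk, rfl⟩ := hC.mem_nonRoot_iff.1 hB
    exact ⟨k, hk, rfl⟩
  · rintro ⟨k, hk, rfl⟩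
    exact ⟨_, ⟨_, hC.nthBlock_mem_nonRoot hk, rfl⟩, rfl⟩

theorem support_eq (c : Color) :
    support C.tree C.newEnd C.newKid c =
      (C.lastPassages c ∪ C.lastPassages c.next).image (C.newLabel c) := by
  rw [Finset.image_union, hC.image_lastPassages, hC.image_lastPassages]
  rfl

theorem theta_eq_encode : Theta C = encode C.tree C.newEnd C.newKid C.transfer := by
  have hw : C.newLabel .white = C.relabel .white := by simp [newLabel, trav]
  have h0 : C.S₀ = support C.tree C.newEnd C.newKid .white := by
    rw [hC.support_eq, hw]
    rfl
  have h1 : C.fullS₁ = support C.tree C.newEnd C.newKid .grey := by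
    rw [hC.support_eq]
    rfl
  have h2 : C.fullS₂ = support C.tree C.newEnd C.newKid .black := by
    rw [hC.support_eq]
    rfl
  have e1 : C.ext₁ = C.transfer .grey := by
    rw [transfer, hw]
    rfl
  have e2 : C.ext₂ = C.transfer .black := by
    rw [transfer, hw]
    rfl
  have hχ : C.χ = (encode C.tree C.newEnd C.newKid C.transfer).χ := by
    simp only [χ, encode]
    have hl : C.reverseLabelled .grey =
        (List.range (C.tree.vcount .grey)).map (C.nthBlock .grey) := by
      refine List.ext_getElem (by rw [hC.length_eq_vcount]; simp) fun k hk _ => ?_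
      rw [List.getElem_map, List.getElem_range, nthBlock_eq hk]
    rw [hl, List.map_map, List.filter_map, List.filter_map, List.map_map]
    have hx : ∀ k, (C.transfer .grey)⁻¹ (C.newEnd .grey k) =
        C.relabel .white (C.lastPassage .grey (C.nthBlock .grey k)) := by
      intro k
      rw [← hw]
      simp only [transfer, newEnd, mul_inv_rev, inv_inv, Equiv.Perm.mul_apply, perm_inv_apply]
    have hf : (List.range (C.tree.vcount .grey)).filter
        ((fun t => decide (t ∉ C.lastPassages .white ∪ C.lastPassages .black)) ∘
          C.lastPassage .grey ∘ C.nthBlock .grey) = (List.range (C.tree.vcount .grey)).filter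
        ((fun t => decide (t ∉ support C.tree C.newEnd C.newKid .white)) ∘
          fun k => (C.transfer .grey)⁻¹ (C.newEnd .grey k)) := by
      refine List.filter_congr fun k _ => decide_eq_decide.2 (not_congr ?_)
      beta_reduce
      rw [hx, ← h0, S₀, Function.comp_apply, Finset.mem_image]
      constructor
      · exact fun h => ⟨_, h, rfl⟩
      · rintro ⟨t, ht, he⟩
        rwa [← (C.relabel .white).injective he]
    rw [hf]
    exact List.map_congr_left fun k _ => (hx k).symm
  have s1 : standardize C.ext₁ C.E₁ C.fullS₁ᶜ C.mem_E₁_iff =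
      standardizeCompl (C.transfer .grey) (support C.tree C.newEnd C.newKid .grey) := by
    rw [standardize_eq_standardizeCompl _ rfl, e1, h1]
  have s2 : standardize C.ext₂ C.E₂ C.fullS₂ᶜ C.mem_E₂_iff =
      standardizeCompl (C.transfer .black) (support C.tree C.newEnd C.newKid .black) := by
    rw [standardize_eq_standardizeCompl _ rfl, e2, h2]
  rw [Theta, s1, s2, hχ, h0, h1, h2]
  rfl

end IsCactus

end FiveTuple

end Cacti

namespace Cacti

namespace FiveTuple

variable {N : ℕ} [NeZero N] {C C' : FiveTuple N} {c : Color}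

/-! ### The relabelled cactus determines the partitioned cactus -/

theorem newLabel_inv_trav (C : FiveTuple N) (c : Color) (l : Fin N) :
    C.newLabel c ((C.trav c)⁻¹ l) = C.relabel c l := by
  simp only [newLabel, Equiv.Perm.mul_apply, perm_apply_inv]

theorem newLabel_eq (C : FiveTuple N) (c d : Color) (t : Fin N) :
    C.newLabel c t = C.transfer c ((C.transfer d)⁻¹ (C.newLabel d t)) := by
  simp only [transfer, mul_inv_rev, inv_inv, Equiv.Perm.mul_apply, perm_inv_apply]

/-- Two partitioned cacti with the same relabelled cactus. -/
structure SameModel (C C' : FiveTuple N) : Prop where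
  left : C.IsCactus
  right : C'.IsCactus
  tree : C.tree = C'.tree
  newEnd : ∀ c, ∀ k < C.tree.vcount c, C.newEnd c k = C'.newEnd c k
  transfer : C.transfer = C'.transfer

namespace SameModel

theorem symm (h : SameModel C C') : SameModel C' C :=
  ⟨h.right, h.left, h.tree.symm, fun c k hk => (h.newEnd c k (h.tree ▸ hk)).symm,
    h.transfer.symm⟩

theorem blockIdx_le (h : SameModel C C') {s t : Fin N}
    (hst : C.newLabel c s = C'.newLabel c t) : C.blockIdx c s ≤ C'.blockIdx c t := by
  have h1 := h.right.blockIdx_lt c t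
  have h2 : C'.blockIdx c t < (C.reverseLabelled c).length := by
    rwa [h.left.length_eq_vcount, h.tree, ← h.right.length_eq_vcount]
  rw [← h.left.newLabel_le_newEnd_iff h2, hst, h.newEnd, h.right.newLabel_le_newEnd_iff h1]
  rwa [← h.left.length_eq_vcount]

theorem blockIdx_eq (h : SameModel C C') {s t : Fin N}
    (hst : C.newLabel c s = C'.newLabel c t) : C.blockIdx c s = C'.blockIdx c t :=
  le_antisymm (h.blockIdx_le hst) (h.symm.blockIdx_le hst.symm)

/-- Otherwise the new label of l in C would be, in C', a smaller label of the same block, hence used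
at an earlier l'. There both relabellings agree, which contradicts injectivity in C. -/
theorem not_relabel_lt (h : SameModel C C') {l : Fin N}
    (hl : ∀ l' < l, C.relabel c l' = C'.relabel c l')
    (hidx : C.blockIdx c ((C.trav c)⁻¹ l) = C'.blockIdx c ((C'.trav c)⁻¹ l)) :
    ¬ C.relabel c l < C'.relabel c l := by
  intro hlt
  obtain ⟨l', hl'⟩ := (C'.relabel c).surjective (C.relabel c l)
  have h1 : C.blockIdx c ((C.trav c)⁻¹ l) = C'.blockIdx c ((C'.trav c)⁻¹ l') := by
    apply h.blockIdx_eq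
    rw [newLabel_inv_trav, newLabel_inv_trav, hl']
  rw [← hl', ← newLabel_inv_trav, ← newLabel_inv_trav, newLabel_lt_iff, ← h1, ← hidx] at hlt
  simp only [lt_irrefl, false_or, true_and, perm_apply_inv] at hlt
  have h2 := hl l' hlt
  rw [hl'] at h2
  exact hlt.ne ((C.relabel c).injective h2)

theorem blockIdx_root (h : SameModel C C') : C.blockIdx .white 0 = C'.blockIdx .white 0 := by
  have key : ∀ {C : FiveTuple N}, C.IsCactus → C.blockIdx .white 0 = C.tree.dcount .white := by
    intro C hC
    rw [hC.blockIdx_eq_iff, hC.nthBlock_root, root_eq]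
    · exact C.mem_block_self _ _
    · rw [hC.length_eq_vcount, C.tree.vcount_white]
      omega
  rw [key h.left, key h.right, h.tree]

theorem blockIdx_perm (hC : C.IsCactus) (c : Color) (m : Fin N) :
    C.blockIdx c ((C.trav c)⁻¹ (step N c m)) = C.blockIdx c ((C.trav c.next)⁻¹ m) := by
  have h1 : C.perm c ((C.trav c.next)⁻¹ m) = (C.trav c)⁻¹ (step N c m) := by
    rw [eq_comm, Equiv.Perm.inv_eq_iff_eq, trav_perm, perm_apply_inv]
  rw [← h1, blockIdx, hC.block_perm]
  rfl

/-- The walk is replayed by induction on the time 3l + `shift c`. The previous new label and the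
transfers determine the block visited now, and inside a block the labels are used in increasing
order. Only time 0 has no predecessor; there the block is the root. -/
theorem relabel_eq (h : SameModel C C') (c : Color) (l : Fin N) :
    C.relabel c l = C'.relabel c l := by
  obtain ⟨n, hn⟩ : ∃ n, n = 3 * l.val + shift c := ⟨_, rfl⟩
  induction n using Nat.strong_induction_on generalizing c l with
  | _ n ih =>
    subst hn
    have hl : ∀ l' < l, C.relabel c l' = C'.relabel c l' := fun l' hl' =>
      ih _ (by rw [Fin.lt_def] at hl'; omega) c l' rfl
    have hidx : C.blockIdx c ((C.trav c)⁻¹ l) = C'.blockIdx c ((C'.trav c)⁻¹ l) := by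
      by_cases h0 : c = .white ∧ l = 0
      · obtain ⟨rfl, rfl⟩ := h0
        exact h.blockIdx_root
      · obtain ⟨m, hm, hlt⟩ : ∃ m, step N c m = l ∧
            3 * m.val + shift c.next < 3 * l.val + shift c := by
          cases c
          · have hl0 : l.val ≠ 0 := fun h' => h0 ⟨rfl, Fin.ext h'⟩
            have := l.isLt
            refine ⟨⟨l.val - 1, by omega⟩, ?_, ?_⟩
            · apply Fin.ext
              rw [step, val_finRotate, if_pos] <;> simp only <;> omega
            · simp only [shift, Color.next]
              omega
          · exact ⟨l, rfl, by simp [shift, Color.next]⟩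
          · exact ⟨l, rfl, by simp [shift, Color.next]⟩
        rw [← hm, blockIdx_perm h.left, blockIdx_perm h.right]
        apply h.blockIdx_eq
        rw [C.newLabel_eq c c.next, C'.newLabel_eq c c.next, newLabel_inv_trav,
          newLabel_inv_trav, ih _ hlt c.next m rfl, h.transfer]
    rcases lt_trichotomy (C.relabel c l) (C'.relabel c l) with h1 | h1 | h1
    · exact absurd h1 (h.not_relabel_lt hl hidx)
    · exact h1
    · exact absurd h1 (h.symm.not_relabel_lt (fun l' hl' => (hl l' hl').symm) hidx.symm)

theorem newLabel_apply_eq (h : SameModel C C') (c : Color) (t : Fin N) :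
    C.newLabel c t = C'.newLabel c t := by
  rw [C.newLabel_eq c .white, C'.newLabel_eq c .white, h.transfer]
  congr 2
  exact h.relabel_eq .white t

theorem trav_eq (h : SameModel C C') (c : Color) : C.trav c = C'.trav c := by
  ext1 t
  apply (C.relabel c).injective
  rw [h.relabel_eq c (C'.trav c t)]
  exact h.newLabel_apply_eq c t

theorem perm_eq (h : SameModel C C') (c : Color) : C.perm c = C'.perm c := by
  ext1 t
  apply (C.trav c).injective
  conv_rhs => rw [h.trav_eq]
  rw [trav_perm, trav_perm, h.trav_eq]

theorem parts_subset (h : SameModel C C') (c : Color) : (C.part c).parts ⊆ (C'.part c).parts := by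
  intro B hB
  obtain ⟨t, rfl⟩ := exists_block_eq hB
  have : C.block c t = C'.block c t := by
    ext s
    rw [mem_iff_block_eq (C.block_mem c t), mem_iff_block_eq (C'.block_mem c t)]
    have key : ∀ {C : FiveTuple N}, C.IsCactus →
        (C.block c s = C.block c t ↔ C.blockIdx c s = C.blockIdx c t) := by
      intro C hC
      exact (List.idxOf_inj (hC.mem_reverseLabelled.2 (C.block_mem c s))).symm
    rw [key h.left, key h.right, h.blockIdx_eq (h.newLabel_apply_eq c s),
      h.blockIdx_eq (h.newLabel_apply_eq c t)]
  rw [this]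
  exact C'.block_mem c t

theorem eq (h : SameModel C C') : C = C' := by
  have hp : ∀ c, C.part c = C'.part c := fun c =>
    Finpartition.ext (Finset.Subset.antisymm (h.parts_subset c) (h.symm.parts_subset c))
  have h1 := hp .white
  have h2 := hp .black
  have h3 := hp .grey
  have h4 := h.perm_eq .white
  have h5 := h.perm_eq .black
  cases C
  cases C'
  simp only [part, perm] at h1 h2 h3 h4 h5
  simp only [h1, h2, h3, h4, h5]

end SameModel

end FiveTuple

end Cacti

namespace Cacti

open FiveTuple

/-! ### Every relabelled cactus comes from a partitioned cactus -/

theorem CactusTree.lt_dcount_or (τ : CactusTree) {c : Color} {k : ℕ}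
    (hk : k < τ.vcount c) :
    k < τ.dcount c ∨ c = .white ∧ k = τ.dcount .white := by
  by_cases hc : c = .white
  · subst hc
    rw [τ.vcount_white] at hk
    rcases Nat.lt_succ_iff_lt_or_eq.1 hk with h1 | h1
    · exact .inl h1
    · exact .inr ⟨rfl, h1⟩
  · left
    simpa [CactusTree.dcount, hc] using hk

theorem apply_eq_of_sameCycle {α β : Type*} {f : α → β} {σ : Equiv.Perm α}
    (h : ∀ x, f (σ x) = f x) {x y : α} (hxy : σ.SameCycle x y) : f x = f y := by
  obtain ⟨i, rfl⟩ := hxy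
  have hn : ∀ n : ℕ, ∀ x, f ((σ ^ n) x) = f x := by
    intro n
    induction n with
    | zero => simp
    | succ n ih =>
      intro x
      rw [pow_succ, Equiv.Perm.mul_apply, ih, h]
  obtain ⟨n, rfl | rfl⟩ := i.eq_nat_or_neg
  · rw [zpow_natCast, hn]
  · rw [zpow_neg, zpow_natCast]
    conv_lhs => rw [← perm_apply_inv (σ ^ n) x, hn]

theorem flatMap_range' {K : ℕ → ℕ} (hK : Monotone K) (h0 : K 0 = 0) (n : ℕ) :
    (List.range n).flatMap (fun k => List.range' (K k) (K (k + 1) - K k)) = List.range (K n) := by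
  induction n with
  | zero => simp [h0]
  | succ n ih =>
    rw [List.range_succ, List.flatMap_append, ih, List.range_eq_range', List.range_eq_range']
    have h := hK (Nat.le_succ n)
    simp only [List.flatMap_cons, List.flatMap_nil, List.append_nil]
    have := List.range'_append_1 (s := 0) (m := K n) (n := K (n + 1) - K n)
    rw [zero_add] at this
    rw [this, Nat.add_sub_cancel' h]

namespace IsModel

variable {N : ℕ} {τ : CactusTree} {en kp : Color → ℕ → Fin N} {E : Color → Equiv.Perm (Fin N)}
  {c : Color}

section

variable (h : IsModel τ en kp E)
include h

theorem le_last (c : Color) (x : Fin N) : x ≤ en c (τ.vcount c - 1) := by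
  have h1 := h.last c
  have h2 := x.isLt
  rw [Fin.le_def]
  omega

theorem en_lt {k k' : ℕ} (hkk : k < k') (hk' : k' < τ.vcount c) : en c k < en c k' := by
  rcases τ.lt_dcount_or hk' with h1 | ⟨rfl, rfl⟩
  · exact (h.spine c).en_lt _ _ hkk h1
  · exact h.root k hkk

theorem en_le {k k' : ℕ} (hkk : k ≤ k') (hk' : k' < τ.vcount c) : en c k ≤ en c k' := by
  rcases hkk.lt_or_eq with h1 | rfl
  · exact (h.en_lt h1 hk').le
  · exact le_rfl

theorem en_lt_kp {k j : ℕ} (hk : k < τ.vcount c) (hj : j < τ.dcount c.next) :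
    en c k < kp c j ↔ τ.kidStart c (k + 1) ≤ j := by
  rcases τ.lt_dcount_or hk with h1 | ⟨rfl, rfl⟩
  · exact (h.spine c).en_lt_kp k h1 j hj
  · have h2 := h.le_last .white (kp .white j)
    have h3 := τ.kidStart_vcount .white
    rw [τ.vcount_white] at h2 h3
    refine iff_of_false (not_lt.2 h2) ?_
    omega

/-- The number of the interval that contains `x`. -/
def interval (c : Color) (x : Fin N) : ℕ :=
  Nat.find (⟨_, h.le_last c x⟩ : ∃ k, x ≤ en c k)

theorem interval_le_iff {k : ℕ} (hk : k < τ.vcount c) {x : Fin N} :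
    h.interval c x ≤ k ↔ x ≤ en c k := by
  rw [interval, Nat.find_le_iff]
  exact ⟨fun ⟨m, hm, hx⟩ => hx.trans (h.en_le hm hk), fun hx => ⟨k, le_rfl, hx⟩⟩

theorem interval_lt (c : Color) (x : Fin N) : h.interval c x < τ.vcount c := by
  have h1 := h.vcount_pos c
  have := (h.interval_le_iff (c := c) (k := τ.vcount c - 1) (by omega)).2 (h.le_last c x)
  omega

theorem interval_mono {x y : Fin N} (hxy : x ≤ y) : h.interval c x ≤ h.interval c y := by
  rw [h.interval_le_iff (h.interval_lt c y)]
  exact hxy.trans ((h.interval_le_iff (h.interval_lt c y)).1 le_rfl)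

theorem interval_en {k : ℕ} (hk : k < τ.vcount c) : h.interval c (en c k) = k := by
  refine le_antisymm ((h.interval_le_iff hk).2 le_rfl) ?_
  by_contra hn
  have h1 := (h.interval_le_iff (h.interval_lt c (en c k))).1 le_rfl
  exact absurd (h.en_lt (not_le.1 hn) hk) (not_lt.2 h1)

theorem interval_kp {i j : ℕ} (hi : i < τ.vcount c) (hj : j < τ.dcount c.next)
    (h1 : τ.kidStart c i ≤ j) (h2 : j < τ.kidStart c (i + 1)) : h.interval c (kp c j) = i := by
  apply le_antisymm
  · rw [h.interval_le_iff hi, ← not_lt, h.en_lt_kp hi hj]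
    omega
  · by_contra hn
    have h3 := (h.interval_le_iff (h.interval_lt c (kp c j))).1 le_rfl
    rw [← not_lt, h.en_lt_kp (h.interval_lt c _) hj] at h3
    have := τ.kidStart_mono c (show h.interval c (kp c j) + 1 ≤ i by omega)
    omega

theorem interval_kp_iff {i j : ℕ} (hi : i < τ.vcount c) (hj : j < τ.dcount c.next) :
    h.interval c (kp c j) = i ↔ τ.kidStart c i ≤ j ∧ j < τ.kidStart c (i + 1) := by
  refine ⟨?_, fun hh => h.interval_kp hi hj hh.1 hh.2⟩
  obtain ⟨i', hi', h1, h2⟩ := τ.exists_parent hj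
  rw [h.interval_kp hi' hj h1 h2]
  rintro rfl
  exact ⟨h1, h2⟩

/-- The traversal labels: `L c` sends the traversal labels of color `c` to the new labels. -/
theorem exists_traversal [NeZero N] : ∃ L : Color → Equiv.Perm (Fin N),
    (∀ c l l', l < l' → h.interval c (L c l) = h.interval c (L c l') → L c l < L c l') ∧
    (∀ c m, h.interval c (L c (step N c m)) =
      h.interval c (E c ((E c.next)⁻¹ (L c.next m)))) ∧
    h.interval .white (L .white 0) = τ.dcount .white := by
  -- Arcs are pairs of a color and a new label. Only the comparison of arcs leaving the same
  -- interval matters; the order of the colors is arbitrary.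
  let e : Color × Fin N → ℕ ×ₗ Fin N := fun x => toLex (shift x.1, x.2)
  have he : Function.Injective e := by
    rintro ⟨c, x⟩ ⟨d, y⟩ hxy
    simp only [e, toLex_inj, Prod.mk.injEq] at hxy
    have : c = d := by
      have := hxy.1
      cases c <;> cases d <;> simp_all [shift]
    rw [this, hxy.2]
  let _ : LinearOrder (Color × Fin N) := LinearOrder.lift' e he
  let _ : Fintype Color := ⟨{.white, .black, .grey}, fun c => by cases c <;> simp⟩
  have hlt : ∀ c x y, ((c, x) : Color × Fin N) < (c, y) ↔ x < y := by
    intro c x y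
    change e (c, x) < e (c, y) ↔ x < y
    simp [e, Prod.Lex.toLex_lt_toLex]
  have hle : ∀ c x y, ((c, x) : Color × Fin N) ≤ (c, y) ↔ x ≤ y := by
    intro c x y
    rw [← not_lt, hlt, not_lt]
  let src : Color × Fin N → Color × ℕ := fun x => (x.1, h.interval x.1 x.2)
  have hnn := Color.next_next_next
  -- The boundary walk goes backwards in the cyclic order of the colors, and `c.next.next` is the
  -- color before c. The arc keeps its triangle, with the label of the new color.
  let φ : Equiv.Perm (Color × Fin N) :=
    { toFun := fun x => (x.1.next.next, E x.1.next.next ((E x.1)⁻¹ x.2))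
      invFun := fun x => (x.1.next, E x.1.next ((E x.1)⁻¹ x.2))
      left_inv := fun x => by
        simp only [hnn, perm_inv_apply, perm_apply_inv]
      right_inv := fun x => by
        simp only [hnn, perm_inv_apply, perm_apply_inv] }
  obtain ⟨ρ, hρ⟩ := τ.exists_depth
  have hr : τ.dcount .white < τ.vcount .white := by rw [τ.vcount_white]; omega
  obtain ⟨p, hnd, hall, ⟨e₀, he₀, hsrc₀⟩, ⟨e₁, he₁, hsrc₁⟩, hch, hpw⟩ :=
    exists_tour src φ (.white, τ.dcount .white)
      ⟨(.white, en .white (τ.dcount .white)), by simp only [src, h.interval_en hr]⟩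
      (fun v => ρ v.1 v.2) (by
        rintro ⟨c, x⟩ hmax hne
        obtain ⟨d, rfl⟩ : ∃ d : Color, d.next = c := ⟨c.next.next, hnn c⟩
        have hk := h.interval_lt d.next x
        set k := h.interval d.next x with hkdef
        have hx : x = en d.next k := by
          apply le_antisymm ((h.interval_le_iff hk).1 le_rfl)
          rw [← hle d.next]
          apply hmax
          simp only [src, h.interval_en hk, ← hkdef]
        have hkd : k < τ.dcount d.next := by
          rcases τ.lt_dcount_or hk with h1 | ⟨h1, h2⟩
          · exact h1
          · exact absurd (by simp only [src]; rw [← hkdef, h2, h1]) hne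
        obtain ⟨i, hi, h1, h2⟩ := τ.exists_parent hkd
        -- The last arc leaving a non-root interval is its end, which by `h.kid` arrives at the
        -- child position of this vertex, inside the interval of its parent.
        have h3 : φ (d.next, x) = (d, kp d k) := by
          change (d.next.next.next, E d.next.next.next ((E d.next)⁻¹ x)) = _
          rw [hnn, hx, ← h.kid d k hkd, perm_apply_inv]
        rw [h3]
        simp only [src, h.interval_kp hi hkd h1 h2, ← hkdef]
        exact hρ d i hi k h1 h2)
  have hlen : p.length = 3 * N := by
    rw [← List.toFinset_card_of_nodup hnd]
    have : p.toFinset = Finset.univ := by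
      ext x
      simpa using hall x
    rw [this, Finset.card_univ, Fintype.card_prod, Fintype.card_fin]
    rfl
  have hN := NeZero.pos N
  have hchain : ∀ i, ∀ hi : i + 1 < p.length,
      src p[i + 1] = src (φ p[i]) := fun i hi => List.isChain_iff_getElem.1 hch i hi
  have hcol : ∀ i, ∀ hi : i + 1 < p.length, (p[i + 1]).1 = (p[i]).1.next.next := fun i hi =>
    congrArg Prod.fst (hchain i hi)
  have h0 : p[0] = e₀ := by
    rw [List.head?_eq_getElem?, List.getElem?_eq_getElem (by omega)] at he₀
    exact Option.some.inj he₀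
  have hwhite : ∀ l, ∀ hl : 3 * l < p.length, (p[3 * l]).1 = .white := by
    intro l
    induction l with
    | zero =>
      intro hl
      simp only [Nat.mul_zero, h0]
      exact congrArg Prod.fst hsrc₀
    | succ l ih =>
      intro hl
      have h1 := hcol (3 * l + 2) (by omega)
      rw [hcol (3 * l + 1) (by omega), hcol (3 * l) (by omega), ih (by omega)] at h1
      exact h1
  have hshift : ∀ c (l : Fin N), 3 * l.val + shift c < p.length := by
    intro c l
    have := l.isLt
    have : shift c ≤ 2 := by cases c <;> simp [shift]
    omega
  have hcolor : ∀ c (l : Fin N), (p[3 * l.val + shift c]'(hshift c l)).1 = c := by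
    intro c l
    have h1 := hwhite l.val (by have := hshift .white l; simpa [shift] using this)
    have h2 := hcol (3 * l.val) (by have := hshift .grey l; simpa [shift] using this)
    have h3 := hcol (3 * l.val + 1) (by have := hshift .black l; simpa [shift] using this)
    rw [h1] at h2
    rw [h2] at h3
    cases c
    · exact h1
    · exact h3
    · exact h2
  -- The tour passes white, grey, black in turn, and its arc number 3l + `shift c` carries the new
  -- label of the traversal label l of color c.
  let f : Color → Fin N → Fin N := fun c l => (p[3 * l.val + shift c]'(hshift c l)).2
  have hpf : ∀ c l, p[3 * l.val + shift c]'(hshift c l) = (c, f c l) := fun c l =>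
    Prod.ext (hcolor c l) rfl
  have hinj : ∀ c, Function.Injective (f c) := by
    intro c l l' hll
    have h1 : p[3 * l.val + shift c]'(hshift c l) = p[3 * l'.val + shift c]'(hshift c l') := by
      rw [hpf, hpf, hll]
    have := hnd.getElem_inj_iff.1 h1
    exact Fin.ext (by omega)
  refine ⟨fun c => Equiv.ofBijective (f c) (Finite.injective_iff_bijective.1 (hinj c)), ?_, ?_, ?_⟩
  · intro c l l' hll hint
    have h1 := List.pairwise_iff_getElem.1 hpw _ _ (hshift c l) (hshift c l')
      (by rw [Fin.lt_def] at hll; omega)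
    rw [hpf, hpf, hlt] at h1
    apply h1
    simp only [src]
    exact congrArg _ hint
  · have hstep : ∀ c (l m : Fin N), 3 * l.val + shift c = 3 * m.val + shift c.next + 1 →
        h.interval c (f c l) = h.interval c (E c ((E c.next)⁻¹ (f c.next m))) := by
      intro c l m hlm
      have h1 := hchain (3 * m.val + shift c.next) (by rw [← hlm]; exact hshift c l)
      simp only [← hlm, hpf] at h1
      have h2 := congrArg Prod.snd h1
      have h3 : φ (c.next, f c.next m) = (c, E c ((E c.next)⁻¹ (f c.next m))) := by
        change (c.next.next.next, E c.next.next.next ((E c.next)⁻¹ (f c.next m))) = _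
        rw [hnn]
      rw [h3] at h2
      exact h2
    intro c m
    simp only [Equiv.ofBijective_apply]
    cases c
    · by_cases hm : m.val + 1 < N
      · apply hstep
        rw [step, val_finRotate, if_pos hm]
        simp only [shift, Color.next]
        ring
      -- The wrap-around: the last arc of the tour is black and returns to the root, where the tour
      -- began.
      · have h1 : step N .white m = 0 := Fin.ext (by
          rw [step, val_finRotate, if_neg hm]
          rfl)
        have h2 : f .white 0 = e₀.2 := by
          change (p[3 * (0 : Fin N).val + shift .white]'(hshift .white 0)).2 = e₀.2
          simp only [Fin.val_zero, shift, Nat.mul_zero, Nat.add_zero, h0]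
        have h3 : e₁ = (.black, f .black m) := by
          rw [← hpf]
          rw [List.getLast?_eq_getElem?, List.getElem?_eq_getElem (by omega)] at he₁
          have h4 := Option.some.inj he₁
          have h5 : p.length - 1 = 3 * m.val + shift .black := by
            have := m.isLt
            simp only [shift]
            omega
          simp only [h5] at h4
          exact h4.symm
        rw [h1, h2]
        have h4 := congrArg Prod.snd hsrc₀
        have h5 := congrArg Prod.snd hsrc₁
        rw [h3] at h5
        have h6 := congrArg Prod.fst hsrc₀
        simp only [src] at h4 h6
        rw [h6] at h4
        exact h4.trans h5.symm
    · apply hstep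
      simp [step, shift, Color.next]
    · apply hstep
      simp [step, shift, Color.next]
  · have h2 : f .white 0 = e₀.2 := by
      change (p[3 * (0 : Fin N).val + shift .white]'(hshift .white 0)).2 = e₀.2
      simp only [Fin.val_zero, shift, Nat.mul_zero, Nat.add_zero, h0]
    simp only [Equiv.ofBijective_apply, h2]
    have h4 := congrArg Prod.snd hsrc₀
    have h6 := congrArg Prod.fst hsrc₀
    simp only [src] at h4 h6
    rw [h6] at h4
    exact h4

end

end IsModel

end Cacti

namespace Cacti

open FiveTuple

/-! ### Realization of a model by a partitioned cactus -/

variable {N : ℕ} {τ : CactusTree} {en kp : Color → ℕ → Fin N} {E L : Color → Equiv.Perm (Fin N)}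

/-- The labels of the triangles in a relabelled cactus, given the white relabelling. -/
def triangleLabel (E L : Color → Equiv.Perm (Fin N)) (c : Color) : Equiv.Perm (Fin N) :=
  E c * L .white

/-- `C` is a partitioned cactus with the given relabelled cactus and relabelling
permutations `L`. -/
structure Realizes [NeZero N] (h : IsModel τ en kp E) (C : FiveTuple N)
    (L : Color → Equiv.Perm (Fin N)) : Prop where
  lt_of_lt : ∀ c l l', l < l' → h.interval c (L c l) = h.interval c (L c l') → L c l < L c l'
  root : h.interval .white (L .white 0) = τ.dcount .white
  cactus : C.IsCactus
  trav : ∀ c t, L c (C.trav c t) = triangleLabel E L c t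
  mem_block : ∀ c s t, s ∈ C.block c t ↔
    h.interval c (triangleLabel E L c s) = h.interval c (triangleLabel E L c t)

/-- The blocks are the classes of triangles whose labels lie in the same interval, and the tour
gives the traversal labels. Its successor property, combined with `trav_perm`, says that each
permutation preserves the blocks of its color. -/
theorem IsModel.exists_realizes [NeZero N] (h : IsModel τ en kp E) :
    ∃ (C : FiveTuple N) (L : Color → Equiv.Perm (Fin N)), Realizes h C L := by
  classical
  obtain ⟨L, h1, h2, h3⟩ := h.exists_traversal
  let θ : Color → Equiv.Perm (Fin N) := fun c => (L c)⁻¹ * triangleLabel E L c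
  let P : Color → Finpartition (Finset.univ : Finset (Fin N)) := fun c =>
    Finpartition.ofSetoid (Setoid.ker fun t => h.interval c (triangleLabel E L c t))
  -- These permutations are forced by requiring the traversal labellings to be θ: then `α₃` is the
  -- inverse of the grey one, and `α₃⁻¹ * α₂⁻¹` is the black one.
  let C : FiveTuple N := ⟨P .white, P .black, P .grey, finRotate N * θ .black,
    (θ .black)⁻¹ * θ .grey⟩
  have hP : ∀ c, C.part c = P c := fun c => by cases c <;> rfl
  have hα : C.α₃ = (θ .grey)⁻¹ := by simp [C, α₃, mul_assoc]
  have hθ : ∀ c, C.trav c = θ c := by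
    intro c
    cases c
    · simp [FiveTuple.trav, θ, triangleLabel, h.white]
    · simp only [FiveTuple.trav, hα]
      simp [C]
    · simp only [FiveTuple.trav, hα, inv_inv]
  have htrav : ∀ c t, L c (C.trav c t) = triangleLabel E L c t := by
    intro c t
    rw [hθ]
    exact perm_apply_inv (L c) _
  have hmem : ∀ c s t, s ∈ C.block c t ↔
      h.interval c (triangleLabel E L c s) = h.interval c (triangleLabel E L c t) := by
    intro c s t
    rw [block, hP, Finpartition.mem_part_ofSetoid_iff_rel]
    exact eq_comm
  refine ⟨C, L, h1, h3, fun c B hB x hx y hxy => ?_, htrav, hmem⟩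
  rw [mem_iff_block_eq hB] at hx
  rw [← hx, hmem, eq_comm]
  refine apply_eq_of_sameCycle (f := fun t => h.interval c (triangleLabel E L c t))
    (fun t => ?_) hxy
  have h4 := h2 c (C.trav c.next t)
  rw [← trav_perm, htrav, htrav] at h4
  simpa only [triangleLabel, Equiv.Perm.mul_apply, perm_inv_apply] using h4

/-- The triangles whose label of color `c` is in the `k`-th interval. -/
def IsModel.blockOf (h : IsModel τ en kp E) (L : Color → Equiv.Perm (Fin N)) (c : Color) (k : ℕ) :
    Finset (Fin N) :=
  Finset.univ.filter fun t => h.interval c (triangleLabel E L c t) = k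

namespace Realizes

variable [NeZero N] {h : IsModel τ en kp E} {C : FiveTuple N} (hR : Realizes h C L) {c : Color}
include hR

theorem block_eq (c : Color) (t : Fin N) :
    C.block c t = h.blockOf L c (h.interval c (triangleLabel E L c t)) := by
  ext s
  simp [hR.mem_block, IsModel.blockOf]

omit [NeZero N] hR in
theorem mem_blockOf {k : ℕ} {t : Fin N} :
    t ∈ h.blockOf L c k ↔ h.interval c (triangleLabel E L c t) = k := by
  simp [IsModel.blockOf]

theorem blockOf_eq {k : ℕ} (hk : k < τ.vcount c) :
    h.blockOf L c k = C.block c ((triangleLabel E L c)⁻¹ (en c k)) := by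
  rw [hR.block_eq, perm_apply_inv, h.interval_en hk]

theorem blockOf_mem {k : ℕ} (hk : k < τ.vcount c) : h.blockOf L c k ∈ (C.part c).parts := by
  rw [hR.blockOf_eq hk]
  exact C.block_mem c _

omit [NeZero N] hR in
theorem blockOf_injOn {k k' : ℕ} (hk : k < τ.vcount c)
    (he : h.blockOf L c k = h.blockOf L c k') : k = k' := by
  have h1 : (triangleLabel E L c)⁻¹ (en c k) ∈ h.blockOf L c k := by
    rw [mem_blockOf, perm_apply_inv, h.interval_en hk]
  have h2 := h1
  rw [he, mem_blockOf] at h2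
  rw [mem_blockOf] at h1
  omega

theorem exists_blockOf_eq {B : Finset (Fin N)} (hB : B ∈ (C.part c).parts) :
    ∃ k < τ.vcount c, h.blockOf L c k = B := by
  obtain ⟨t, rfl⟩ := exists_block_eq hB
  exact ⟨_, h.interval_lt c _, (hR.block_eq c t).symm⟩

theorem root_eq_blockOf : C.root = h.blockOf L .white (τ.dcount .white) := by
  rw [root_eq, hR.block_eq, triangleLabel, h.white, one_mul, hR.root]

theorem mem_nonRoot_iff {B : Finset (Fin N)} :
    B ∈ C.nonRoot c ↔ ∃ k < τ.dcount c, h.blockOf L c k = B := by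
  rw [mem_nonRoot, hR.root_eq_blockOf]
  constructor
  · rintro ⟨hB, hr⟩
    obtain ⟨k, hk, rfl⟩ := hR.exists_blockOf_eq hB
    rcases τ.lt_dcount_or hk with h1 | ⟨rfl, rfl⟩
    · exact ⟨k, h1, rfl⟩
    · exact absurd ⟨rfl, rfl⟩ hr
  · rintro ⟨k, hk, rfl⟩
    have hk' := hk.trans_le (τ.dcount_le c)
    refine ⟨hR.blockOf_mem hk', ?_⟩
    rintro ⟨rfl, he⟩
    exact hk.ne (blockOf_injOn hk' he)

theorem trav_lt {s t : Fin N}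
    (he : h.interval c (triangleLabel E L c s) = h.interval c (triangleLabel E L c t)) :
    C.trav c s < C.trav c t ↔ triangleLabel E L c s < triangleLabel E L c t := by
  have key : ∀ {s t : Fin N},
      h.interval c (triangleLabel E L c s) = h.interval c (triangleLabel E L c t) →
      C.trav c s < C.trav c t → triangleLabel E L c s < triangleLabel E L c t := by
    intro s t he hlt
    simp only [← hR.trav] at he ⊢
    exact hR.lt_of_lt c _ _ hlt he
  refine ⟨key he, fun hlt => ?_⟩
  by_contra hn
  rcases (not_lt.1 hn).lt_or_eq with h1 | h1
  · exact hlt.asymm (key he.symm h1)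
  · rw [(C.trav c).injective h1] at hlt
    exact lt_irrefl _ hlt

theorem lastPassage_blockOf {k : ℕ} (hk : k < τ.vcount c) :
    C.lastPassage c (h.blockOf L c k) = (triangleLabel E L c)⁻¹ (en c k) := by
  have h0 : h.interval c (triangleLabel E L c ((triangleLabel E L c)⁻¹ (en c k))) = k := by
    rw [perm_apply_inv, h.interval_en hk]
  rw [lastPassage, maxLabel_eq (t := (triangleLabel E L c)⁻¹ (en c k)) (mem_blockOf.2 h0),
    perm_inv_apply]
  intro s hs
  rw [mem_blockOf] at hs
  rw [← not_lt, hR.trav_lt (h0.trans hs.symm), perm_apply_inv, not_lt, ← h.interval_le_iff hk]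
  exact hs.le

theorem triangleLabel_lastPassage {j : ℕ} (hj : j < τ.dcount c.next) :
    triangleLabel E L c (C.lastPassage c.next (h.blockOf L c.next j)) = kp c j := by
  rw [hR.lastPassage_blockOf (hj.trans_le (τ.dcount_le _))]
  have h1 := h.kid c j hj
  rw [Equiv.Perm.inv_eq_iff_eq] at h1
  simp only [triangleLabel, mul_inv_rev, Equiv.Perm.mul_apply, perm_apply_inv, ← h1]

theorem children_blockOf {k : ℕ} (hk : k < τ.vcount c) :
    C.children c (h.blockOf L c k) =
      (List.range' (τ.kidStart c k) (τ.kidStart c (k + 1) - τ.kidStart c k)).map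
        (h.blockOf L c.next) := by
  have hle : τ.kidStart c (k + 1) ≤ τ.dcount c.next := τ.kidStart_le hk
  have hmono := τ.kidStart_mono c (Nat.le_succ k)
  apply eq_children
  · rw [List.pairwise_map]
    refine List.Pairwise.imp_of_mem (fun {j j'} hj hj' hlt => ?_) List.pairwise_lt_range'
    rw [List.mem_range'_1] at hj hj'
    have hd : j < τ.dcount c.next := by omega
    have hd' : j' < τ.dcount c.next := by omega
    rw [hR.trav_lt, hR.triangleLabel_lastPassage hd, hR.triangleLabel_lastPassage hd']
    · exact (h.spine c).kp_lt _ _ hlt hd'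
    · rw [hR.triangleLabel_lastPassage hd, hR.triangleLabel_lastPassage hd',
        h.interval_kp hk hd (by omega) (by omega), h.interval_kp hk hd' (by omega) (by omega)]
  · intro D
    rw [List.mem_map, hR.mem_nonRoot_iff]
    constructor
    · rintro ⟨j, hj, rfl⟩
      rw [List.mem_range'_1] at hj
      have hd : j < τ.dcount c.next := by omega
      refine ⟨⟨j, hd, rfl⟩, ?_⟩
      rw [mem_blockOf, hR.triangleLabel_lastPassage hd]
      exact h.interval_kp hk hd (by omega) (by omega)
    · rintro ⟨⟨j, hd, rfl⟩, hD⟩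
      rw [mem_blockOf, hR.triangleLabel_lastPassage hd, h.interval_kp_iff hk hd] at hD
      refine ⟨j, ?_, rfl⟩
      rw [List.mem_range'_1]
      omega

/-- The blocks in the order of their intervals solve the listing equation, because the children of
consecutive vertices are numbered by consecutive ranges. -/
theorem reverseLabelled_eq (c : Color) :
    C.reverseLabelled c = (List.range (τ.vcount c)).map (h.blockOf L c) := by
  refine (hR.cactus.eq_reverseLabelled (A := fun c =>
    (List.range (τ.vcount c)).map (h.blockOf L c)) ?_ ?_ c).symm
  · intro c
    have h1 : ((List.range (τ.vcount c)).map (h.blockOf L c)).flatMap (C.children c) =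
        (List.range (τ.dcount c.next)).map (h.blockOf L c.next) := by
      rw [← τ.kidStart_vcount c, ← flatMap_range' (τ.kidStart_mono c) (τ.kidStart_zero c),
        List.flatMap_map, List.map_flatMap]
      exact List.flatMap_congr fun k hk => hR.children_blockOf (List.mem_range.1 hk)
    rw [h1]
    cases c
    · simp [Color.next, rootList, τ.vcount_black]
    · simp [Color.next, rootList, τ.vcount_grey]
    · simp [Color.next, rootList, τ.vcount_white, List.range_succ, hR.root_eq_blockOf]
  · intro c B hB
    obtain ⟨k, hk, rfl⟩ := List.mem_map.1 hB
    exact hR.blockOf_mem (List.mem_range.1 hk)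

theorem nthBlock_eq_blockOf {k : ℕ} (hk : k < τ.vcount c) :
    C.nthBlock c k = h.blockOf L c k := by
  rw [nthBlock, hR.reverseLabelled_eq, List.getD_eq_getElem _ _ (by simpa using hk)]
  simp

theorem blockIdx_eq (c : Color) (t : Fin N) :
    C.blockIdx c t = h.interval c (triangleLabel E L c t) := by
  have hk := h.interval_lt c (triangleLabel E L c t)
  rw [hR.cactus.blockIdx_eq_iff (by simpa [hR.reverseLabelled_eq] using hk),
    hR.nthBlock_eq_blockOf hk, mem_blockOf]

/-- Both labellings order the triangles by interval and then by traversal label, and a strictly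
increasing permutation of [N] is the identity. -/
theorem newLabel_eq_triangleLabel (c : Color) : C.newLabel c = triangleLabel E L c := by
  have key : ∀ s t, triangleLabel E L c s < triangleLabel E L c t →
      C.newLabel c s < C.newLabel c t := by
    intro s t hst
    rw [newLabel_lt_iff, hR.blockIdx_eq, hR.blockIdx_eq]
    rcases (h.interval_mono hst.le).lt_or_eq with h1 | h1
    · exact .inl h1
    · exact .inr ⟨h1, (hR.trav_lt h1).2 hst⟩
  have hm : StrictMono (C.newLabel c * (triangleLabel E L c)⁻¹) := by
    intro x y hxy
    apply key
    simpa only [perm_apply_inv] using hxy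
  have := hm.range_inj (g := id) strictMono_id |>.1 (by
    rw [Set.range_id, (C.newLabel c * (triangleLabel E L c)⁻¹).surjective.range_eq])
  ext t
  have h1 := congrFun this (triangleLabel E L c t)
  simp only [Equiv.Perm.mul_apply, perm_inv_apply, id_eq] at h1
  rw [h1]

theorem transfer_eq : C.transfer = E := by
  funext c
  rw [transfer, hR.newLabel_eq_triangleLabel, hR.newLabel_eq_triangleLabel, triangleLabel,
    triangleLabel, h.white]
  group

theorem newEnd_eq {k : ℕ} (hk : k < τ.vcount c) : C.newEnd c k = en c k := by
  rw [newEnd, hR.nthBlock_eq_blockOf hk, hR.newLabel_eq_triangleLabel,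
    hR.lastPassage_blockOf hk, perm_apply_inv]

theorem newKid_eq {j : ℕ} (hj : j < τ.dcount c.next) : C.newKid c j = kp c j := by
  rw [newKid, hR.nthBlock_eq_blockOf (hj.trans_le (τ.dcount_le _)),
    hR.newLabel_eq_triangleLabel, hR.triangleLabel_lastPassage hj]

theorem isTop_blockOf {k : ℕ} (hk : k < τ.dcount c) :
    C.isTop c (h.blockOf L c k) = true ↔ τ.Flagged c k := by
  have hk' := hk.trans_le (τ.dcount_le c)
  rw [isTop_iff_exists_nonRoot (hR.blockOf_mem hk'), (h.spine c).flag k hk]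
  constructor
  · rintro ⟨D, hD, he⟩
    obtain ⟨j, hj, rfl⟩ := hR.mem_nonRoot_iff.1 hD
    refine ⟨j, hj, ?_⟩
    rw [← hR.triangleLabel_lastPassage hj, he, hR.lastPassage_blockOf hk', perm_apply_inv]
  · rintro ⟨j, hj, he⟩
    refine ⟨_, hR.mem_nonRoot_iff.2 ⟨j, hj, rfl⟩, (triangleLabel E L c).injective ?_⟩
    rw [hR.triangleLabel_lastPassage hj, he, hR.lastPassage_blockOf hk', perm_apply_inv]

/-- Induction on a bound for the rank, which is smaller for children; a cactus tree is determined by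
its children (`kids_injective`). -/
theorem getElem?_verts_eq_vertex (n : ℕ) : ∀ c, ∀ k < τ.vcount c,
    C.rank c (h.blockOf L c k) < n →
      (τ.verts c)[k]? = some (C.vertex c (h.blockOf L c k)) := by
  induction n with
  | zero => intro c k _ hn; omega
  | succ n ih =>
    intro c k hk hn
    obtain ⟨v, hv⟩ : ∃ v, (τ.verts c)[k]? = some v := ⟨_, List.getElem?_eq_getElem hk⟩
    have hs := τ.kidStart_succ hv
    have hle : τ.kidStart c (k + 1) ≤ τ.dcount c.next := τ.kidStart_le hk
    have hd := τ.dcount_le c.next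
    have h1 : v.1 = C.subtree c (h.blockOf L c k) := by
      apply CactusTree.kids_injective
      rw [hR.cactus.kids_subtree, hR.children_blockOf hk, List.map_map]
      refine List.ext_getElem (by simp [hs]) fun o ho ho' => ?_
      have h2 := τ.getElem?_verts_kid hv ho
      rw [ih c.next _ (by omega) ?_, Option.some.injEq] at h2
      · rw [← h2]
        simp
      · have : h.blockOf L c.next (τ.kidStart c k + o) ∈ C.children c (h.blockOf L c k) := by
          rw [hR.children_blockOf hk]
          exact List.mem_map_of_mem (List.mem_range'_1.2 (by omega))
        have := hR.cactus.rank_children_lt (hR.blockOf_mem hk) this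
        omega
    rw [hv, vertex, ← h1]
    congr 1
    refine Prod.ext rfl ?_
    rcases τ.lt_dcount_or hk with h2 | ⟨rfl, rfl⟩
    · have h3 := (mem_nonRoot.1 (hR.mem_nonRoot_iff.2 ⟨k, h2, rfl⟩)).2
      rw [if_neg h3, Bool.eq_iff_iff, hR.isTop_blockOf h2, CactusTree.Flagged, hv]
      constructor
      · intro h4
        exact ⟨v.1, by rw [← h4]⟩
      · rintro ⟨s, h4⟩
        rw [Option.some.inj h4]
    · rw [if_pos ⟨rfl, hR.root_eq_blockOf.symm⟩]
      rw [τ.getElem?_verts_root] at hv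
      rw [← Option.some.inj hv]

theorem tree_eq : C.tree = τ := by
  have hd : τ.dcount .white < τ.vcount .white := by
    rw [τ.vcount_white]
    omega
  have h1 := hR.getElem?_verts_eq_vertex _ .white _ hd (Nat.lt_succ_self _)
  rw [τ.getElem?_verts_root, ← hR.root_eq_blockOf, vertex_root] at h1
  exact (congrArg Prod.fst (Option.some.inj h1)).symm

end Realizes

/-! ### Assembly of the bijection -/

theorem IsModel.exists_theta_eq [NeZero N] (h : IsModel τ en kp E) :
    ∃ C : FiveTuple N, C.IsCactus ∧ Theta C = encode τ en kp E := by
  obtain ⟨C, L, hR⟩ := h.exists_realizes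
  refine ⟨C, hR.cactus, ?_⟩
  rw [hR.cactus.theta_eq_encode, hR.tree_eq, hR.transfer_eq]
  exact encode_congr (fun c k hk => hR.newEnd_eq hk) (fun c j hj => hR.newKid_eq hj)

theorem FiveTuple.IsCactus.card_parts [NeZero N] {C : FiveTuple N} (hC : C.IsCactus) (c : Color) :
    (C.part c).parts.card = (Theta C).τ.numVertices c .white := by
  rw [← hC.length_reverseLabelled, hC.length_eq_vcount, CactusTree.vcount_eq]
  rfl

end Cacti

theorem theorem2 (p₁ p₂ p₃ N : ℕ) [NeZero N] :
    Set.BijOn (Cacti.Theta (N := N)) (Cacti.CC p₁ p₂ p₃ N) (Cacti.I p₁ p₂ p₃ N) := by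
  refine ⟨fun C hC => ?_, fun C hC C' hC' he => ?_, fun X hX => ?_⟩
  · obtain ⟨hC, h1, h2, h3⟩ := Cacti.FiveTuple.mem_CC_iff.1 hC
    rw [← h1, ← h2, ← h3, hC.card_parts, hC.card_parts, hC.card_parts]
    simp only [← Cacti.CactusTree.vcount_eq]
    have := hC.isModel.encode_mem
    rw [← hC.theta_eq_encode] at this
    exact this
  · have hC := (Cacti.FiveTuple.mem_CC_iff.1 hC).1
    have hC' := (Cacti.FiveTuple.mem_CC_iff.1 hC').1
    have ht : C.tree = C'.tree := congrArg Cacti.SevenTuple.τ he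
    have h' := hC'.isModel
    rw [hC.theta_eq_encode, hC'.theta_eq_encode, ← ht] at he
    rw [← ht] at h'
    obtain ⟨h1, h2⟩ := hC.isModel.encode_inj h' he
    exact Cacti.FiveTuple.SameModel.eq ⟨hC, hC', ht, h1, h2⟩
  · obtain ⟨en, kp, E, h, hen⟩ := Cacti.exists_isModel hX
    obtain ⟨C, hC, he⟩ := h.exists_theta_eq
    obtain ⟨a, b, c, ⟨h1, h2, h3, -⟩, -⟩ := hX
    refine ⟨C, Cacti.FiveTuple.mem_CC_iff.2 ⟨hC, ?_⟩, ?_⟩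
    · rw [hC.card_parts, hC.card_parts, hC.card_parts, he, hen]
      exact ⟨h1, h2, h3⟩
    · exact he.trans hen
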